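/- Fix an integer $q>2$. The mean-field Potts measure on $\{1,\dots,q\}^n$ at inverse temperature $\beta$ is $\pi(\sigma)\propto\exp\big(-\frac{\beta}{n}\,\#\{\{i,j\}:\sigma_i\neq\sigma_j\}\big)$ (unordered pairs of vertices). Its Glauber dynamics $(\sigma_t)_{t\ge 0}$ at each step picks a uniformly random vertex $v$ and gives it a new spin, drawn from the conditional law given all other spins, i.e. spin $k$ with probability proportional to $\exp\big(\frac{\beta}{n}\#\{j\ne v:\sigma_j=k\}\big)$. Let $S(\sigma)\in[0,1]^q$ be the vector of the proportions of vertices of each spin, and put $$D_\beta(x)=\Big(1+(q-1)e^{\beta\frac{1-qx}{q-1}}\Big)^{-1}-x,\qquad \beta_{\mathsf u}=\sup\{\beta\ge 0: D_\beta(x)\ne 0\ \ \forall x\in(1/q,1)\},\qquad \beta_{\mathsf s}=q .$$ For $\beta\in(\beta_{\mathsf u},\beta_{\mathsf s})$ let $m_*<m_{\mathsf r}$ be the two zeros of $D_\beta$ in $(1/q,1)$. For $k\in\{1,\dots,q\}$ and $m\in[0,1]$ let $v_k(m)\in\mathbb R^q$ have $k$-th entry $m$ and all other entries $\frac{1-m}{q-1}$.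 For a sequence $\delta_n\to 0$ let $$\Omega^{\mathsf{dis}}=\{\sigma:\|S(\sigma)-(\tfrac1q,\dots,\tfrac1q)\|_1\le\delta_n\},\qquad \Omega^{\mathsf{ord},k}=\{\sigma:\|S(\sigma)-v_k(m_{\mathsf r})\|_1\le\delta_n\},$$ and, when these sets are non-empty, $\pi^{\mathsf{dis}}=\pi(\cdot\mid\Omega^{\mathsf{dis}})$ and $\pi^{\mathsf{ord},k}=\pi(\cdot\mid\Omega^{\mathsf{ord},k})$. **Theorem.** Let $q>2$ and $\beta\in(\beta_{\mathsf u},\beta_{\mathsf s})$. There are constants $c,C,\gamma_0>0$, depending only on $q$ and $\beta$, such that for every $\gamma\ge\gamma_0$, every $K$ and every sequence $\delta_n\to0$ the following holds for all sufficiently large $n$ (depending on $q,\beta,\gamma,K,(\delta_n)$). Let $k\in\{1,\dots,q\}$ (for instance $k=1$), and let $\sigma_0$ be a configuration such that, with $m=S_k(\sigma_0)$, $$\|S(\sigma_0)-v_k(m)\|_1\le K n^{-1/2}\log n .$$ 1. If $\frac1q<m\le m_*-\gamma n^{-1/2}$ and $\Omega^{\mathsf{dis}}\neq\emptyset$, then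 there is an integer $0\le T\le C n\log n$ such that, for the Glauber dynamics $(\sigma_t)$ started from $\sigma_0$ and $(\sigma'_t)$ started from $\sigma_0'\sim\pi^{\mathsf{dis}}$, $$\big\|\mathbb P_{\sigma_0}(S(\sigma_T)\in\cdot)-\mathbb P_{\sigma_0'}(S(\sigma_T')\in\cdot)\big\|_{\mathrm{TV}}\le e^{-c\gamma^2}.$$ 2. If $m\ge m_*+\gamma n^{-1/2}$ and $\Omega^{\mathsf{ord},k}\neq\emptyset$, then the same conclusion holds with $\sigma_0'\sim\pi^{\mathsf{ord},k}$. -/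

import Mathlib

namespace MeanFieldPotts

noncomputable section

/-- Spin configurations of the `q`-state Potts model on `n` vertices. -/
abbrev Config (n q : ℕ) : Type := Fin n → Fin q

/-- The number of edges of the complete graph on `n` vertices whose endpoints have different
spins (every unordered pair is counted once). -/
def disagreements {n q : ℕ} (σ : Config n q) : ℕ :=
  ((Finset.univ : Finset (Fin n × Fin n)).filter
    (fun e => e.1 < e.2 ∧ σ e.1 ≠ σ e.2)).card

/-- The unnormalized Potts weight `exp (-(β / n) * #{disagreeing edges})`. -/
def pottsWeight (n q : ℕ) (β : ℝ) (σ : Config n q) : ℝ :=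
  Real.exp (-(β / n) * disagreements σ)

/-- The mean-field Potts measure `π`, as a probability mass function on configurations. -/
def pottsMeasure (n q : ℕ) (β : ℝ) (σ : Config n q) : ℝ :=
  pottsWeight n q β σ / ∑ τ : Config n q, pottsWeight n q β τ

/-- The number of vertices other than `v` that have spin `k`. -/
def othersWithSpin {n q : ℕ} (σ : Config n q) (v : Fin n) (k : Fin q) : ℕ :=
  ((Finset.univ : Finset (Fin n)).filter (fun j => j ≠ v ∧ σ j = k)).card

/-- The probability that the resampled spin at `v` is `k`: the Potts conditional law of the spin
at `v` given all other spins. -/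
def resampleProb (n q : ℕ) (β : ℝ) (σ : Config n q) (v : Fin n) (k : Fin q) : ℝ :=
  Real.exp (β / n * othersWithSpin σ v k) /
    ∑ l : Fin q, Real.exp (β / n * othersWithSpin σ v l)

/-- The transition matrix of the Glauber dynamics: a uniformly random vertex has its spin
resampled. -/
def glauber (n q : ℕ) (β : ℝ) : Matrix (Config n q) (Config n q) ℝ :=
  Matrix.of fun σ τ =>
    (1 / (n : ℝ)) * ∑ v : Fin n, ∑ k : Fin q,
      if τ = Function.update σ v k then resampleProb n q β σ v k else 0

/-- The law of the Glauber dynamics after `t` steps, when the starting law is `μ`. -/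
def glauberLaw (n q : ℕ) (β : ℝ) (μ : Config n q → ℝ) (t : ℕ) : Config n q → ℝ :=
  Matrix.vecMul μ (glauber n q β ^ t)

/-- The proportions vector `S(σ)`: entry `k` is the fraction of vertices of spin `k`. -/
def proportions {n q : ℕ} (σ : Config n q) : Fin q → ℝ :=
  fun k => (((Finset.univ : Finset (Fin n)).filter (fun v => σ v = k)).card : ℝ) / n

/-- The `ℓ¹` distance of two vectors. -/
def l1Dist {q : ℕ} (x y : Fin q → ℝ) : ℝ := ∑ i, |x i - y i|

/-- The vector with entry `m` at position `k`, all other entries being `(1 - m) / (q - 1)`. -/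
def dominated {q : ℕ} (k : Fin q) (m : ℝ) : Fin q → ℝ :=
  fun i => if i = k then m else (1 - m) / ((q : ℝ) - 1)

/-- The drift function `D_β` of a dominant proportion `x`. -/
def drift (q : ℕ) (β x : ℝ) : ℝ :=
  (1 + ((q : ℝ) - 1) * Real.exp (β * ((1 - q * x) / ((q : ℝ) - 1))))⁻¹ - x

/-- The threshold `β_u`. -/
def betaU (q : ℕ) : ℝ :=
  sSup {β : ℝ | 0 ≤ β ∧ ∀ x ∈ Set.Ioo (1 / (q : ℝ)) 1, drift q β x ≠ 0}

/-- The threshold `β_s`. -/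
def betaS (q : ℕ) : ℝ := q

/-- The zeros of the drift function in `(1/q, 1)`; there are exactly two of them when
`2 < q` and `β_u < β < β_s`. -/
def driftZeros (q : ℕ) (β : ℝ) : Set ℝ :=
  {x | x ∈ Set.Ioo (1 / (q : ℝ)) 1 ∧ drift q β x = 0}

/-- The smaller zero `m_*` of the drift function in `(1/q, 1)`. -/
def mStar (q : ℕ) (β : ℝ) : ℝ := sInf (driftZeros q β)

/-- The larger zero `m_r` of the drift function in `(1/q, 1)`. -/
def mR (q : ℕ) (β : ℝ) : ℝ := sSup (driftZeros q β)

/-- The disordered phase with `ℓ¹` tolerance `δ`. -/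
def disPhase (n q : ℕ) (δ : ℝ) : Set (Config n q) :=
  {σ | l1Dist (proportions σ) (fun _ => 1 / (q : ℝ)) ≤ δ}

/-- The ordered phase dominated by spin `k`, with `ℓ¹` tolerance `δ`. -/
def ordPhase (n q : ℕ) (β : ℝ) (k : Fin q) (δ : ℝ) : Set (Config n q) :=
  {σ | l1Dist (proportions σ) (dominated k (mR q β)) ≤ δ}

/-- The probability of the event `E` under the mass function `μ` on a finite type. -/
def prob {Ω : Type*} [Fintype Ω] (μ : Ω → ℝ) (E : Set Ω) : ℝ := ∑ ω, E.indicator μ ω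

/-- The mass function of `μ (· ∣ E)`. -/
def condOn {Ω : Type*} [Fintype Ω] (μ : Ω → ℝ) (E : Set Ω) : Ω → ℝ :=
  fun ω => E.indicator μ ω / prob μ E

/-- The total-variation distance of the laws of the random variable `f` under `μ` and `ν`:
the supremum of `|μ (f ∈ A) - ν (f ∈ A)|` over all `A`. -/
def tvOf {Ω X : Type*} [Fintype Ω] (f : Ω → X) (μ ν : Ω → ℝ) : ℝ :=
  ⨆ A : Set X, |prob μ (f ⁻¹' A) - prob ν (f ⁻¹' A)|

/-- `π^dis = π (· ∣ Ω^dis)`. -/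
def piDis (n q : ℕ) (β δ : ℝ) : Config n q → ℝ :=
  condOn (pottsMeasure n q β) (disPhase n q δ)

/-- `π^{ord,k} = π (· ∣ Ω^{ord,k})`. -/
def piOrd (n q : ℕ) (β : ℝ) (k : Fin q) (δ : ℝ) : Config n q → ℝ :=
  condOn (pottsMeasure n q β) (ordPhase n q β k δ)

/-- The total-variation distance, at time `t`, of the proportions vectors of two Glauber dynamics
with starting laws `μ` and `ν`. -/
def proportionsTV (n q : ℕ) (β : ℝ) (μ ν : Config n q → ℝ) (t : ℕ) : ℝ :=
  tvOf (proportions (n := n) (q := q)) (glauberLaw n q β μ t) (glauberLaw n q β ν t)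

end

end MeanFieldPotts

/-!
Up to noise, the proportion `x` of the leading spin follows the flow of `drift` with step `1 / n`,
while the other proportions contract towards each other. Let `c = mStar` be the unstable zero, `p`
the target (`1 / q` or `mR`) and `L = |p - c|`.

*Escape.* At distance at least of order `n ^ (-1/2)` from `c` the drift beats the fluctuations, so
that `exp (-a n (x - c) ^ 2)` is nearly superharmonic; hence a chain started at distance
`γ / √n` falls back towards `c` with probability at most `exp (-Ω(γ ^ 2))`. As long as it does not,
`(L / |x - c| - 1) ^ 2` contracts in mean by a factor `1 - Ω(1 / n)` per step: the logistic flow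
`y' = λ y (L - y)` becomes linear in the variable `L / y - 1`. After `O(n log n)` steps the chain is
close to the target.

*Coupling.* Near the target the squared distance to it grows in mean by at most `O(1 / n ^ 2)` per
step, so both chains stay there for another `O(n log n)` steps. Resampling is a softmax of the
proportions, whose linearization at the target has `ℓ¹` norm `β q p (1 - p) / (q - 1) < 1` on the
relevant vectors; optimally coupled updates therefore contract the mean Hamming distance by a factor
`1 - Ω(1 / n)`, and the two chains coalesce.
-/

namespace MeanFieldPotts

noncomputable section

open Matrix Filter Topology

section FiniteMarkovChains

variable {Ω : Type*}

/-- A bound for the probability that `V` reaches the level `ρ` within `t` steps, when `V` grows in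
mean by at most `b` per step. -/
def exitBound (V : Ω → ℝ) (ρ b : ℝ) (t : ℕ) (ω : Ω) : ℝ := min 1 ((V ω + b * t) / ρ)

lemma exitBound_le (V : Ω → ℝ) (ρ b : ℝ) (t : ℕ) (ω : Ω) :
    exitBound V ρ b t ω ≤ (V ω + b * t) / ρ := min_le_right _ _

lemma exitBound_mem_Icc {V : Ω → ℝ} {ρ b : ℝ} (hV : ∀ ω, 0 ≤ V ω) (hρ : 0 ≤ ρ) (hb : 0 ≤ b)
    (t : ℕ) (ω : Ω) : exitBound V ρ b t ω ∈ Set.Icc (0 : ℝ) 1 :=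
  ⟨le_min zero_le_one (by have := hV ω; positivity), min_le_left _ _⟩

lemma exitBound_eq_one {V : Ω → ℝ} {ρ b : ℝ} (hρ : 0 < ρ) (hb : 0 ≤ b) {t : ℕ} {ω : Ω}
    (hω : ρ ≤ V ω) : exitBound V ρ b t ω = 1 := by
  refine min_eq_left ((one_le_div hρ).2 (hω.trans ?_))
  have : 0 ≤ b * t := by positivity
  linarith

variable [Fintype Ω]

section Stochastic

variable [DecidableEq Ω] {P : Matrix Ω Ω ℝ}

lemma mulVec_mono (hP : P ∈ rowStochastic ℝ Ω) {F G : Ω → ℝ} (h : F ≤ G) : P *ᵥ F ≤ P *ᵥ G :=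
  fun ω => dotProduct_le_dotProduct_of_nonneg_left h fun τ => hP.1 ω τ

lemma mulVec_const (hP : P ∈ rowStochastic ℝ Ω) (c : ℝ) : (P *ᵥ fun _ => c) = fun _ => c := by
  have h := congrArg (c • ·) hP.2
  simp only [← mulVec_smul] at h
  simpa [Pi.smul_def] using h

lemma mulVec_mem_Icc (hP : P ∈ rowStochastic ℝ Ω) {F : Ω → ℝ} {a b : ℝ}
    (hF : ∀ ω, F ω ∈ Set.Icc a b) (ω : Ω) : (P *ᵥ F) ω ∈ Set.Icc a b := by
  have hlo := mulVec_mono hP (F := fun _ => a) (fun τ => (hF τ).1) ω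
  have hhi := mulVec_mono hP (G := fun _ => b) (fun τ => (hF τ).2) ω
  rw [mulVec_const hP] at hlo hhi
  exact ⟨hlo, hhi⟩

/-! ### Supersolutions -/

lemma pow_mulVec_le_of_supersolution (hP : P ∈ rowStochastic ℝ Ω) {R : Set Ω} {g : Ω → ℝ}
    {Ψ : ℕ → Ω → ℝ} (hg : ∀ ω, g ω ∈ Set.Icc (0 : ℝ) 1) (hinit : ∀ ω ∈ R, g ω ≤ Ψ 0 ω)
    (hout : ∀ t, ∀ ω ∉ R, 1 ≤ Ψ t ω) (hstep : ∀ t, ∀ ω ∈ R, (P *ᵥ Ψ t) ω ≤ Ψ (t + 1) ω) (t : ℕ) :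
    P ^ t *ᵥ g ≤ Ψ t := by
  have hone (t : ℕ) (ω : Ω) : (P ^ t *ᵥ g) ω ≤ 1 := (mulVec_mem_Icc (pow_mem hP t) hg ω).2
  induction t with
  | zero =>
    intro ω
    by_cases hω : ω ∈ R
    · simpa using hinit ω hω
    · exact (hone 0 ω).trans (hout 0 ω hω)
  | succ t ih =>
    intro ω
    by_cases hω : ω ∈ R
    · rw [pow_succ', ← mulVec_mulVec]
      exact (mulVec_mono hP ih ω).trans (hstep t ω hω)
    · exact (hone _ ω).trans (hout _ ω hω)

/-- `Φ` bounds the probability of ever leaving `R`, up to an error `e` per step, and `V` contracts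
in mean towards the level `B` as long as the chain stays in `R`. -/
lemma pow_mulVec_le_of_lyapunov (hP : P ∈ rowStochastic ℝ Ω) {R : Set Ω} {g Φ V : Ω → ℝ}
    {e W B D g₀ : ℝ} (hg : ∀ ω, g ω ∈ Set.Icc (0 : ℝ) 1) (he : 0 ≤ e) (hW₀ : 0 ≤ W) (hW₁ : W ≤ 1)
    (hB : 0 ≤ B) (hD : 0 ≤ D) (hg₀ : 0 ≤ g₀) (hΦ : ∀ ω, 0 ≤ Φ ω) (hV : ∀ ω, 0 ≤ V ω)
    (hΦ_out : ∀ ω ∉ R, 1 ≤ Φ ω) (hΦ_step : ∀ ω ∈ R, (P *ᵥ Φ) ω ≤ Φ ω + e)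
    (hV_step : ∀ ω ∈ R, (P *ᵥ V) ω ≤ W * V ω + (1 - W) * B)
    (hgV : ∀ ω ∈ R, g ω ≤ D * V ω + g₀) (t : ℕ) (ω : Ω) :
    (P ^ t *ᵥ g) ω ≤ Φ ω + t * e + D * (W ^ t * V ω + B) + g₀ := by
  have hWt (t : ℕ) : 0 ≤ W ^ t ∧ W ^ t ≤ 1 := ⟨pow_nonneg hW₀ t, pow_le_one₀ hW₀ hW₁⟩
  have hsuper := pow_mulVec_le_of_supersolution hP (R := R) hg
    (Ψ := fun t => Φ + (D * W ^ t) • V + fun _ => t * e + D * (1 - W ^ t) * B + g₀)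
    (fun σ hσ => ?_) (fun t σ hσ => ?_) (fun t σ hσ => ?_) t ω
  · refine hsuper.trans ?_
    have : 0 ≤ D * W ^ t * B := by have := hWt t; have := this.1; positivity
    simp only [Pi.add_apply, Pi.smul_apply, smul_eq_mul]
    linarith
  · simpa using (hgV σ hσ).trans (by linarith [hΦ σ])
  · have h₁ : 0 ≤ D * W ^ t * V σ := mul_nonneg (mul_nonneg hD (hWt t).1) (hV σ)
    have h₂ : 0 ≤ D * (1 - W ^ t) * B := mul_nonneg (mul_nonneg hD (sub_nonneg.2 (hWt t).2)) hB
    have h₃ : 0 ≤ t * e := by positivity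
    simp only [Pi.add_apply, Pi.smul_apply, smul_eq_mul]
    linarith [hΦ_out σ hσ]
  · have h := mul_le_mul_of_nonneg_left (hV_step σ hσ) (mul_nonneg hD (hWt t).1)
    simp only [mulVec_add, mulVec_smul, mulVec_const hP, Pi.add_apply, Pi.smul_apply, smul_eq_mul,
      Nat.cast_add, Nat.cast_one, pow_succ]
    linarith [hΦ_step σ hσ]

lemma mulVec_exitBound_le (hP : P ∈ rowStochastic ℝ Ω) {V : Ω → ℝ} {ρ b : ℝ}
    (hV : ∀ ω, 0 ≤ V ω) (hρ : 0 < ρ) (hb : 0 ≤ b)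
    (hstep : ∀ ω, V ω < ρ → (P *ᵥ V) ω ≤ V ω + b) (t : ℕ) :
    P *ᵥ exitBound V ρ b t ≤ exitBound V ρ b (t + 1) := by
  intro ω
  have hone := (mulVec_mem_Icc hP (exitBound_mem_Icc hV hρ.le hb t) ω).2
  by_cases hω : V ω < ρ
  · refine le_min hone ?_
    calc (P *ᵥ exitBound V ρ b t) ω
        ≤ (P *ᵥ (ρ⁻¹ • V + fun _ => b * t / ρ)) ω := by
          refine mulVec_mono hP (fun τ => (min_le_right _ _).trans_eq ?_) ω
          simp only [Pi.add_apply, Pi.smul_apply, smul_eq_mul]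
          ring
      _ = ρ⁻¹ * (P *ᵥ V) ω + b * t / ρ := by
          simp only [mulVec_add, mulVec_smul, mulVec_const hP, Pi.add_apply, Pi.smul_apply,
            smul_eq_mul]
      _ ≤ ρ⁻¹ * (V ω + b) + b * t / ρ := by gcongr; exact hstep ω hω
      _ = (V ω + b * (t + 1 : ℕ)) / ρ := by push_cast; ring
  · rwa [exitBound_eq_one hρ hb (not_lt.1 hω)]

lemma pow_mulVec_exitBound_le (hP : P ∈ rowStochastic ℝ Ω) {V : Ω → ℝ} {ρ b : ℝ}
    (hV : ∀ ω, 0 ≤ V ω) (hρ : 0 < ρ) (hb : 0 ≤ b)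
    (hstep : ∀ ω, V ω < ρ → (P *ᵥ V) ω ≤ V ω + b) (s t : ℕ) :
    P ^ s *ᵥ exitBound V ρ b t ≤ exitBound V ρ b (t + s) := by
  induction s with
  | zero => simp
  | succ s ih =>
    rw [pow_succ', ← mulVec_mulVec]
    exact (mulVec_mono hP ih).trans (mulVec_exitBound_le hP hV hρ hb hstep (t + s))

end Stochastic

/-! ### Couplings -/

/-- A coupling of the weights `μ` and `ν` on `Ω`: random variables `X` and `Y` on a finite space
with weights `w`, distributed according to `μ` and `ν`. The laws of `X` and `Y` are encoded by the
expectations of test functions. -/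
structure IsCoupling {ι : Type*} [Fintype ι] (w : ι → ℝ) (X Y : ι → Ω) (μ ν : Ω → ℝ) : Prop where
  nonneg : ∀ i, 0 ≤ w i
  fst : ∀ F : Ω → ℝ, ∑ i, w i * F (X i) = μ ⬝ᵥ F
  snd : ∀ F : Ω → ℝ, ∑ i, w i * F (Y i) = ν ⬝ᵥ F

lemma IsCoupling.dotProduct_sub_le {ι : Type*} [Fintype ι] {w : ι → ℝ} {X Y : ι → Ω}
    {μ ν F : Ω → ℝ} {g : ι → ℝ} (h : IsCoupling w X Y μ ν) (hF : ∀ i, F (X i) - F (Y i) ≤ g i) :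
    μ ⬝ᵥ F - ν ⬝ᵥ F ≤ ∑ i, w i * g i := by
  rw [← h.fst, ← h.snd, ← Finset.sum_sub_distrib]
  refine Finset.sum_le_sum fun i _ => ?_
  rw [← mul_sub]
  exact mul_le_mul_of_nonneg_left (hF i) (h.nonneg i)

lemma isCoupling_of_marginals {c : Ω → Ω → ℝ} {μ ν : Ω → ℝ} (hc : ∀ i j, 0 ≤ c i j)
    (hμ : ∀ i, ∑ j, c i j = μ i) (hν : ∀ j, ∑ i, c i j = ν j) :
    IsCoupling (fun p : Ω × Ω => c p.1 p.2) Prod.fst Prod.snd μ ν where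
  nonneg p := hc p.1 p.2
  fst F := by
    simp only [Fintype.sum_prod_type, ← Finset.sum_mul, hμ, dotProduct]
  snd F := by
    simp only [Fintype.sum_prod_type_right, ← Finset.sum_mul, hν, dotProduct]

lemma isCoupling_mul {μ ν : Ω → ℝ} (hμ : ∀ i, 0 ≤ μ i) (hν : ∀ i, 0 ≤ ν i)
    (hμ₁ : ∑ i, μ i = 1) (hν₁ : ∑ i, ν i = 1) :
    IsCoupling (fun p : Ω × Ω => μ p.1 * ν p.2) Prod.fst Prod.snd μ ν :=
  isCoupling_of_marginals (fun i j => mul_nonneg (hμ i) (hν j))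
    (fun i => by rw [← Finset.mul_sum, hν₁, mul_one])
    (fun j => by rw [← Finset.sum_mul, hμ₁, one_mul])

/-- The maximal coupling of weights `μ` and `ν` of equal total mass: the common mass is put on the
diagonal and the rest is coupled independently. When `μ = ν`, the second term is `0 / 0 = 0`. -/
def maximalCoupling [DecidableEq Ω] (μ ν : Ω → ℝ) (p : Ω × Ω) : ℝ :=
  (if p.1 = p.2 then min (μ p.1) (ν p.1) else 0) +
    (μ p.1 - min (μ p.1) (ν p.1)) * (ν p.2 - min (μ p.2) (ν p.2)) /
      ∑ i, (μ i - min (μ i) (ν i))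

lemma sum_sub_min_eq_half_sum_abs {μ ν : Ω → ℝ} (h : ∑ i, μ i = ∑ i, ν i) :
    ∑ i, (μ i - min (μ i) (ν i)) = (∑ i, |μ i - ν i|) / 2 := by
  have hmin (i : Ω) : μ i - min (μ i) (ν i) = |μ i - ν i| / 2 + (μ i - ν i) / 2 := by
    rcases le_total (μ i) (ν i) with hi | hi
    · rw [min_eq_left hi, abs_of_nonpos (sub_nonpos.2 hi)]; ring
    · rw [min_eq_right hi, abs_of_nonneg (sub_nonneg.2 hi)]; ring
  simp only [hmin, Finset.sum_add_distrib, ← Finset.sum_div, Finset.sum_sub_distrib, h, sub_self,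
    zero_div, add_zero]

lemma sum_sub_min_comm {μ ν : Ω → ℝ} (h : ∑ i, μ i = ∑ i, ν i) :
    ∑ i, (ν i - min (μ i) (ν i)) = ∑ i, (μ i - min (μ i) (ν i)) := by
  simp only [Finset.sum_sub_distrib, h]

lemma isCoupling_maximalCoupling [DecidableEq Ω] {μ ν : Ω → ℝ} (hμ : ∀ i, 0 ≤ μ i)
    (hν : ∀ i, 0 ≤ ν i) (h : ∑ i, μ i = ∑ i, ν i) :
    IsCoupling (maximalCoupling μ ν) Prod.fst Prod.snd μ ν := by
  have hμ_sub (i : Ω) : 0 ≤ μ i - min (μ i) (ν i) := sub_nonneg.2 (min_le_left _ _)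
  have hν_sub (i : Ω) : 0 ≤ ν i - min (μ i) (ν i) := sub_nonneg.2 (min_le_right _ _)
  refine isCoupling_of_marginals (c := fun i j => maximalCoupling μ ν (i, j)) (fun i j => ?_)
    (fun i => ?_) (fun j => ?_) <;> simp only [maximalCoupling]
  · refine add_nonneg ?_ (div_nonneg (mul_nonneg (hμ_sub i) (hν_sub j))
      (Finset.sum_nonneg fun i _ => hμ_sub i))
    split_ifs
    exacts [le_min (hμ i) (hν i), le_rfl]
  · rw [Finset.sum_add_distrib, ← Finset.sum_div, ← Finset.mul_sum, sum_sub_min_comm h,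
      mul_div_cancel_of_imp fun h₀ =>
        (Finset.sum_eq_zero_iff_of_nonneg fun i _ => hμ_sub i).1 h₀ i (Finset.mem_univ i)]
    simp
  · rw [Finset.sum_add_distrib, ← Finset.sum_div, ← Finset.sum_mul, mul_comm,
      mul_div_cancel_of_imp fun h₀ =>
        (Finset.sum_eq_zero_iff_of_nonneg fun i _ => hν_sub i).1
          ((sum_sub_min_comm h).trans h₀) j (Finset.mem_univ j)]
    simp

lemma sum_maximalCoupling_mul_ne_le [DecidableEq Ω] {μ ν : Ω → ℝ} (h : ∑ i, μ i = ∑ i, ν i) :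
    ∑ p, maximalCoupling μ ν p * (if p.1 = p.2 then 0 else 1) ≤ (∑ i, |μ i - ν i|) / 2 := by
  have hμ_sub (i : Ω) : 0 ≤ μ i - min (μ i) (ν i) := sub_nonneg.2 (min_le_left _ _)
  have hν_sub (i : Ω) : 0 ≤ ν i - min (μ i) (ν i) := sub_nonneg.2 (min_le_right _ _)
  rw [← sum_sub_min_eq_half_sum_abs h]
  set d := ∑ i, (μ i - min (μ i) (ν i)) with hd
  have hd₀ : 0 ≤ d := Finset.sum_nonneg fun i _ => hμ_sub i
  calc ∑ p, maximalCoupling μ ν p * (if p.1 = p.2 then 0 else 1)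
      ≤ ∑ p : Ω × Ω, (μ p.1 - min (μ p.1) (ν p.1)) * (ν p.2 - min (μ p.2) (ν p.2)) / d := by
        refine Finset.sum_le_sum fun p _ => ?_
        have := div_nonneg (mul_nonneg (hμ_sub p.1) (hν_sub p.2)) hd₀
        simp only [maximalCoupling, ← hd]
        split_ifs <;> simp [this]
    _ = d * d / d := by
        simp only [Fintype.sum_prod_type, ← Finset.sum_div, ← Finset.mul_sum, ← Finset.sum_mul,
          sum_sub_min_comm h, ← hd]
    _ = d := mul_self_div_self d

section Contraction

variable [DecidableEq Ω] {P : Matrix Ω Ω ℝ}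

/-- If one step of the chain can be coupled so as to contract `d` inside `U`, then `t` steps are
coupled up to `d > 0`, unless one of the two chains leaves `U`, an event controlled by `G`. -/
lemma pow_mulVec_sub_le_of_coupling (hP : P ∈ rowStochastic ℝ Ω) {ι : Type*} [Fintype ι]
    {U : Set Ω} {d : Ω → Ω → ℝ} {ρ : ℝ} {G : ℕ → Ω → ℝ} {f : Ω → ℝ} (hρ : 0 ≤ ρ)
    (hd : ∀ σ τ, 0 ≤ d σ τ) (hd_ne : ∀ σ τ, σ ≠ τ → 1 ≤ d σ τ)
    (hcoup : ∀ σ ∈ U, ∀ τ ∈ U, ∃ (w : ι → ℝ) (X Y : ι → Ω),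
      IsCoupling w X Y (P σ) (P τ) ∧ ∑ i, w i * d (X i) (Y i) ≤ ρ * d σ τ)
    (hG : ∀ t ω, 0 ≤ G t ω) (hG_out : ∀ t, ∀ ω ∉ U, 1 ≤ G t ω)
    (hG_step : ∀ t, P *ᵥ G t ≤ G (t + 1)) (hf : ∀ ω, f ω ∈ Set.Icc (0 : ℝ) 1) (t : ℕ)
    (σ τ : Ω) : (P ^ t *ᵥ f) σ - (P ^ t *ᵥ f) τ ≤ ρ ^ t * d σ τ + G t σ + G t τ := by
  have hone (t : ℕ) (σ τ : Ω) : (P ^ t *ᵥ f) σ - (P ^ t *ᵥ f) τ ≤ 1 := by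
    linarith [(mulVec_mem_Icc (pow_mem hP t) hf σ).2, (mulVec_mem_Icc (pow_mem hP t) hf τ).1]
  induction t generalizing σ τ with
  | zero =>
    rcases eq_or_ne σ τ with rfl | hne
    · linarith [hd σ σ, hG 0 σ, pow_zero ρ, mul_nonneg (pow_nonneg hρ 0) (hd σ σ)]
    · linarith [hone 0 σ τ, hd_ne σ τ hne, hG 0 σ, hG 0 τ, one_mul (d σ τ), pow_zero ρ]
  | succ t ih =>
    have hd_nonneg := mul_nonneg (pow_nonneg hρ (t + 1)) (hd σ τ)
    by_cases hσ : σ ∈ U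
    swap
    · linarith [hone (t + 1) σ τ, hG_out (t + 1) σ hσ, hG (t + 1) τ]
    by_cases hτ : τ ∈ U
    swap
    · linarith [hone (t + 1) σ τ, hG_out (t + 1) τ hτ, hG (t + 1) σ]
    obtain ⟨w, X, Y, hw, hd_step⟩ := hcoup σ hσ τ hτ
    rw [pow_succ', ← mulVec_mulVec]
    calc (P *ᵥ (P ^ t *ᵥ f)) σ - (P *ᵥ (P ^ t *ᵥ f)) τ
        ≤ ∑ i, w i * (ρ ^ t * d (X i) (Y i) + G t (X i) + G t (Y i)) :=
          hw.dotProduct_sub_le fun i => ih (X i) (Y i)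
      _ = ρ ^ t * ∑ i, w i * d (X i) (Y i) + (P *ᵥ G t) σ + (P *ᵥ G t) τ := by
          simp only [mul_add, Finset.sum_add_distrib, hw.fst, hw.snd, Finset.mul_sum,
            mul_left_comm (w _), mulVec]
      _ ≤ ρ ^ t * (ρ * d σ τ) + G (t + 1) σ + G (t + 1) τ := by
          gcongr
          exacts [hG_step t σ, hG_step t τ]
      _ = ρ ^ (t + 1) * d σ τ + G (t + 1) σ + G (t + 1) τ := by ring

/-- Both chains are run independently for the steps described by `P`. -/
lemma mulVec_sub_le_of_forall_sub_le (hP : P ∈ rowStochastic ℝ Ω) {h e : Ω → ℝ} {N : ℝ}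
    (hh : ∀ σ τ, h σ - h τ ≤ N + e σ + e τ) (σ τ : Ω) :
    (P *ᵥ h) σ - (P *ᵥ h) τ ≤ N + (P *ᵥ e) σ + (P *ᵥ e) τ := by
  have hsum := sum_row_of_mem_rowStochastic hP
  have hw := isCoupling_mul (hP.1 σ) (hP.1 τ) (hsum σ) (hsum τ)
  refine (hw.dotProduct_sub_le (F := h) fun p => hh p.1 p.2).trans_eq ?_
  simp only [mul_add, Finset.sum_add_distrib, hw.fst, hw.snd, ← Finset.sum_mul]
  simp [Fintype.sum_prod_type, ← Finset.mul_sum, hsum, mulVec]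

end Contraction

/-! ### Total variation -/

lemma prob_vecMul (μ : Ω → ℝ) (Q : Matrix Ω Ω ℝ) (E : Set Ω) :
    prob (μ ᵥ* Q) E = μ ⬝ᵥ (Q *ᵥ E.indicator 1) := by
  rw [dotProduct_mulVec]
  refine Finset.sum_congr rfl fun ω _ => ?_
  by_cases hω : ω ∈ E <;> simp [hω]

lemma tvOf_vecMul_single_le [DecidableEq Ω] {X : Type*} (S : Ω → X) {Q : Matrix Ω Ω ℝ}
    {ν : Ω → ℝ} {ω₀ : Ω} {ε : ℝ} (hν : ∀ ω, 0 ≤ ν ω) (hν_sum : ∑ ω, ν ω = 1)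
    (hQ : ∀ f : Ω → ℝ, (∀ ω, f ω ∈ Set.Icc (0 : ℝ) 1) → ∀ ω, ν ω ≠ 0 →
      |(Q *ᵥ f) ω₀ - (Q *ᵥ f) ω| ≤ ε) :
    tvOf S (Pi.single ω₀ 1 ᵥ* Q) (ν ᵥ* Q) ≤ ε := by
  refine ciSup_le fun A => ?_
  set f : Ω → ℝ := (S ⁻¹' A).indicator 1
  have hf (ω : Ω) : f ω ∈ Set.Icc (0 : ℝ) 1 :=
    ⟨Set.indicator_nonneg (by simp) ω, Set.indicator_le_self' (by simp) ω⟩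
  rw [prob_vecMul, prob_vecMul, single_one_dotProduct]
  calc |(Q *ᵥ f) ω₀ - ν ⬝ᵥ (Q *ᵥ f)|
      = |∑ ω, ν ω * ((Q *ᵥ f) ω₀ - (Q *ᵥ f) ω)| := by
        simp only [mul_sub, Finset.sum_sub_distrib, ← Finset.sum_mul, hν_sum, one_mul, dotProduct]
    _ ≤ ∑ ω, |ν ω * ((Q *ᵥ f) ω₀ - (Q *ᵥ f) ω)| := Finset.abs_sum_le_sum_abs _ _
    _ ≤ ∑ ω, ν ω * ε := by
        refine Finset.sum_le_sum fun ω _ => ?_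
        rcases eq_or_ne (ν ω) 0 with hω | hω
        · simp [hω]
        · rw [abs_mul, abs_of_nonneg (hν ω)]
          exact mul_le_mul_of_nonneg_left (hQ f hf ω hω) (hν ω)
    _ = ε := by rw [← Finset.sum_mul, hν_sum, one_mul]

lemma prob_pos {μ : Ω → ℝ} (hμ : ∀ ω, 0 < μ ω) {E : Set Ω} (hE : E.Nonempty) : 0 < prob μ E := by
  obtain ⟨ω, hω⟩ := hE
  refine Finset.sum_pos' (fun τ _ => Set.indicator_nonneg (fun τ _ => (hμ τ).le) τ)
    ⟨ω, Finset.mem_univ ω, ?_⟩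
  rw [Set.indicator_of_mem hω]
  exact hμ ω

lemma condOn_nonneg {μ : Ω → ℝ} (hμ : ∀ ω, 0 ≤ μ ω) (E : Set Ω) (ω : Ω) : 0 ≤ condOn μ E ω :=
  have hind (τ : Ω) : 0 ≤ E.indicator μ τ := Set.indicator_nonneg (fun τ _ => hμ τ) τ
  div_nonneg (hind ω) (Finset.sum_nonneg fun τ _ => hind τ)

lemma sum_condOn {μ : Ω → ℝ} {E : Set Ω} (hE : prob μ E ≠ 0) : ∑ ω, condOn μ E ω = 1 := by
  simp only [condOn, ← Finset.sum_div]
  exact div_self hE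

lemma mem_of_condOn_ne_zero {μ : Ω → ℝ} {E : Set Ω} {ω : Ω} (h : condOn μ E ω ≠ 0) : ω ∈ E := by
  contrapose! h
  simp [condOn, h]

end FiniteMarkovChains

section GlauberDynamics

variable {n q : ℕ} {β : ℝ}

/-! ### One step of the Glauber dynamics -/

lemma glauber_mulVec_apply (F : Config n q → ℝ) (σ : Config n q) :
    (glauber n q β *ᵥ F) σ =
      (1 / (n : ℝ)) * ∑ v, ∑ l, resampleProb n q β σ v l * F (Function.update σ v l) := by
  simp only [mulVec, dotProduct, glauber, of_apply, mul_assoc, ← Finset.mul_sum, Finset.sum_mul]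
  congr 1
  rw [Finset.sum_comm]
  refine Finset.sum_congr rfl fun v _ => ?_
  rw [Finset.sum_comm]
  simp

lemma resampleProb_nonneg (σ : Config n q) (v : Fin n) (l : Fin q) :
    0 ≤ resampleProb n q β σ v l := by
  unfold resampleProb; positivity

lemma sum_resampleProb [NeZero q] (σ : Config n q) (v : Fin n) :
    ∑ l, resampleProb n q β σ v l = 1 := by
  simp only [resampleProb, ← Finset.sum_div]
  exact div_self (Finset.sum_pos (fun _ _ => Real.exp_pos _) Finset.univ_nonempty).ne'

lemma glauber_mem_rowStochastic [NeZero n] [NeZero q] :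
    glauber n q β ∈ rowStochastic ℝ (Config n q) := by
  refine ⟨fun σ τ => ?_, funext fun σ => ?_⟩
  · refine mul_nonneg (by positivity) (Finset.sum_nonneg fun v _ => Finset.sum_nonneg fun l _ => ?_)
    split_ifs
    exacts [resampleProb_nonneg σ v l, le_rfl]
  · simp [glauber_mulVec_apply, sum_resampleProb]

lemma glauber_mulVec_le_of_update_le {F G : Config n q → ℝ} {σ : Config n q}
    (h : ∀ v l, F (Function.update σ v l) ≤ G (Function.update σ v l)) :
    (glauber n q β *ᵥ F) σ ≤ (glauber n q β *ᵥ G) σ := by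
  simp only [glauber_mulVec_apply]
  gcongr with v _ l _
  · exact resampleProb_nonneg σ v l
  · exact h v l

lemma hammingDist_eq_sum {ι α : Type*} [Fintype ι] [DecidableEq α] (x y : ι → α) :
    (hammingDist x y : ℝ) = ∑ i, if x i = y i then 0 else 1 := by
  simp only [hammingDist, Finset.card_filter, ne_eq, ite_not, Nat.cast_sum, Nat.cast_ite,
    Nat.cast_zero, Nat.cast_one]

lemma hammingDist_update_add {ι α : Type*} [Fintype ι] [DecidableEq ι] [DecidableEq α]
    (x y : ι → α) (i : ι) (a b : α) :
    (hammingDist (Function.update x i a) (Function.update y i b) : ℝ) +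
      (if x i = y i then 0 else 1) = hammingDist x y + (if a = b then 0 else 1) := by
  have hne : ∀ j ∈ Finset.univ.erase i,
      (if Function.update x i a j = Function.update y i b j then (0 : ℝ) else 1) =
        if x j = y j then 0 else 1 := fun j hj => by
    simp only [Function.update_of_ne (Finset.ne_of_mem_erase hj)]
  rw [hammingDist_eq_sum, hammingDist_eq_sum, ← Finset.add_sum_erase _ _ (Finset.mem_univ i),
    Finset.sum_congr rfl hne, ← Finset.add_sum_erase _ _ (Finset.mem_univ i)]
  simp only [Function.update_self]
  ring

/-- Both chains resample the same vertex, with maximally coupled spins. -/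
lemma exists_glauber_coupling [NeZero n] [NeZero q] {κ : ℝ} {σ τ : Config n q}
    (hκ : ∀ v, (∑ l, |resampleProb n q β σ v l - resampleProb n q β τ v l|) / 2 ≤
      κ * hammingDist σ τ / n) :
    ∃ (w : Fin n × Fin q × Fin q → ℝ) (X Y : Fin n × Fin q × Fin q → Config n q),
      IsCoupling w X Y (glauber n q β σ) (glauber n q β τ) ∧
        ∑ i, w i * hammingDist (X i) (Y i) ≤ (1 - (1 - κ) / n) * hammingDist σ τ := by
  have hn : (n : ℝ) ≠ 0 := NeZero.ne _
  set c : Fin n → Fin q × Fin q → ℝ := fun v =>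
    maximalCoupling (resampleProb n q β σ v) (resampleProb n q β τ v)
  have hsum (v : Fin n) : ∑ l, resampleProb n q β σ v l = ∑ l, resampleProb n q β τ v l := by
    rw [sum_resampleProb, sum_resampleProb]
  have hc (v : Fin n) := isCoupling_maximalCoupling (resampleProb_nonneg (β := β) σ v)
    (resampleProb_nonneg τ v) (hsum v)
  have hc_sum (v : Fin n) : ∑ p, c v p = 1 := by
    simpa [dotProduct, sum_resampleProb] using (hc v).fst fun _ => 1
  refine ⟨fun i => 1 / (n : ℝ) * c i.1 i.2, fun i => Function.update σ i.1 i.2.1,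
    fun i => Function.update τ i.1 i.2.2,
    ⟨fun i => mul_nonneg (by positivity) ((hc i.1).nonneg i.2), fun F => ?_, fun F => ?_⟩, ?_⟩
  · refine Eq.trans ?_ (glauber_mulVec_apply F σ).symm
    rw [Fintype.sum_prod_type]
    simp only [mul_assoc, ← Finset.mul_sum]
    exact congrArg _ (Finset.sum_congr rfl fun v _ => (hc v).fst fun l => F (Function.update σ v l))
  · refine Eq.trans ?_ (glauber_mulVec_apply F τ).symm
    rw [Fintype.sum_prod_type]
    simp only [mul_assoc, ← Finset.mul_sum]
    exact congrArg _ (Finset.sum_congr rfl fun v _ => (hc v).snd fun l => F (Function.update τ v l))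
  · have hstep (v : Fin n) :
        ∑ p, c v p * hammingDist (Function.update σ v p.1) (Function.update τ v p.2) ≤
          hammingDist σ τ - (if σ v = τ v then 0 else 1) + κ * hammingDist σ τ / n := by
      simp only [fun p : Fin q × Fin q => eq_sub_of_add_eq (hammingDist_update_add σ τ v p.1 p.2),
        add_sub_right_comm, mul_add, Finset.sum_add_distrib, ← Finset.sum_mul, hc_sum, one_mul]
      gcongr
      exact (sum_maximalCoupling_mul_ne_le (hsum v)).trans (hκ v)
    rw [Fintype.sum_prod_type]
    simp only [mul_assoc, ← Finset.mul_sum]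
    calc 1 / (n : ℝ) * ∑ v, ∑ p, c v p *
            hammingDist (Function.update σ v p.1) (Function.update τ v p.2)
        ≤ 1 / (n : ℝ) * ∑ v, (hammingDist σ τ - (if σ v = τ v then 0 else 1) +
            κ * hammingDist σ τ / n) := by gcongr with v; exact hstep v
      _ = (1 - (1 - κ) / n) * hammingDist σ τ := by
          simp only [Finset.sum_add_distrib, Finset.sum_sub_distrib, ← hammingDist_eq_sum,
            Finset.sum_const, Finset.card_univ, Fintype.card_fin, nsmul_eq_mul]
          field_simp
          ring

/-! ### Proportions -/

lemma proportions_eq_sum (σ : Config n q) (k : Fin q) :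
    proportions σ k = (∑ v, if σ v = k then (1 : ℝ) else 0) / n := by
  simp [proportions]

lemma proportions_nonneg (σ : Config n q) (k : Fin q) : 0 ≤ proportions σ k := by
  unfold proportions; positivity

lemma sum_proportions [NeZero n] (σ : Config n q) : ∑ k, proportions σ k = 1 := by
  simp only [proportions_eq_sum, ← Finset.sum_div]
  rw [Finset.sum_comm]
  simp

lemma proportions_le_one [NeZero n] (σ : Config n q) (k : Fin q) : proportions σ k ≤ 1 := by
  rw [← sum_proportions σ]
  exact Finset.single_le_sum (fun i _ => proportions_nonneg σ i) (Finset.mem_univ k)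

/-- The proportions of the spins of all vertices but `v`, normalized by `n` and not by `n - 1`. -/
def othersProp (σ : Config n q) (v : Fin n) : Fin q → ℝ := fun k => othersWithSpin σ v k / n

lemma othersProp_eq (σ : Config n q) (v : Fin n) (k : Fin q) :
    othersProp σ v k = proportions σ k - (if σ v = k then 1 else 0) / n := by
  rw [othersProp, proportions_eq_sum, ← Finset.sum_erase_add _ _ (Finset.mem_univ v), ← sub_div,
    add_sub_cancel_right, Finset.sum_boole, othersWithSpin]
  congr 3
  ext w
  simp

lemma othersProp_update (σ : Config n q) (v : Fin n) (l : Fin q) :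
    othersProp (Function.update σ v l) v = othersProp σ v := by
  funext k
  simp only [othersProp, othersWithSpin]
  congr 3
  ext w
  simp +contextual [Function.update_of_ne]

lemma proportions_update (σ : Config n q) (v : Fin n) (l k : Fin q) :
    proportions (Function.update σ v l) k = proportions σ k +
      ((if l = k then 1 else 0) - (if σ v = k then 1 else 0)) / n := by
  have h := congrFun (othersProp_update σ v l) k
  rw [othersProp_eq, othersProp_eq, Function.update_self] at h
  rw [sub_div]
  linarith

lemma abs_proportions_update_sub_le (σ : Config n q) (v : Fin n) (l k : Fin q) :
    |proportions (Function.update σ v l) k - proportions σ k| ≤ 1 / n := by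
  rw [proportions_update, add_sub_cancel_left, abs_div, Nat.abs_cast]
  gcongr
  split_ifs <;> simp

/-- The mean increment of the proportions vector in one step of the dynamics. -/
def meanInc (n q : ℕ) (β : ℝ) (σ : Config n q) : Fin q → ℝ :=
  fun k => (glauber n q β *ᵥ fun τ => proportions τ k - proportions σ k) σ

lemma glauber_mulVec_le_of_update_le_affine [NeZero n] [NeZero q] {F : Config n q → ℝ}
    {σ : Config n q} {A : ℝ} {c : Fin q → ℝ}
    (h : ∀ v l, F (Function.update σ v l) ≤
      A + c ⬝ᵥ (proportions (Function.update σ v l) - proportions σ)) :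
    (glauber n q β *ᵥ F) σ ≤ A + c ⬝ᵥ meanInc n q β σ := by
  refine (glauber_mulVec_le_of_update_le
    (G := (fun _ => A) + ∑ i, c i • fun τ => proportions τ i - proportions σ i)
    fun v l => (h v l).trans_eq ?_).trans_eq ?_
  · simp [dotProduct]
  · simp only [mulVec_add, mulVec_const glauber_mem_rowStochastic, mulVec_sum, mulVec_smul,
      Pi.add_apply, Finset.sum_apply, Pi.smul_apply, smul_eq_mul]
    rfl

lemma glauber_mulVec_le_of_update_le_affine_single [NeZero n] [NeZero q] {F : Config n q → ℝ}
    {σ : Config n q} {k : Fin q} {A B : ℝ}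
    (h : ∀ v l, F (Function.update σ v l) ≤
      A + B * (proportions (Function.update σ v l) k - proportions σ k)) :
    (glauber n q β *ᵥ F) σ ≤ A + B * meanInc n q β σ k := by
  simpa using glauber_mulVec_le_of_update_le_affine (β := β) (c := Pi.single k B)
    fun v l => by simpa [mul_sub] using h v l

lemma mul_meanInc [NeZero n] [NeZero q] (σ : Config n q) (k : Fin q) :
    n * meanInc n q β σ k =
      (1 / (n : ℝ)) * ∑ v, resampleProb n q β σ v k - proportions σ k := by
  have h (v : Fin n) : ∑ l, resampleProb n q β σ v l *
      (proportions (Function.update σ v l) k - proportions σ k) =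
        (resampleProb n q β σ v k - (if σ v = k then 1 else 0)) / n := by
    simp only [proportions_update, add_sub_cancel_left, mul_div_assoc', ← Finset.sum_div, mul_sub,
      Finset.sum_sub_distrib, ← Finset.sum_mul, sum_resampleProb]
    simp
  have hn : (n : ℝ) ≠ 0 := NeZero.ne _
  simp only [meanInc, glauber_mulVec_apply, h, ← Finset.sum_div, Finset.sum_sub_distrib]
  rw [proportions_eq_sum]
  field_simp

end GlauberDynamics

section Softmax

variable {ι : Type*} [Fintype ι] {β : ℝ}

/-! ### The softmax map -/

/-- The softmax weights of the vector `s` at inverse temperature `β`. -/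
def softmax (β : ℝ) (s : ι → ℝ) (k : ι) : ℝ := Real.exp (β * s k) / ∑ l, Real.exp (β * s l)

lemma sum_exp_pos [Nonempty ι] (s : ι → ℝ) : 0 < ∑ l, Real.exp (s l) :=
  Finset.sum_pos (fun _ _ => Real.exp_pos _) Finset.univ_nonempty

lemma softmax_le_one (β : ℝ) (s : ι → ℝ) (k : ι) : softmax β s k ≤ 1 :=
  div_le_one_of_le₀ (Finset.single_le_sum (f := fun l => Real.exp (β * s l))
    (fun _ _ => (Real.exp_pos _).le) (Finset.mem_univ k))
    (Finset.sum_nonneg fun _ _ => (Real.exp_pos _).le)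

lemma abs_exp_sub_one_le_mul_exp_abs (u : ℝ) : |Real.exp u - 1| ≤ |u| * Real.exp |u| := by
  simpa [← Complex.ofReal_exp, ← Complex.ofReal_one, ← Complex.ofReal_sub]
    using Complex.norm_exp_sub_sum_le_norm_mul_exp (u : ℂ) 1

lemma softmax_le_exp_mul_softmax (hβ : 0 ≤ β) {s s' : ι → ℝ} {ε : ℝ}
    (hε : ∀ l, |s l - s' l| ≤ ε) (k : ι) :
    softmax β s k ≤ Real.exp (2 * β * ε) * softmax β s' k := by
  have : Nonempty ι := ⟨k⟩
  have hnum : Real.exp (β * s k) ≤ Real.exp (β * ε) * Real.exp (β * s' k) := by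
    rw [← Real.exp_add, Real.exp_le_exp, ← mul_add]
    exact mul_le_mul_of_nonneg_left (by linarith [(abs_le.1 (hε k)).2]) hβ
  have hden : ∑ l, Real.exp (β * s' l) ≤ Real.exp (β * ε) * ∑ l, Real.exp (β * s l) := by
    rw [Finset.mul_sum]
    refine Finset.sum_le_sum fun l _ => ?_
    rw [← Real.exp_add, Real.exp_le_exp, ← mul_add]
    exact mul_le_mul_of_nonneg_left (by linarith [(abs_le.1 (hε l)).1]) hβ
  rw [softmax, softmax, ← mul_div_assoc, div_le_div_iff₀ (sum_exp_pos _) (sum_exp_pos _)]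
  calc Real.exp (β * s k) * ∑ l, Real.exp (β * s' l)
      ≤ (Real.exp (β * ε) * Real.exp (β * s' k)) *
          (Real.exp (β * ε) * ∑ l, Real.exp (β * s l)) := by gcongr
    _ = Real.exp (2 * β * ε) * Real.exp (β * s' k) * ∑ l, Real.exp (β * s l) := by
        rw [mul_assoc 2 β ε, two_mul, Real.exp_add]; ring

lemma abs_softmax_sub_le (hβ : 0 ≤ β) {s s' : ι → ℝ} {ε : ℝ} (hε : ∀ l, |s l - s' l| ≤ ε)
    (k : ι) : |softmax β s k - softmax β s' k| ≤ 2 * β * ε * Real.exp (2 * β * ε) := by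
  have hε₀ : 0 ≤ ε := (abs_nonneg _).trans (hε k)
  have hβε : 0 ≤ 2 * β * ε := by positivity
  have hexp := (le_abs_self _).trans (abs_exp_sub_one_le_mul_exp_abs (2 * β * ε))
  rw [abs_of_nonneg hβε] at hexp
  have hexp₁ := Real.one_le_exp hβε
  have key {x y : ℝ} (hy : y ≤ 1) (h : x ≤ Real.exp (2 * β * ε) * y) :
      x - y ≤ 2 * β * ε * Real.exp (2 * β * ε) := by nlinarith
  rw [abs_le, neg_le, neg_sub]
  exact ⟨key (softmax_le_one β s k) (softmax_le_exp_mul_softmax hβ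
      (fun l => (abs_sub_comm (s' l) (s l)).trans_le (hε l)) k),
    key (softmax_le_one β s' k) (softmax_le_exp_mul_softmax hβ hε k)⟩

end Softmax

section MeanIncrement

variable {n q : ℕ} {β : ℝ}

lemma resampleProb_eq_softmax (σ : Config n q) (v : Fin n) (k : Fin q) :
    resampleProb n q β σ v k = softmax β (othersProp σ v) k := by
  have h (l : Fin q) : β / n * (othersWithSpin σ v l : ℝ) = β * othersProp σ v l := by
    rw [othersProp]; ring
  simp only [resampleProb, softmax, h]

lemma abs_resampleProb_sub_softmax_le (hβ : 0 ≤ β) (σ : Config n q) (v : Fin n) (k : Fin q) :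
    |resampleProb n q β σ v k - softmax β (proportions σ) k| ≤ 2 * β * Real.exp (2 * β) / n := by
  have hn : 1 / (n : ℝ) ≤ 1 := div_le_one_of_le₀ (by exact_mod_cast v.pos) n.cast_nonneg
  rw [resampleProb_eq_softmax]
  calc |softmax β (othersProp σ v) k - softmax β (proportions σ) k|
      ≤ 2 * β * (1 / n) * Real.exp (2 * β * (1 / n)) := by
        refine abs_softmax_sub_le hβ (fun l => ?_) k
        rw [othersProp_eq, sub_sub_cancel_left, abs_neg, abs_div, Nat.abs_cast]
        gcongr
        split_ifs <;> simp
    _ ≤ 2 * β * (1 / n) * Real.exp (2 * β) := by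
        gcongr ?_ * Real.exp ?_
        exact mul_le_of_le_one_right (by positivity) hn
    _ = 2 * β * Real.exp (2 * β) / n := by ring

lemma abs_meanInc_sub_le [NeZero n] [NeZero q] (hβ : 0 ≤ β) (σ : Config n q) (k : Fin q) :
    |n * meanInc n q β σ k - (softmax β (proportions σ) k - proportions σ k)| ≤
      2 * β * Real.exp (2 * β) / n := by
  have hn : (n : ℝ) ≠ 0 := NeZero.ne _
  calc |n * meanInc n q β σ k - (softmax β (proportions σ) k - proportions σ k)|
      = |1 / (n : ℝ) * ∑ v, (resampleProb n q β σ v k - softmax β (proportions σ) k)| := by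
        rw [mul_meanInc, Finset.sum_sub_distrib, sub_sub_sub_cancel_right, mul_sub]
        simp [hn]
    _ ≤ 1 / (n : ℝ) * ∑ _v : Fin n, 2 * β * Real.exp (2 * β) / n := by
        rw [abs_mul, abs_of_nonneg (by positivity : (0 : ℝ) ≤ 1 / n)]
        gcongr
        exact (Finset.abs_sum_le_sum_abs _ _).trans
          (Finset.sum_le_sum fun v _ => abs_resampleProb_sub_softmax_le hβ σ v k)
    _ = 2 * β * Real.exp (2 * β) / n := by simp; field_simp

end MeanIncrement

section TransverseDeviation

variable {n q : ℕ} {β : ℝ}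

/-! ### Deviation from the axis of a dominant spin -/

lemma dominated_self (k : Fin q) (m : ℝ) : dominated k m k = m := if_pos rfl

lemma dominated_of_ne {k i : Fin q} (hi : i ≠ k) (m : ℝ) :
    dominated k m i = (1 - m) / ((q : ℝ) - 1) := if_neg hi

lemma sum_erase_const (hq : 1 < q) (k : Fin q) (c : ℝ) :
    ∑ _i ∈ Finset.univ.erase k, c = ((q : ℝ) - 1) * c := by
  simp [Finset.card_erase_of_mem, Nat.cast_sub hq.le]

lemma sum_dominated (hq : 1 < q) (k : Fin q) (m : ℝ) : ∑ i, dominated k m i = 1 := by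
  have hq' : (q : ℝ) - 1 ≠ 0 := (sub_pos.2 (Nat.one_lt_cast.2 hq)).ne'
  rw [← Finset.add_sum_erase _ _ (Finset.mem_univ k), dominated_self,
    Finset.sum_congr rfl fun i hi => dominated_of_ne (Finset.ne_of_mem_erase hi) m,
    sum_erase_const hq, mul_div_cancel₀ _ hq']
  ring

lemma abs_dominated_sub_dominated_le (hq : 1 < q) (k : Fin q) (m m' : ℝ) (i : Fin q) :
    |dominated k m i - dominated k m' i| ≤ |m - m'| := by
  have hq' : (1 : ℝ) ≤ q - 1 := by linarith [show (2 : ℝ) ≤ q from mod_cast hq]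
  rcases eq_or_ne i k with rfl | hi
  · rw [dominated_self, dominated_self]
  · rw [dominated_of_ne hi, dominated_of_ne hi, ← sub_div, sub_sub_sub_cancel_left, abs_div,
      abs_sub_comm, abs_of_pos (zero_lt_one.trans_le hq')]
    exact div_le_self (abs_nonneg _) hq'

/-- The deviation of `s` from the vector on the axis `dominated k` with the same entry at `k`. -/
def transverse (k : Fin q) (s : Fin q → ℝ) : Fin q → ℝ := s - dominated k (s k)

/-- The squared Euclidean norm of the deviation of `s` from the axis `dominated k`. -/
def transverseSq (k : Fin q) (s : Fin q → ℝ) : ℝ := ∑ i, transverse k s i ^ 2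

lemma transverse_self (k : Fin q) (s : Fin q → ℝ) : transverse k s k = 0 := by
  simp [transverse, dominated_self]

lemma transverse_of_ne {k i : Fin q} (hi : i ≠ k) (s : Fin q → ℝ) :
    transverse k s i = s i - (1 - s k) / ((q : ℝ) - 1) := by
  simp [transverse, dominated_of_ne hi]

lemma sum_transverse (hq : 1 < q) (k : Fin q) {s : Fin q → ℝ} (hs : ∑ i, s i = 1) :
    ∑ i, transverse k s i = 0 := by
  simp [transverse, hs, sum_dominated hq]

lemma sum_erase_transverse (hq : 1 < q) (k : Fin q) {s : Fin q → ℝ} (hs : ∑ i, s i = 1) :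
    ∑ i ∈ Finset.univ.erase k, transverse k s i = 0 := by
  rw [← sum_transverse hq k hs, ← Finset.add_sum_erase _ _ (Finset.mem_univ k), transverse_self,
    zero_add]

lemma transverseSq_nonneg (k : Fin q) (s : Fin q → ℝ) : 0 ≤ transverseSq k s :=
  Finset.sum_nonneg fun _ _ => sq_nonneg _

lemma sq_transverse_le_transverseSq (k : Fin q) (s : Fin q → ℝ) (i : Fin q) :
    transverse k s i ^ 2 ≤ transverseSq k s :=
  Finset.single_le_sum (f := fun i => transverse k s i ^ 2) (fun _ _ => sq_nonneg _)
    (Finset.mem_univ i)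

lemma abs_transverse_le_one (hq : 1 < q) (k : Fin q) {s : Fin q → ℝ} (hs₀ : ∀ i, 0 ≤ s i)
    (hs : ∑ i, s i = 1) (i : Fin q) : |transverse k s i| ≤ 1 := by
  have hq' : (1 : ℝ) ≤ q - 1 := by linarith [show (2 : ℝ) ≤ q from mod_cast hq]
  have hs₁ (j : Fin q) : s j ≤ 1 :=
    hs ▸ Finset.single_le_sum (fun i _ => hs₀ i) (Finset.mem_univ j)
  rcases eq_or_ne i k with rfl | hi
  · simp [transverse_self]
  · have h₀ : 0 ≤ (1 - s k) / ((q : ℝ) - 1) :=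
      div_nonneg (by linarith [hs₁ k]) (zero_le_one.trans hq')
    have h₁ : (1 - s k) / ((q : ℝ) - 1) ≤ 1 :=
      div_le_one_of_le₀ (by linarith [hs₀ k]) (zero_le_one.trans hq')
    rw [transverse_of_ne hi, abs_le]
    exact ⟨by linarith [hs₀ i], by linarith [hs₁ i]⟩

lemma transverse_dotProduct_dominated (hq : 1 < q) (k : Fin q) {s : Fin q → ℝ}
    (hs : ∑ i, s i = 1) (m : ℝ) : transverse k s ⬝ᵥ dominated k m = 0 := by
  have h (i : Fin q) :
      transverse k s i * dominated k m i = transverse k s i * ((1 - m) / ((q : ℝ) - 1)) := by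
    rcases eq_or_ne i k with rfl | hi
    · simp [transverse_self]
    · rw [dominated_of_ne hi]
  simp only [dotProduct, h, ← Finset.sum_mul, sum_transverse hq k hs, zero_mul]

lemma transverse_dotProduct_self (hq : 1 < q) (k : Fin q) {s : Fin q → ℝ} (hs : ∑ i, s i = 1) :
    transverse k s ⬝ᵥ s = transverseSq k s := by
  rw [← sub_zero (transverse k s ⬝ᵥ s), ← transverse_dotProduct_dominated hq k hs (s k),
    ← dotProduct_sub]
  exact Finset.sum_congr rfl fun i _ => (sq _).symm

lemma transverseSq_le_of_abs_sub_le (hq : 1 < q) (k : Fin q) {s s' : Fin q → ℝ}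
    (hs : ∑ i, s i = 1) {ε : ℝ} (hε : ∀ i, |s' i - s i| ≤ ε) :
    transverseSq k s' ≤ transverseSq k s + (2 • transverse k s) ⬝ᵥ (s' - s) + 4 * q * ε ^ 2 := by
  set d := (s' - s) - (dominated k (s' k) - dominated k (s k)) with hd
  have hexpand : transverseSq k s' =
      transverseSq k s + (2 • transverse k s) ⬝ᵥ d + ∑ i, d i ^ 2 := by
    simp only [transverseSq, dotProduct, ← Finset.sum_add_distrib]
    refine Finset.sum_congr rfl fun i _ => ?_
    simp only [hd, transverse, nsmul_eq_mul, Pi.sub_apply, Pi.mul_apply, Pi.natCast_apply]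
    ring
  have hd_sq (i : Fin q) : d i ^ 2 ≤ 4 * ε ^ 2 := by
    have hdi : |d i| ≤ 2 * ε := by
      calc |d i| ≤ |s' i - s i| + |dominated k (s' k) i - dominated k (s k) i| := abs_sub _ _
        _ ≤ ε + ε :=
          add_le_add (hε i) ((abs_dominated_sub_dominated_le hq k _ _ i).trans (hε k))
        _ = 2 * ε := by ring
    calc d i ^ 2 ≤ (2 * ε) ^ 2 := sq_le_sq' (abs_le.1 hdi).1 (abs_le.1 hdi).2
      _ = 4 * ε ^ 2 := by ring
  have hdot : (2 • transverse k s) ⬝ᵥ d = (2 • transverse k s) ⬝ᵥ (s' - s) := by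
    simp only [hd, dotProduct_sub, smul_dotProduct, transverse_dotProduct_dominated hq k hs]
    simp
  rw [hexpand, hdot]
  gcongr
  calc ∑ i, d i ^ 2 ≤ ∑ _i : Fin q, 4 * ε ^ 2 := Finset.sum_le_sum fun i _ => hd_sq i
    _ = 4 * q * ε ^ 2 := by simp; ring

/-! ### Softmax near the axis -/

lemma exp_sub_one_sub_le_sq_mul_exp_abs (u : ℝ) :
    Real.exp u - 1 - u ≤ u ^ 2 * Real.exp |u| := by
  have h := Complex.norm_exp_sub_sum_le_norm_mul_exp (u : ℂ) 2
  have hsum : Complex.exp u - ∑ m ∈ Finset.range 2, (u : ℂ) ^ m / m.factorial =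
      ((Real.exp u - 1 - u : ℝ) : ℂ) := by
    simp [Finset.sum_range_succ, sub_sub]
  rw [hsum, Complex.norm_real, Complex.norm_real, Real.norm_eq_abs, Real.norm_eq_abs, sq_abs] at h
  exact (le_abs_self _).trans h

lemma softmax_eq_inv_one_add_sum (β : ℝ) (s : Fin q → ℝ) (k : Fin q) :
    softmax β s k = (1 + ∑ i ∈ Finset.univ.erase k, Real.exp (β * (s i - s k)))⁻¹ := by
  have h (i : Fin q) : Real.exp (β * s i) = Real.exp (β * s k) * Real.exp (β * (s i - s k)) := by
    rw [← Real.exp_add]; ring_nf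
  rw [softmax, Finset.sum_congr rfl fun i _ => h i, ← Finset.mul_sum, ← div_div,
    div_self (Real.exp_pos _).ne', one_div, ← Finset.add_sum_erase _ _ (Finset.mem_univ k)]
  simp

lemma softmax_dominated_self (hq : 1 < q) (β : ℝ) (k : Fin q) (m : ℝ) :
    softmax β (dominated k m) k = m + drift q β m := by
  have hq' : (q : ℝ) - 1 ≠ 0 := (sub_pos.2 (Nat.one_lt_cast.2 hq)).ne'
  have h : ∀ i ∈ Finset.univ.erase k, Real.exp (β * (dominated k m i - dominated k m k)) =
      Real.exp (β * ((1 - q * m) / ((q : ℝ) - 1))) := fun i hi => by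
    rw [dominated_of_ne (Finset.ne_of_mem_erase hi), dominated_self]
    congr 2
    field_simp
    ring
  rw [softmax_eq_inv_one_add_sum, Finset.sum_congr rfl h, sum_erase_const hq, drift]
  ring

lemma sum_erase_exp_transverse_mem_Icc (hq : 1 < q) (hβ : 0 ≤ β) (k : Fin q) {s : Fin q → ℝ}
    (hs₀ : ∀ i, 0 ≤ s i) (hs : ∑ i, s i = 1) :
    ∑ i ∈ Finset.univ.erase k, Real.exp (β * transverse k s i) ∈
      Set.Icc ((q : ℝ) - 1) (q - 1 + β ^ 2 * Real.exp β * transverseSq k s) := by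
  have hlin : ∑ i ∈ Finset.univ.erase k, (1 + β * transverse k s i) = (q : ℝ) - 1 := by
    rw [Finset.sum_add_distrib, ← Finset.mul_sum, sum_erase_transverse hq k hs, sum_erase_const hq]
    ring
  have hquad (i : Fin q) : Real.exp (β * transverse k s i) ≤
      1 + β * transverse k s i + β ^ 2 * Real.exp β * transverse k s i ^ 2 := by
    have habs : |β * transverse k s i| ≤ β := by
      rw [abs_mul, abs_of_nonneg hβ]
      exact mul_le_of_le_one_right hβ (abs_transverse_le_one hq k hs₀ hs i)
    have hexp : (β * transverse k s i) ^ 2 * Real.exp |β * transverse k s i| ≤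
        (β * transverse k s i) ^ 2 * Real.exp β := by gcongr
    linarith [exp_sub_one_sub_le_sq_mul_exp_abs (β * transverse k s i)]
  constructor
  · rw [← hlin]
    exact Finset.sum_le_sum fun i _ => by linarith [Real.add_one_le_exp (β * transverse k s i)]
  · calc ∑ i ∈ Finset.univ.erase k, Real.exp (β * transverse k s i)
        ≤ ∑ i ∈ Finset.univ.erase k, (1 + β * transverse k s i) +
            ∑ i ∈ Finset.univ.erase k, β ^ 2 * Real.exp β * transverse k s i ^ 2 := by
          rw [← Finset.sum_add_distrib]
          exact Finset.sum_le_sum fun i _ => hquad i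
      _ ≤ q - 1 + β ^ 2 * Real.exp β * transverseSq k s := by
          rw [hlin, ← Finset.mul_sum]
          gcongr
          exact Finset.sum_le_sum_of_subset_of_nonneg (Finset.subset_univ _)
            fun _ _ _ => sq_nonneg _

lemma abs_inv_one_add_sub_le {x y : ℝ} (hx : 0 ≤ x) (hy : 0 ≤ y) :
    |(1 + x)⁻¹ - (1 + y)⁻¹| ≤ |x - y| := by
  have hx₁ : 0 < 1 + x := by linarith
  have hy₁ : 0 < 1 + y := by linarith
  rw [inv_sub_inv hx₁.ne' hy₁.ne', add_sub_add_left_eq_sub, abs_div, abs_sub_comm,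
    abs_of_pos (mul_pos hx₁ hy₁)]
  exact div_le_self (abs_nonneg _) (by nlinarith)

lemma abs_softmax_sub_drift_le (hq : 1 < q) (hβ : 0 ≤ β) (k : Fin q) {s : Fin q → ℝ}
    (hs₀ : ∀ i, 0 ≤ s i) (hs : ∑ i, s i = 1) :
    |softmax β s k - s k - drift q β (s k)| ≤
      β ^ 2 * Real.exp (2 * β) * transverseSq k s := by
  have hq' : (1 : ℝ) ≤ q - 1 := by linarith [show (2 : ℝ) ≤ q from mod_cast hq]
  set E := Real.exp (β * ((1 - s k) / ((q : ℝ) - 1) - s k)) with hE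
  have hE_le : E ≤ Real.exp β := by
    refine Real.exp_le_exp.2 (mul_le_of_le_one_right hβ ?_)
    have : (1 - s k) / ((q : ℝ) - 1) ≤ 1 :=
      div_le_one_of_le₀ (by linarith [hs₀ k]) (by linarith)
    linarith [hs₀ k]
  have hsoftmax : softmax β s k =
      (1 + E * ∑ i ∈ Finset.univ.erase k, Real.exp (β * transverse k s i))⁻¹ := by
    rw [softmax_eq_inv_one_add_sum, Finset.mul_sum]
    congr 2
    refine Finset.sum_congr rfl fun i hi => ?_
    rw [transverse_of_ne (Finset.ne_of_mem_erase hi), hE, ← Real.exp_add]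
    ring_nf
  have haxis : s k + drift q β (s k) = (1 + E * ((q : ℝ) - 1))⁻¹ := by
    have : (1 - q * s k) / ((q : ℝ) - 1) = (1 - s k) / ((q : ℝ) - 1) - s k := by
      field_simp; ring
    rw [drift, this, mul_comm ((q : ℝ) - 1)]
    ring
  obtain ⟨hlo, hhi⟩ := sum_erase_exp_transverse_mem_Icc hq hβ k hs₀ hs
  rw [sub_sub, haxis, hsoftmax]
  have hE₀ : 0 ≤ E := (Real.exp_pos _).le
  calc |(1 + E * ∑ i ∈ Finset.univ.erase k, Real.exp (β * transverse k s i))⁻¹ -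
          (1 + E * ((q : ℝ) - 1))⁻¹|
      ≤ |E * ∑ i ∈ Finset.univ.erase k, Real.exp (β * transverse k s i) - E * ((q : ℝ) - 1)| :=
        abs_inv_one_add_sub_le (by positivity) (mul_nonneg hE₀ (by linarith))
    _ = E * (∑ i ∈ Finset.univ.erase k, Real.exp (β * transverse k s i) - ((q : ℝ) - 1)) := by
        rw [← mul_sub, abs_of_nonneg (mul_nonneg hE₀ (sub_nonneg.2 hlo))]
    _ ≤ Real.exp β * (β ^ 2 * Real.exp β * transverseSq k s) := by
        gcongr
        linarith
    _ = β ^ 2 * Real.exp (2 * β) * transverseSq k s := by rw [two_mul, Real.exp_add]; ring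

lemma abs_meanInc_sub_drift_le [NeZero n] [NeZero q] (hq : 1 < q) (hβ : 0 ≤ β)
    (σ : Config n q) (k : Fin q) :
    |n * meanInc n q β σ k - drift q β (proportions σ k)| ≤
      (β ^ 2 + 2 * β) * Real.exp (2 * β) * (transverseSq k (proportions σ) + 1 / n) := by
  have hT := transverseSq_nonneg k (proportions σ)
  have htri := abs_sub_le (n * meanInc n q β σ k)
    (softmax β (proportions σ) k - proportions σ k) (drift q β (proportions σ k))
  have hmean := abs_meanInc_sub_le hβ σ k
  have hsoftmax := abs_softmax_sub_drift_le hq hβ k (proportions_nonneg σ) (sum_proportions σ)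
  have hcross : 0 ≤ 2 * β * Real.exp (2 * β) * transverseSq k (proportions σ) +
      β ^ 2 * Real.exp (2 * β) * (1 / n) := by positivity
  rw [← mul_one_div] at hmean
  linarith

/-! ### Contraction of the transverse deviation -/

lemma mul_exp_sub_one_mem_Icc (hβ : 0 ≤ β) {w r : ℝ} (hw : |w| ≤ r) :
    w * (Real.exp (β * w) - 1) ∈ Set.Icc 0 (β * Real.exp (β * r) * w ^ 2) := by
  constructor
  · rcases le_total 0 w with h | h
    · exact mul_nonneg h (sub_nonneg.2 (Real.one_le_exp (mul_nonneg hβ h)))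
    · exact mul_nonneg_of_nonpos_of_nonpos h
        (sub_nonpos.2 (Real.exp_le_one_iff.2 (mul_nonpos_of_nonneg_of_nonpos hβ h)))
  · calc w * (Real.exp (β * w) - 1) ≤ |w| * |Real.exp (β * w) - 1| :=
          (le_abs_self _).trans (abs_mul _ _).le
      _ ≤ |w| * (|β * w| * Real.exp |β * w|) := by
          gcongr
          exact abs_exp_sub_one_le_mul_exp_abs _
      _ = β * Real.exp (β * |w|) * w ^ 2 := by
          rw [abs_mul, abs_of_nonneg hβ, ← sq_abs w]
          ring
      _ ≤ β * Real.exp (β * r) * w ^ 2 := by gcongr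

lemma sub_mul_exp_le_sum_exp (hq : 1 < q) (hβ : 0 ≤ β) (k : Fin q) {s : Fin q → ℝ}
    (hs : ∑ i, s i = 1) {r : ℝ} (hr : 0 ≤ r) (hk : 1 / (q : ℝ) - r ≤ s k) :
    (q - 2 * β * r) * Real.exp (β * ((1 - s k) / ((q : ℝ) - 1))) ≤ ∑ l, Real.exp (β * s l) := by
  have hq' : (2 : ℝ) ≤ q := mod_cast hq
  set a := (1 - s k) / ((q : ℝ) - 1) with ha
  have ha_le : q * a - 1 ≤ 2 * r := by
    have hqa : q * a - 1 = (1 - q * s k) / ((q : ℝ) - 1) := by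
      have : (q : ℝ) - 1 ≠ 0 := by linarith
      rw [ha]
      field_simp
      ring
    have hqk : 1 - q * s k ≤ q * r := by
      have := mul_le_mul_of_nonneg_left hk (by linarith : (0 : ℝ) ≤ q)
      rw [mul_sub, mul_one_div_cancel (by linarith)] at this
      linarith
    rw [hqa, div_le_iff₀ (by linarith)]
    nlinarith
  calc (q - 2 * β * r) * Real.exp (β * a)
      ≤ (q - β * (q * a - 1)) * Real.exp (β * a) := by
        gcongr ?_ * _
        linarith [mul_le_mul_of_nonneg_left ha_le hβ]
    _ = ∑ l, (1 + β * (s l - a)) * Real.exp (β * a) := by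
        simp only [← Finset.sum_mul, Finset.sum_add_distrib, ← Finset.mul_sum,
          Finset.sum_sub_distrib, hs, Finset.sum_const, Finset.card_univ, Fintype.card_fin,
          nsmul_eq_mul]
        ring
    _ ≤ ∑ l, Real.exp (β * (s l - a)) * Real.exp (β * a) := by
        gcongr with l
        linarith [Real.add_one_le_exp (β * (s l - a))]
    _ = ∑ l, Real.exp (β * s l) := by
        refine Finset.sum_congr rfl fun l _ => ?_
        rw [← Real.exp_add]
        ring_nf

lemma transverse_dotProduct_softmax_le (hq : 1 < q) (hβ : 0 ≤ β) (k : Fin q) {s : Fin q → ℝ}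
    (hs : ∑ i, s i = 1) {r : ℝ} (hr : 0 ≤ r) (hrq : 2 * β * r < q)
    (hk : 1 / (q : ℝ) - r ≤ s k) (hT : transverseSq k s ≤ r ^ 2) :
    transverse k s ⬝ᵥ softmax β s ≤
      β * Real.exp (β * r) / (q - 2 * β * r) * transverseSq k s := by
  have : NeZero q := ⟨by lia⟩
  set w := transverse k s with hw
  set a := (1 - s k) / ((q : ℝ) - 1) with ha
  set Z := ∑ l, Real.exp (β * s l) with hZ
  have hZ₀ : 0 < Z := sum_exp_pos _
  have hw_mem (i : Fin q) : w i * (Real.exp (β * w i) - 1) ∈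
      Set.Icc 0 (β * Real.exp (β * r) * w i ^ 2) :=
    mul_exp_sub_one_mem_Icc hβ
      (abs_le_of_sq_le_sq ((sq_transverse_le_transverseSq k s i).trans hT) hr)
  have hcentre : w ⬝ᵥ softmax β s =
      Real.exp (β * a) / Z * ∑ i, w i * (Real.exp (β * w i) - 1) := by
    simp only [mul_sub, mul_one, Finset.sum_sub_distrib, hw, sum_transverse hq k hs, sub_zero]
    rw [dotProduct, Finset.mul_sum]
    refine Finset.sum_congr rfl fun i _ => ?_
    rcases eq_or_ne i k with rfl | hi
    · simp [transverse_self]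
    · have hsi : s i = a + transverse k s i := by rw [transverse_of_ne hi]; ring
      rw [softmax, ← hZ, show β * s i = β * a + β * transverse k s i by rw [hsi]; ring,
        Real.exp_add]
      ring
  have hZ_le : Real.exp (β * a) / Z ≤ 1 / (q - 2 * β * r) := by
    rw [div_le_div_iff₀ hZ₀ (by linarith), one_mul, mul_comm]
    exact sub_mul_exp_le_sum_exp hq hβ k hs hr hk
  calc w ⬝ᵥ softmax β s = Real.exp (β * a) / Z * ∑ i, w i * (Real.exp (β * w i) - 1) := hcentre
    _ ≤ 1 / (q - 2 * β * r) * ∑ i, β * Real.exp (β * r) * w i ^ 2 :=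
        mul_le_mul hZ_le (Finset.sum_le_sum fun i _ => (hw_mem i).2)
          (Finset.sum_nonneg fun i _ => (hw_mem i).1) (by simp [hrq.le])
    _ = β * Real.exp (β * r) / (q - 2 * β * r) * transverseSq k s := by
        rw [← Finset.mul_sum, transverseSq]
        ring

lemma mul_transverse_dotProduct_meanInc_le [NeZero n] [NeZero q] (hq : 1 < q) (hβ : 0 ≤ β)
    (k : Fin q) (σ : Config n q) :
    n * (transverse k (proportions σ) ⬝ᵥ meanInc n q β σ) ≤
      transverse k (proportions σ) ⬝ᵥ softmax β (proportions σ) -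
        transverseSq k (proportions σ) + q * (2 * β * Real.exp (2 * β) / n) := by
  have hs := sum_proportions σ
  set s := proportions σ
  have herr (i : Fin q) :
      transverse k s i * (n * meanInc n q β σ i - (softmax β s i - s i)) ≤
        2 * β * Real.exp (2 * β) / n :=
    calc _ ≤ |transverse k s i| * |n * meanInc n q β σ i - (softmax β s i - s i)| :=
          (le_abs_self _).trans (abs_mul _ _).le
      _ ≤ 1 * (2 * β * Real.exp (2 * β) / n) :=
          mul_le_mul (abs_transverse_le_one hq k (proportions_nonneg σ) hs i)
            (abs_meanInc_sub_le hβ σ i) (abs_nonneg _) zero_le_one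
      _ = 2 * β * Real.exp (2 * β) / n := one_mul _
  have hsum : transverse k s ⬝ᵥ ((n : ℝ) • meanInc n q β σ - (softmax β s - s)) ≤
      q * (2 * β * Real.exp (2 * β) / n) := by
    simpa [dotProduct] using Finset.sum_le_sum fun i (_ : i ∈ Finset.univ) => herr i
  simp only [dotProduct_sub, dotProduct_smul, transverse_dotProduct_self hq k hs,
    smul_eq_mul] at hsum
  linarith

lemma glauber_mulVec_transverseSq_le [NeZero n] [NeZero q] (hq : 1 < q) (hβ : 0 ≤ β) (k : Fin q)
    (σ : Config n q) {r : ℝ} (hr : 0 ≤ r) (hrq : 2 * β * r < q)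
    (hk : 1 / (q : ℝ) - r ≤ proportions σ k) (hT : transverseSq k (proportions σ) ≤ r ^ 2) :
    (glauber n q β *ᵥ fun τ => transverseSq k (proportions τ)) σ ≤
      transverseSq k (proportions σ) -
        2 * (1 - β * Real.exp (β * r) / (q - 2 * β * r)) / n * transverseSq k (proportions σ) +
      (4 * q + 4 * q * β * Real.exp (2 * β)) / n ^ 2 := by
  have hn : (n : ℝ) ≠ 0 := NeZero.ne _
  have hs := sum_proportions σ
  have hstep := glauber_mulVec_le_of_update_le_affine (β := β)
    (F := fun τ => transverseSq k (proportions τ)) (σ := σ)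
    (A := transverseSq k (proportions σ) + 4 * q * (1 / n) ^ 2)
    (c := 2 • transverse k (proportions σ)) fun v l => by
      linarith [transverseSq_le_of_abs_sub_le hq k hs
        fun i => abs_proportions_update_sub_le σ v l i]
  have hmean := mul_transverse_dotProduct_meanInc_le (β := β) hq hβ k σ
  have hsoftmax := transverse_dotProduct_softmax_le hq hβ k hs hr hrq hk hT
  set T := transverseSq k (proportions σ)
  set θ := β * Real.exp (β * r) / (q - 2 * β * r)
  calc _ ≤ T + 4 * q * (1 / n) ^ 2 +
        2 / n * (n * (transverse k (proportions σ) ⬝ᵥ meanInc n q β σ)) := by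
        refine hstep.trans_eq ?_
        rw [smul_dotProduct, nsmul_eq_mul]
        field_simp
        push_cast
        ring
    _ ≤ T + 4 * q * (1 / n) ^ 2 +
        2 / n * (θ * T - T + q * (2 * β * Real.exp (2 * β) / n)) := by
        gcongr
        linarith
    _ = T - 2 * (1 - θ) / n * T + (4 * q + 4 * q * β * Real.exp (2 * β)) / n ^ 2 := by
        field_simp
        ring

lemma exists_pos_contraction_radius (hβ₀ : 0 ≤ β) (hβ : β < q) :
    ∃ r > 0, 2 * β * r < q ∧ β * Real.exp (β * r) / (q - 2 * β * r) < 1 := by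
  have hq : (0 : ℝ) < q := by linarith
  have hden : ∀ᶠ r in 𝓝[>] (0 : ℝ), 2 * β * r < q := by
    have : ContinuousAt (fun r : ℝ => 2 * β * r) 0 := by fun_prop
    exact nhdsWithin_le_nhds (this.tendsto.eventually_lt_const (by simpa using hq))
  have hratio : ∀ᶠ r in 𝓝[>] (0 : ℝ), β * Real.exp (β * r) / (q - 2 * β * r) < 1 := by
    have : ContinuousAt (fun r : ℝ => β * Real.exp (β * r) / (q - 2 * β * r)) 0 :=
      ContinuousAt.div (by fun_prop) (by fun_prop) (by simpa using hq.ne')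
    refine nhdsWithin_le_nhds (this.tendsto.eventually_lt_const ?_)
    simpa using (div_lt_one hq).2 hβ
  obtain ⟨r, hr, hrq, hr_lt⟩ :=
    ((eventually_mem_nhdsWithin (s := Set.Ioi (0 : ℝ))).and (hden.and hratio)).exists
  exact ⟨r, hr, hrq, hr_lt⟩

end TransverseDeviation

section SoftmaxContraction

variable {ι : Type*} [Fintype ι]

/-! ### Local contraction of the softmax map -/

/-- The derivative of the softmax map at `s`. -/
def softmaxDeriv (β : ℝ) (s : ι → ℝ) : (ι → ℝ) →L[ℝ] ι → ℝ :=
  ContinuousLinearMap.pi fun k => (β * softmax β s k) •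
    (ContinuousLinearMap.proj k - ∑ i, softmax β s i • ContinuousLinearMap.proj i)

lemma softmaxDeriv_apply (β : ℝ) (s z : ι → ℝ) (k : ι) :
    softmaxDeriv β s z k = β * softmax β s k * (z k - softmax β s ⬝ᵥ z) := by
  simp [softmaxDeriv, dotProduct]

lemma sum_softmax [Nonempty ι] (β : ℝ) (s : ι → ℝ) : ∑ k, softmax β s k = 1 := by
  simp only [softmax, ← Finset.sum_div]
  exact div_self (sum_exp_pos _).ne'

lemma softmax_eq_exp_sub_log [Nonempty ι] (β : ℝ) (s : ι → ℝ) (k : ι) :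
    softmax β s k = Real.exp (β * s k - Real.log (∑ i, Real.exp (β * s i))) := by
  rw [Real.exp_sub, Real.exp_log (sum_exp_pos _), softmax]

lemma hasStrictFDerivAt_softmax [Nonempty ι] (β : ℝ) (s : ι → ℝ) :
    HasStrictFDerivAt (softmax β) (softmaxDeriv β s) s := by
  refine hasStrictFDerivAt_pi.2 fun k => ?_
  have hlin (i : ι) : HasStrictFDerivAt (fun s : ι → ℝ => β * s i)
      (β • ContinuousLinearMap.proj (R := ℝ) (φ := fun _ : ι => ℝ) i) s :=
    (hasStrictFDerivAt_apply i s).const_mul β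
  have hlogsum := (HasStrictFDerivAt.fun_sum (u := Finset.univ) fun i _ => (hlin i).exp).log
    (sum_exp_pos _).ne'
  convert! ((hlin k).sub hlogsum).exp using 1
  · exact funext fun s => softmax_eq_exp_sub_log β s k
  · ext z
    simp only [Pi.sub_apply, ← softmax_eq_exp_sub_log, softmax, smul_smul, Finset.smul_sum]
    simp only [_root_.smul_apply, _root_.sub_apply, _root_.sum_apply,
      ContinuousLinearMap.proj_apply, smul_eq_mul, mul_sub, Finset.mul_sum]
    congr 1
    · ring
    · exact Finset.sum_congr rfl fun i _ => by ring

variable {q : ℕ} {β p : ℝ}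

lemma softmax_dominated (hq : 1 < q) (k : Fin q) (hp : drift q β p = 0) :
    softmax β (dominated k p) = dominated k p := by
  have : NeZero q := ⟨by lia⟩
  have hq' : (q : ℝ) - 1 ≠ 0 := (sub_pos.2 (Nat.one_lt_cast.2 hq)).ne'
  have hk : softmax β (dominated k p) k = p := by
    rw [softmax_dominated_self hq, hp, add_zero]
  funext i
  rcases eq_or_ne i k with rfl | hi
  · rw [hk, dominated_self]
  · have hconst : ∀ j ∈ Finset.univ.erase k,
        softmax β (dominated k p) j = softmax β (dominated k p) i := fun j hj => by
      rw [softmax, softmax, dominated_of_ne (Finset.ne_of_mem_erase hj), dominated_of_ne hi]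
    have hsum := sum_softmax β (dominated k p)
    rw [← Finset.add_sum_erase _ _ (Finset.mem_univ k), hk, Finset.sum_congr rfl hconst,
      sum_erase_const hq] at hsum
    rw [dominated_of_ne hi, eq_div_iff hq']
    linarith

lemma dominated_dotProduct (k : Fin q) {z : Fin q → ℝ} (hz : ∑ i, z i = 0) :
    dominated k p ⬝ᵥ z = (p - (1 - p) / ((q : ℝ) - 1)) * z k := by
  have hdecomp (i : Fin q) : dominated k p i * z i =
      (1 - p) / ((q : ℝ) - 1) * z i +
        if i = k then (p - (1 - p) / ((q : ℝ) - 1)) * z i else 0 := by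
    rcases eq_or_ne i k with rfl | hi
    · rw [dominated_self, if_pos rfl]; ring
    · rw [dominated_of_ne hi, if_neg hi, add_zero]
  simp [dotProduct, hdecomp, Finset.sum_add_distrib, ← Finset.mul_sum, hz]

lemma sum_abs_softmaxDeriv_dominated_le (hq : 1 < q) (hβ : 0 ≤ β) (k : Fin q)
    (hp₀ : 1 / (q : ℝ) ≤ p) (hp₁ : p ≤ 1) (hp : drift q β p = 0) {z : Fin q → ℝ}
    (hz : ∑ i, z i = 0) :
    ∑ l, |softmaxDeriv β (dominated k p) z l| ≤
      β * q * p * (1 - p) / (q - 1) * ∑ l, |z l| := by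
  have hq₀ : (1 : ℝ) < q := mod_cast hq
  have hqp : 1 ≤ q * p := by rwa [div_le_iff₀' (by linarith)] at hp₀
  simp only [softmaxDeriv_apply, softmax_dominated hq k hp, dominated_dotProduct k hz]
  set a := (1 - p) / ((q : ℝ) - 1) with ha
  have ha_mul : (q - 1) * a = 1 - p := mul_div_cancel₀ _ (by linarith)
  have hβa : 0 ≤ β * a := mul_nonneg hβ (div_nonneg (by linarith) (by linarith))
  have hpa : 0 ≤ p - a := by nlinarith
  set A := ∑ i ∈ Finset.univ.erase k, |z i| with hA
  have hzk : |z k| ≤ A := by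
    have hz_erase : z k = -∑ i ∈ Finset.univ.erase k, z i := by
      linarith [Finset.add_sum_erase _ z (Finset.mem_univ k)]
    rw [hz_erase, abs_neg]
    exact Finset.abs_sum_le_sum_abs _ _
  have hk : |β * p * (z k - (p - a) * z k)| = β * a * (q * p) * |z k| := by
    rw [← abs_of_nonneg (mul_nonneg hβa (by linarith : 0 ≤ q * p)), ← abs_mul]
    congr 1
    linear_combination (-β * p * z k) * ha_mul
  have hrest : ∑ i ∈ Finset.univ.erase k, |β * dominated k p i * (z i - (p - a) * z k)| ≤
      β * a * (A + (q * p - 1) * |z k|) :=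
    calc _ ≤ ∑ i ∈ Finset.univ.erase k, β * a * (|z i| + (p - a) * |z k|) := by
          refine Finset.sum_le_sum fun i hi => ?_
          rw [dominated_of_ne (Finset.ne_of_mem_erase hi), ← ha, abs_mul, abs_of_nonneg hβa]
          gcongr
          exact (abs_sub _ _).trans_eq (by rw [abs_mul, abs_of_nonneg hpa])
      _ = β * a * (A + (q * p - 1) * |z k|) := by
          rw [← Finset.mul_sum, Finset.sum_add_distrib, sum_erase_const hq, ← hA]
          linear_combination (-(β * a) * |z k|) * ha_mul
  calc _ ≤ β * a * (q * p) * |z k| + β * a * (A + (q * p - 1) * |z k|) := by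
        rw [← Finset.add_sum_erase _ _ (Finset.mem_univ k), dominated_self, hk]
        gcongr
    _ ≤ β * a * (q * p) * (|z k| + A) := by
        nlinarith [mul_nonneg hβa (mul_nonneg (sub_nonneg.2 hqp) (sub_nonneg.2 hzk))]
    _ = β * q * p * (1 - p) / (q - 1) * ∑ l, |z l| := by
        rw [← Finset.add_sum_erase _ _ (Finset.mem_univ k), ha]
        ring

lemma eventually_sum_abs_softmax_sub_le (hq : 1 < q) (hβ : 0 ≤ β) (hp₀ : 1 / (q : ℝ) ≤ p)
    (hp₁ : p ≤ 1) (hp : drift q β p = 0) {κ : ℝ} (hκ : β * q * p * (1 - p) / (q - 1) < κ)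
    (k : Fin q) :
    ∀ᶠ s in 𝓝 (dominated k p, dominated k p), ∑ i, s.1 i = ∑ i, s.2 i →
      ∑ l, |softmax β s.1 l - softmax β s.2 l| ≤ κ * ∑ l, |s.1 l - s.2 l| := by
  have : NeZero q := ⟨by lia⟩
  have hq₀ : (0 : ℝ) < q := by simp [Nat.pos_of_ne_zero (NeZero.ne q)]
  set θ := β * q * p * (1 - p) / (q - 1)
  set D := softmaxDeriv β (dominated k p)
  filter_upwards [(hasStrictFDerivAt_iff_isLittleO.1
    (hasStrictFDerivAt_softmax β (dominated k p))).def (div_pos (sub_pos.2 hκ) hq₀)] with s hs hsum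
  have hz : ∑ i, (s.1 - s.2) i = 0 := by simp [hsum]
  have hnorm : ‖s.1 - s.2‖ ≤ ∑ i, |s.1 i - s.2 i| :=
    (pi_norm_le_iff_of_nonneg (Finset.sum_nonneg fun _ _ => abs_nonneg _)).2 fun i =>
      Finset.single_le_sum (f := fun i => |s.1 i - s.2 i|) (fun _ _ => abs_nonneg _)
        (Finset.mem_univ i)
  have hcoord (l : Fin q) : |softmax β s.1 l - softmax β s.2 l| ≤
      |D (s.1 - s.2) l| + (κ - θ) / q * ∑ i, |s.1 i - s.2 i| := by
    have hrem := ((norm_le_pi_norm _ l).trans hs).trans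
      (mul_le_mul_of_nonneg_left hnorm (div_pos (sub_pos.2 hκ) hq₀).le)
    have := abs_sub_abs_le_abs_sub (softmax β s.1 l - softmax β s.2 l) (D (s.1 - s.2) l)
    simp only [Real.norm_eq_abs, Pi.sub_apply] at hrem
    linarith
  calc _ ≤ ∑ l, (|D (s.1 - s.2) l| + (κ - θ) / q * ∑ i, |s.1 i - s.2 i|) :=
        Finset.sum_le_sum fun l _ => hcoord l
    _ ≤ θ * ∑ l, |s.1 l - s.2 l| + q * ((κ - θ) / q * ∑ i, |s.1 i - s.2 i|) := by
        rw [Finset.sum_add_distrib, Finset.sum_const, Finset.card_univ, Fintype.card_fin,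
          nsmul_eq_mul]
        gcongr
        exact sum_abs_softmaxDeriv_dominated_le hq hβ k hp₀ hp₁ hp hz
    _ = κ * ∑ l, |s.1 l - s.2 l| := by
        field_simp
        ring

lemma exists_softmax_contraction (hq : 1 < q) (hβ : 0 ≤ β) (hp₀ : 1 / (q : ℝ) ≤ p)
    (hp₁ : p ≤ 1) (hp : drift q β p = 0) {κ : ℝ} (hκ : β * q * p * (1 - p) / (q - 1) < κ) :
    ∃ ε > 0, ∀ (k : Fin q) (s s' : Fin q → ℝ), (∀ i, |s i - dominated k p i| < ε) →
      (∀ i, |s' i - dominated k p i| < ε) → ∑ i, s i = ∑ i, s' i →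
      ∑ l, |softmax β s l - softmax β s' l| ≤ κ * ∑ l, |s l - s' l| := by
  have hk (k : Fin q) : ∀ᶠ ε in 𝓝[>] (0 : ℝ), ∀ s s' : Fin q → ℝ,
      (∀ i, |s i - dominated k p i| < ε) → (∀ i, |s' i - dominated k p i| < ε) →
      ∑ i, s i = ∑ i, s' i →
      ∑ l, |softmax β s l - softmax β s' l| ≤ κ * ∑ l, |s l - s' l| := by
    obtain ⟨ε₀, hε₀, hball⟩ := Metric.eventually_nhds_iff.1
      (eventually_sum_abs_softmax_sub_le hq hβ hp₀ hp₁ hp hκ k)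
    filter_upwards [Ioo_mem_nhdsGT hε₀] with ε hε s s' hs hs'
    refine @hball (s, s') (max_lt ?_ ?_)
    · exact ((dist_pi_lt_iff hε.1).2 hs).trans hε.2
    · exact ((dist_pi_lt_iff hε.1).2 hs').trans hε.2
  obtain ⟨ε, hε, hcontr⟩ :=
    ((eventually_mem_nhdsWithin (s := Set.Ioi (0 : ℝ))).and (eventually_all.2 hk)).exists
  exact ⟨ε, hε, hcontr⟩

variable {n : ℕ}

lemma sum_othersProp [NeZero n] (σ : Config n q) (v : Fin n) :
    ∑ l, othersProp σ v l = 1 - 1 / n := by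
  simp [othersProp_eq, Finset.sum_sub_distrib, sum_proportions, ← Finset.sum_div]

lemma othersProp_eq_sum_erase (σ : Config n q) (v : Fin n) (k : Fin q) :
    othersProp σ v k = (∑ w ∈ Finset.univ.erase v, if σ w = k then (1 : ℝ) else 0) / n := by
  rw [othersProp_eq, proportions_eq_sum, ← Finset.sum_erase_add _ _ (Finset.mem_univ v), add_div,
    add_sub_cancel_right]

lemma sum_abs_ite_sub_ite (a b : Fin q) :
    ∑ l, |(if a = l then (1 : ℝ) else 0) - if b = l then 1 else 0| =
      2 * if a ≠ b then 1 else 0 := by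
  rcases eq_or_ne a b with rfl | hab
  · simp
  · have h (l : Fin q) : |(if a = l then (1 : ℝ) else 0) - if b = l then 1 else 0| =
        (if a = l then 1 else 0) + if b = l then 1 else 0 := by
      split_ifs with ha hb hb
      · exact absurd (ha.trans hb.symm) hab
      all_goals simp
    simp only [h, Finset.sum_add_distrib, Finset.sum_ite_eq, Finset.mem_univ, if_pos hab, if_true]
    norm_num

lemma sum_abs_othersProp_sub_le (σ τ : Config n q) (v : Fin n) :
    ∑ l, |othersProp σ v l - othersProp τ v l| ≤ 2 * (hammingDist σ τ : ℝ) / n := by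
  simp only [othersProp_eq_sum_erase, ← sub_div, abs_div, Nat.abs_cast, ← Finset.sum_div,
    ← Finset.sum_sub_distrib]
  gcongr
  calc _ ≤ ∑ l, ∑ w ∈ Finset.univ.erase v,
        |(if σ w = l then (1 : ℝ) else 0) - if τ w = l then 1 else 0| :=
        Finset.sum_le_sum fun l _ => Finset.abs_sum_le_sum_abs _ _
    _ = ∑ w ∈ Finset.univ.erase v, 2 * if σ w ≠ τ w then 1 else 0 := by
        rw [Finset.sum_comm]
        exact Finset.sum_congr rfl fun w _ => sum_abs_ite_sub_ite _ _
    _ ≤ ∑ w, 2 * if σ w ≠ τ w then 1 else 0 :=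
        Finset.sum_le_sum_of_subset_of_nonneg (Finset.subset_univ _)
          fun _ _ _ => by split_ifs <;> norm_num
    _ = 2 * (hammingDist σ τ : ℝ) := by
        simp only [hammingDist_eq_sum, Finset.mul_sum, ne_eq, ite_not]

end SoftmaxContraction

section DriftAnalysis

variable {q : ℕ} {β : ℝ}

/-! ### The zeros of the drift -/

lemma hasDerivAt_drift (hq : 1 < q) (β x : ℝ) :
    HasDerivAt (drift q β)
      (β * q * (drift q β x + x) * (1 - (drift q β x + x)) / (q - 1) - 1) x := by
  have hq' : (0 : ℝ) < q - 1 := sub_pos.2 (Nat.one_lt_cast.2 hq)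
  have hden : 1 + ((q : ℝ) - 1) * Real.exp (β * ((1 - q * x) / ((q : ℝ) - 1))) ≠ 0 := by positivity
  have hexponent : HasDerivAt (fun x : ℝ => β * ((1 - q * x) / ((q : ℝ) - 1)))
      (β * (-(q * 1) / ((q : ℝ) - 1))) x :=
    ((((hasDerivAt_id x).const_mul (q : ℝ)).const_sub 1).div_const _).const_mul β
  refine ((((hexponent.exp.const_mul ((q : ℝ) - 1)).const_add 1).fun_inv hden).sub
    (hasDerivAt_id x)).congr_deriv ?_
  rw [drift, sub_add_cancel]
  field_simp
  ring

lemma hasDerivAt_drift_of_eq_zero (hq : 1 < q) {x : ℝ} (hx : drift q β x = 0) :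
    HasDerivAt (drift q β) (β * q * x * (1 - x) / (q - 1) - 1) x := by
  simpa only [hx, zero_add] using hasDerivAt_drift hq β x

lemma differentiable_drift (hq : 1 < q) (β : ℝ) : Differentiable ℝ (drift q β) :=
  fun x => (hasDerivAt_drift hq β x).differentiableAt

lemma continuousOn_drift (hq : 1 < q) (β : ℝ) (s : Set ℝ) : ContinuousOn (drift q β) s :=
  (differentiable_drift hq β).continuous.continuousOn

lemma drift_lt_drift_of_beta_lt (hq : 1 < q) {β β' x : ℝ} (hβ : β < β') (hx : 1 / (q : ℝ) < x) :
    drift q β x < drift q β' x := by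
  have hq' : (0 : ℝ) < q - 1 := sub_pos.2 (Nat.one_lt_cast.2 hq)
  have hneg : (1 - q * x) / ((q : ℝ) - 1) < 0 := by
    rw [div_lt_iff₀ (by linarith)] at hx
    exact div_neg_of_neg_of_pos (by linarith) hq'
  have hexp := Real.exp_lt_exp.2 (mul_lt_mul_of_neg_right hβ hneg)
  unfold drift
  gcongr

lemma strictMono_drift_add_self (hq : 1 < q) (hβ : 0 < β) :
    StrictMono fun x => drift q β x + x := by
  have hq' : (0 : ℝ) < q - 1 := sub_pos.2 (Nat.one_lt_cast.2 hq)
  intro x y hxy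
  simp only [drift, sub_add_cancel]
  gcongr

lemma drift_one_div (hq : q ≠ 0) (β : ℝ) : drift q β (1 / q) = 0 := by
  rw [drift, mul_one_div_cancel (Nat.cast_ne_zero.2 hq), sub_self, zero_div, mul_zero,
    Real.exp_zero]
  simp

lemma slope_one_div (hq : 1 < q) (β : ℝ) :
    β * q * (1 / q) * (1 - 1 / q) / (q - 1) = β / q := by
  have hq' : (q : ℝ) - 1 ≠ 0 := (sub_pos.2 (Nat.one_lt_cast.2 hq)).ne'
  have hq₀ : (q : ℝ) ≠ 0 := Nat.cast_ne_zero.2 (by lia)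
  field_simp

lemma drift_one_neg (hq : 1 < q) (β : ℝ) : drift q β 1 < 0 := by
  have hq' : (0 : ℝ) < q - 1 := sub_pos.2 (Nat.one_lt_cast.2 hq)
  exact sub_neg.2 (inv_lt_one_of_one_lt₀ (lt_add_of_pos_right 1 (by positivity)))

lemma exists_pos_of_hasDerivAt_pos {f : ℝ → ℝ} {f' a b : ℝ} (h : HasDerivAt f f' a)
    (ha : f a = 0) (hf' : 0 < f') (hab : a < b) : ∃ x ∈ Set.Ioo a b, 0 < f x := by
  have hslope := ((hasDerivAt_iff_tendsto_slope.1 h).mono_left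
    (nhdsGT_le_nhdsNE a)).eventually_const_lt hf'
  obtain ⟨x, hx, hx_mem⟩ := (hslope.and (Ioo_mem_nhdsGT hab)).exists
  rw [slope_def_field, ha, sub_zero] at hx
  exact ⟨x, hx_mem, (div_pos_iff_of_pos_right (sub_pos.2 hx_mem.1)).1 hx⟩

lemma exists_drift_eq_zero_of_pos (hq : 1 < q) {x : ℝ} (hx : x < 1) (hpos : 0 < drift q β x) :
    ∃ z ∈ Set.Ioo x 1, drift q β z = 0 :=
  intermediate_value_Ioo' hx.le (continuousOn_drift hq β _) ⟨drift_one_neg hq β, hpos⟩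

lemma bddAbove_setOf_drift_ne_zero (hq : 1 < q) :
    BddAbove {β : ℝ | 0 ≤ β ∧ ∀ x ∈ Set.Ioo (1 / (q : ℝ)) 1, drift q β x ≠ 0} := by
  have hq₀ : (1 : ℝ) < q := Nat.one_lt_cast.2 hq
  refine ⟨q, fun β hβ => not_lt.1 fun hlt => ?_⟩
  have hzero := drift_one_div (by lia : q ≠ 0) β
  have hslope : 0 < β * q * (1 / q) * (1 - 1 / q) / (q - 1) - 1 := by
    rw [slope_one_div hq, sub_pos, one_lt_div (by linarith)]
    exact hlt
  obtain ⟨x, hx, hpos⟩ := exists_pos_of_hasDerivAt_pos (hasDerivAt_drift_of_eq_zero hq hzero)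
    hzero hslope ((div_lt_one (by linarith)).2 hq₀)
  obtain ⟨z, hz, hz₀⟩ := exists_drift_eq_zero_of_pos hq hx.2 hpos
  exact hβ.2 z ⟨hx.1.trans hz.1, hz.2⟩ hz₀

lemma betaU_nonneg (hq : 1 < q) : 0 ≤ betaU q := by
  refine le_csSup (bddAbove_setOf_drift_ne_zero hq) ⟨le_rfl, fun x hx hzero => ?_⟩
  have : drift q 0 x = 1 / q - x := by simp [drift]
  linarith [hx.1]

lemma exists_drift_pos (hq : 1 < q) (hβ : betaU q < β) :
    ∃ x ∈ Set.Ioo (1 / (q : ℝ)) 1, 0 < drift q β x := by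
  obtain ⟨β', hβ'_gt, hβ'_lt⟩ := exists_between hβ
  have hzero : ¬ ∀ x ∈ Set.Ioo (1 / (q : ℝ)) 1, drift q β' x ≠ 0 := fun h =>
    hβ'_gt.not_ge (le_csSup (bddAbove_setOf_drift_ne_zero hq)
      ⟨(betaU_nonneg hq).trans hβ'_gt.le, h⟩)
  push Not at hzero
  obtain ⟨x, hx, hx₀⟩ := hzero
  exact ⟨x, hx, hx₀ ▸ drift_lt_drift_of_beta_lt hq hβ'_lt hx.1⟩

lemma exists_deriv_drift_eq_zero (hq : 1 < q) {a b : ℝ} (hab : a < b) (ha : drift q β a = 0)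
    (hb : drift q β b = 0) : ∃ c ∈ Set.Ioo a b, deriv (drift q β) c = 0 :=
  exists_deriv_eq_zero hab (continuousOn_drift hq β _) (ha.trans hb.symm)

-- The derivative is a quadratic polynomial in the strictly increasing function `drift q β x + x`.
lemma not_three_critical_points (hq : 1 < q) (hβ : 0 < β) {a b c : ℝ} (hab : a < b) (hbc : b < c)
    (ha : deriv (drift q β) a = 0) (hb : deriv (drift q β) b = 0)
    (hc : deriv (drift q β) c = 0) : False := by
  have hq' : (0 : ℝ) < q - 1 := sub_pos.2 (Nat.one_lt_cast.2 hq)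
  rw [(hasDerivAt_drift hq β _).deriv] at ha hb hc
  have hinj {x y : ℝ} (hxy : x < y)
      (h : β * q * x * (1 - x) / (q - 1) - 1 = β * q * y * (1 - y) / (q - 1) - 1) :
      x + y = 1 := by
    have : (0 : ℝ) < q := by linarith
    have hfactor : β * q / (q - 1) * (y - x) * (x + y - 1) = 0 := by
      linear_combination h
    have hne : β * q / (q - 1) * (y - x) ≠ 0 :=
      mul_ne_zero (by positivity) (sub_ne_zero.2 hxy.ne')
    linarith [(mul_eq_zero.1 hfactor).resolve_left hne]
  have hab' : drift q β a + a < drift q β b + b := strictMono_drift_add_self hq hβ hab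
  have hbc' : drift q β b + b < drift q β c + c := strictMono_drift_add_self hq hβ hbc
  linarith [hinj hab' (ha.trans hb.symm), hinj hbc' (hb.trans hc.symm)]

lemma not_four_zeros (hq : 1 < q) (hβ : 0 < β) {w x y z : ℝ} (hwx : w < x) (hxy : x < y)
    (hyz : y < z) (hw : drift q β w = 0) (hx : drift q β x = 0) (hy : drift q β y = 0)
    (hz : drift q β z = 0) : False := by
  obtain ⟨u₁, h₁, hu₁⟩ := exists_deriv_drift_eq_zero hq hwx hw hx
  obtain ⟨u₂, h₂, hu₂⟩ := exists_deriv_drift_eq_zero hq hxy hx hy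
  obtain ⟨u₃, h₃, hu₃⟩ := exists_deriv_drift_eq_zero hq hyz hy hz
  exact not_three_critical_points hq hβ (h₁.2.trans h₂.1) (h₂.2.trans h₃.1) hu₁ hu₂ hu₃

section TwoZeros

variable {a b : ℝ}

lemma eq_of_drift_eq_zero (hq : 1 < q) (hβ : 0 < β) (hqa : 1 / (q : ℝ) < a) (hab : a < b)
    (ha : drift q β a = 0) (hb : drift q β b = 0) {z : ℝ} (hz : drift q β z = 0) :
    z = 1 / q ∨ z = a ∨ z = b := by
  have h₀ := drift_one_div (by lia : q ≠ 0) β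
  by_contra! ⟨hz₀, hza, hzb⟩
  rcases hz₀.lt_or_gt with h | h
  · exact not_four_zeros hq hβ h hqa hab hz h₀ ha hb
  rcases hza.lt_or_gt with h' | h'
  · exact not_four_zeros hq hβ h h' hab h₀ hz ha hb
  rcases hzb.lt_or_gt with h'' | h''
  · exact not_four_zeros hq hβ hqa h' h'' h₀ ha hz hb
  · exact not_four_zeros hq hβ hqa hab h'' h₀ ha hb hz

lemma deriv_drift_ne_zero (hq : 1 < q) (hβ : 0 < β) (hqa : 1 / (q : ℝ) < a) (hab : a < b)
    (ha : drift q β a = 0) (hb : drift q β b = 0) :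
    deriv (drift q β) a ≠ 0 ∧ deriv (drift q β) b ≠ 0 := by
  obtain ⟨u, hu, hu₀⟩ := exists_deriv_drift_eq_zero hq hqa (drift_one_div (by lia) β) ha
  obtain ⟨v, hv, hv₀⟩ := exists_deriv_drift_eq_zero hq hab ha hb
  exact ⟨fun h => not_three_critical_points hq hβ hu.2 hv.1 hu₀ h hv₀,
    fun h => not_three_critical_points hq hβ (hu.2.trans hv.1) hv.2 hu₀ hv₀ h⟩

lemma deriv_drift_neg_of_largest (hq : 1 < q) (hβ : 0 < β) (hqa : 1 / (q : ℝ) < a) (hab : a < b)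
    (hb₁ : b < 1) (ha : drift q β a = 0) (hb : drift q β b = 0) :
    deriv (drift q β) b < 0 := by
  refine lt_of_le_of_ne (not_lt.1 fun hpos => ?_) (deriv_drift_ne_zero hq hβ hqa hab ha hb).2
  obtain ⟨x, hx, hx_pos⟩ :=
    exists_pos_of_hasDerivAt_pos (differentiable_drift hq β b).hasDerivAt hb hpos hb₁
  obtain ⟨z, hz, hz₀⟩ := exists_drift_eq_zero_of_pos hq hx.2 hx_pos
  exact not_four_zeros hq hβ hqa hab (hx.1.trans hz.1) (drift_one_div (by lia) β) ha hb hz₀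

lemma driftZeros_eq_pair (hq : 1 < q) (hβ : 0 < β) (hqa : 1 / (q : ℝ) < a) (hab : a < b)
    (hb₁ : b < 1) (ha : drift q β a = 0) (hb : drift q β b = 0) : driftZeros q β = {a, b} := by
  ext z
  constructor
  · rintro ⟨hz, hz₀⟩
    exact (eq_of_drift_eq_zero hq hβ hqa hab ha hb hz₀).resolve_left hz.1.ne'
  · rintro (rfl | rfl)
    · exact ⟨⟨hqa, hab.trans hb₁⟩, ha⟩
    · exact ⟨⟨hqa.trans hab, hb₁⟩, hb⟩

end TwoZeros

lemma mStar_mR_spec (hq : 1 < q) (hβ : β ∈ Set.Ioo (betaU q) (betaS q)) :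
    1 / (q : ℝ) < mStar q β ∧ mStar q β < mR q β ∧ mR q β < 1 ∧
      drift q β (mStar q β) = 0 ∧ drift q β (mR q β) = 0 := by
  have hβ₀ : 0 < β := (betaU_nonneg hq).trans_lt hβ.1
  have h₀ := drift_one_div (by lia : q ≠ 0) β
  have hslope : 0 < -(β * q * (1 / q) * (1 - 1 / q) / (q - 1) - 1) := by
    rw [slope_one_div hq, neg_sub, sub_pos, div_lt_one (by positivity)]
    exact hβ.2
  obtain ⟨x, hx, hx_pos⟩ := exists_drift_pos hq hβ.1
  obtain ⟨y, hy, hy_neg⟩ := exists_pos_of_hasDerivAt_pos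
    (hasDerivAt_drift_of_eq_zero hq h₀).fun_neg (by rw [h₀, neg_zero]) hslope hx.1
  obtain ⟨a, ha, ha₀⟩ := intermediate_value_Ioo hy.2.le (continuousOn_drift hq β _)
    (show (0 : ℝ) ∈ Set.Ioo _ _ from ⟨neg_pos.1 hy_neg, hx_pos⟩)
  obtain ⟨b, hb, hb₀⟩ := exists_drift_eq_zero_of_pos hq hx.2 hx_pos
  have hqa : 1 / (q : ℝ) < a := hy.1.trans ha.1
  have hab : a < b := ha.2.trans hb.1
  have hpair := driftZeros_eq_pair hq hβ₀ hqa hab hb.2 ha₀ hb₀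
  have hmStar : mStar q β = a := by rw [mStar, hpair, csInf_pair, inf_eq_left.2 hab.le]
  have hmR : mR q β = b := by rw [mR, hpair, csSup_pair, sup_eq_right.2 hab.le]
  rw [hmStar, hmR]
  exact ⟨hqa, hab, hb.2, ha₀, hb₀⟩

/-! ### Attraction towards a stable zero -/

lemma exists_continuous_eq_mul_mul_of_two_zeros {f : ℝ → ℝ} (hf : Differentiable ℝ f) {p c : ℝ}
    (hpc : p ≠ c) (hp : f p = 0) (hc : f c = 0) :
    ∃ h : ℝ → ℝ, Continuous h ∧ ∀ x, f x = (x - p) * ((x - c) * h x) := by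
  have hg : Continuous (dslope f p) := by
    rw [← continuousOn_univ]
    exact (continuousOn_dslope univ_mem).2 ⟨hf.continuous.continuousOn, hf p⟩
  have hfg (x : ℝ) : f x = (x - p) * dslope f p x := by
    simpa [hp] using (sub_smul_dslope f p x).symm
  have hgc : dslope f p c = 0 :=
    (mul_eq_zero.1 ((hfg c).symm.trans hc)).resolve_left (sub_ne_zero.2 hpc.symm)
  refine ⟨dslope (dslope f p) c, ?_, fun x => ?_⟩
  · rw [← continuousOn_univ]
    exact (continuousOn_dslope univ_mem).2
      ⟨hg.continuousOn, (differentiableAt_dslope_of_ne hpc.symm).2 (hf c)⟩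
  · rw [hfg, ← smul_eq_mul (x - c), sub_smul_dslope, hgc, sub_zero]

lemma hasDerivAt_of_eq_sub_mul {f g : ℝ → ℝ} {p : ℝ} (hg : ContinuousAt g p)
    (hfg : ∀ x, f x = (x - p) * g x) : HasDerivAt f (g p) p := by
  refine hasDerivAt_iff_tendsto_slope.2 ((hg.tendsto.mono_left nhdsWithin_le_nhds).congr' ?_)
  filter_upwards [self_mem_nhdsWithin] with x hx
  rw [slope_def_field, hfg, hfg p, sub_self, zero_mul, sub_zero,
    mul_div_cancel_left₀ _ (sub_ne_zero.2 hx)]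

lemma exists_pos_forall_le_of_ne_zero {F : ℝ → ℝ} (hF : Continuous F) {p lo hi : ℝ}
    (hp : p ∈ Set.Icc lo hi) (hFp : 0 < F p) (hne : ∀ x ∈ Set.Icc lo hi, F x ≠ 0) :
    ∃ lam > 0, ∀ x ∈ Set.Icc lo hi, lam ≤ F x := by
  obtain ⟨y, hy, hmin⟩ := isCompact_Icc.exists_isMinOn ⟨p, hp⟩ hF.continuousOn
  refine ⟨F y, not_le.1 fun hle => ?_, fun x hx => hmin hx⟩
  obtain ⟨z, hz, hz₀⟩ :=
    isPreconnected_Icc.intermediate_value hy hp hF.continuousOn ⟨hle, hFp.le⟩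
  exact hne z hz hz₀

lemma exists_mul_sq_le_of_simple_zeros {f : ℝ → ℝ} (hf : Differentiable ℝ f) {s p c lo hi : ℝ}
    (hs : 0 < s * (p - c)) (hp : f p = 0) (hc : f c = 0) (hp' : deriv f p < 0)
    (hc' : deriv f c ≠ 0) (hpI : p ∈ Set.Icc lo hi)
    (hne : ∀ x ∈ Set.Icc lo hi, f x = 0 → x = p ∨ x = c) :
    ∃ lam > 0, ∀ x ∈ Set.Icc lo hi, 0 ≤ s * (x - c) →
      lam * (s * (x - c)) * (p - x) ^ 2 ≤ f x * (p - x) := by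
  have hs₀ : s ≠ 0 := left_ne_zero_of_mul hs.ne'
  have hpc : p - c ≠ 0 := right_ne_zero_of_mul hs.ne'
  obtain ⟨h, hcont, hfh⟩ := exists_continuous_eq_mul_mul_of_two_zeros hf (sub_ne_zero.1 hpc) hp hc
  have hderiv_p : deriv f p = (p - c) * h p :=
    (hasDerivAt_of_eq_sub_mul (by fun_prop) hfh).deriv
  have hderiv_c : deriv f c = (c - p) * h c :=
    (hasDerivAt_of_eq_sub_mul (g := fun x => (x - p) * h x) (by fun_prop)
      fun x => (hfh x).trans (mul_left_comm _ _ _)).deriv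
  have hFp : 0 < -h p / s := by
    have : -h p / s = -((p - c) * h p) / (s * (p - c)) := by field_simp
    rw [this, ← hderiv_p]
    exact div_pos (neg_pos.2 hp') hs
  have hF_ne : ∀ x ∈ Set.Icc lo hi, -h x / s ≠ 0 := fun x hx hx₀ => by
    have hhx : h x = 0 := by simpa [hs₀] using hx₀
    rcases hne x hx (by rw [hfh, hhx, mul_zero, mul_zero]) with rfl | rfl
    · exact hp'.ne (by rw [hderiv_p, hhx, mul_zero])
    · exact hc' (by rw [hderiv_c, hhx, mul_zero])
  obtain ⟨lam, hlam, hle⟩ := exists_pos_forall_le_of_ne_zero (by fun_prop) hpI hFp hF_ne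
  refine ⟨lam, hlam, fun x hx hsx => ?_⟩
  calc lam * (s * (x - c)) * (p - x) ^ 2 ≤ -h x / s * (s * (x - c)) * (p - x) ^ 2 := by
        gcongr
        exact hle x hx
    _ = f x * (p - x) := by
        rw [hfh]
        field_simp
        ring

/-- The zero `p` of the drift attracts every point of `[0, 1]` on the side `s * (m - c) > 0` of
the zero `c`, at a rate proportional to the distance to `c`; the number `s` is a sign. -/
structure IsTarget (q : ℕ) (β s c p lam : ℝ) : Prop where
  sign : s = 1 ∨ s = -1
  lam_pos : 0 < lam
  dist_pos : 0 < s * (p - c)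
  one_div_lt : 1 / (q : ℝ) < c
  lt_one : c < 1
  one_div_le : 1 / (q : ℝ) ≤ p
  le_one : p ≤ 1
  drift_eq_zero : drift q β p = 0
  slope_lt : β * q * p * (1 - p) / (q - 1) < 1
  drift_le : ∀ m ∈ Set.Icc (0 : ℝ) 1, 0 ≤ s * (m - c) →
    lam * (s * (m - c)) * (p - m) ^ 2 ≤ drift q β m * (p - m)

lemma exists_isTarget_one_div (hq : 1 < q) (hβ : β ∈ Set.Ioo (betaU q) (betaS q)) :
    ∃ lam, IsTarget q β (-1) (mStar q β) (1 / q) lam := by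
  obtain ⟨hqa, hab, hb₁, ha, hb⟩ := mStar_mR_spec hq hβ
  have hβ₀ : 0 < β := (betaU_nonneg hq).trans_lt hβ.1
  have hp := drift_one_div (by lia : q ≠ 0) β
  have hdist : 0 < -1 * (1 / q - mStar q β) := by linarith
  have hslope : β * q * (1 / q) * (1 - 1 / q) / (q - 1) < 1 := by
    rw [slope_one_div hq, div_lt_one (by positivity)]
    exact hβ.2
  obtain ⟨lam, hlam, hle⟩ := exists_mul_sq_le_of_simple_zeros (lo := 0) (hi := mStar q β)
    (differentiable_drift hq β) hdist hp ha
    (by rw [(hasDerivAt_drift_of_eq_zero hq hp).deriv]; linarith)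
    (deriv_drift_ne_zero hq hβ₀ hqa hab ha hb).1 ⟨by positivity, hqa.le⟩ fun x hx hx₀ => by
      rcases eq_of_drift_eq_zero hq hβ₀ hqa hab ha hb hx₀ with h | h | h
      · exact Or.inl h
      · exact Or.inr h
      · linarith [hx.2]
  exact ⟨lam, Or.inr rfl, hlam, hdist, hqa, hab.trans hb₁, le_rfl, by linarith, hp, hslope,
    fun m hm hmc => hle m ⟨hm.1, by linarith⟩ hmc⟩

lemma exists_isTarget_mR (hq : 1 < q) (hβ : β ∈ Set.Ioo (betaU q) (betaS q)) :
    ∃ lam, IsTarget q β 1 (mStar q β) (mR q β) lam := by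
  obtain ⟨hqa, hab, hb₁, ha, hb⟩ := mStar_mR_spec hq hβ
  have hβ₀ : 0 < β := (betaU_nonneg hq).trans_lt hβ.1
  have hdist : 0 < 1 * (mR q β - mStar q β) := by linarith
  have hderiv := deriv_drift_neg_of_largest hq hβ₀ hqa hab hb₁ ha hb
  have hslope : β * q * mR q β * (1 - mR q β) / (q - 1) < 1 := by
    rw [(hasDerivAt_drift_of_eq_zero hq hb).deriv] at hderiv
    linarith
  obtain ⟨lam, hlam, hle⟩ := exists_mul_sq_le_of_simple_zeros (lo := mStar q β) (hi := 1)
    (differentiable_drift hq β) hdist hb ha hderiv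
    (deriv_drift_ne_zero hq hβ₀ hqa hab ha hb).1 ⟨hab.le, hb₁.le⟩ fun x hx hx₀ => by
      rcases eq_of_drift_eq_zero hq hβ₀ hqa hab ha hb hx₀ with h | h | h
      · linarith [hx.1]
      · exact Or.inr h
      · exact Or.inl h
  exact ⟨lam, Or.inl rfl, hlam, hdist, hqa, hab.trans hb₁, (hqa.trans hab).le, hb₁.le, hb, hslope,
    fun m hm hmc => hle m ⟨by linarith, hm.2⟩ hmc⟩

end DriftAnalysis

section Barriers

variable {n q : ℕ} {β : ℝ}

/-! ### One-step estimates for the dominant proportion -/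

section ExponentialTilt

variable {F : Config n q → ℝ} {σ : Config n q} {k : Fin q} {E u : ℝ}

lemma abs_mul_proportions_update_sub_le (u : ℝ) (σ : Config n q) (v : Fin n) (k l : Fin q) :
    |u * n * (proportions (Function.update σ v l) k - proportions σ k)| ≤ |u| := by
  have hn : (0 : ℝ) < n := by exact_mod_cast v.pos
  rw [abs_mul, abs_mul, Nat.abs_cast, mul_assoc]
  refine mul_le_of_le_one_right (abs_nonneg u) ?_
  rw [← le_div_iff₀' hn]
  exact abs_proportions_update_sub_le σ v l k

lemma glauber_mulVec_le_of_exp_tilt [NeZero n] [NeZero q] (hE : 0 ≤ E) (hu : |u| ≤ 1)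
    (hF : ∀ v l, F (Function.update σ v l) ≤
      E * Real.exp (-(u * n * (proportions (Function.update σ v l) k - proportions σ k))))
    (hdrift : u ^ 2 ≤ u * (n * meanInc n q β σ k)) :
    (glauber n q β *ᵥ F) σ ≤ E := by
  have hstep : (glauber n q β *ᵥ F) σ ≤ E * (1 + u ^ 2) + E * -(u * n) * meanInc n q β σ k := by
    refine glauber_mulVec_le_of_update_le_affine_single fun v l => (hF v l).trans ?_
    have hw := abs_mul_proportions_update_sub_le u σ v k l
    set w := u * n * (proportions (Function.update σ v l) k - proportions σ k) with hw_def
    have hexp : Real.exp (-w) ≤ 1 - w + w ^ 2 := by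
      have := (abs_le.1 (Real.abs_exp_sub_one_sub_id_le
        ((abs_neg w).trans_le (hw.trans hu)))).2
      linarith [neg_sq w]
    calc E * Real.exp (-w) ≤ E * (1 - w + u ^ 2) := by
          gcongr
          exact hexp.trans (by linarith [sq_le_sq.2 hw])
      _ = _ := by rw [hw_def]; ring
  nlinarith [mul_nonneg hE (sub_nonneg.2 hdrift)]

lemma glauber_mulVec_le_mul_exp_one_of_exp_tilt [NeZero n] [NeZero q] (hE : 0 ≤ E) (hu : |u| ≤ 1)
    (hF : ∀ v l, F (Function.update σ v l) ≤
      E * Real.exp (-(u * n * (proportions (Function.update σ v l) k - proportions σ k)))) :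
    (glauber n q β *ᵥ F) σ ≤ E * Real.exp 1 := by
  have h := glauber_mulVec_le_of_update_le (β := β) (σ := σ) (F := F)
    (G := fun _ => E * Real.exp 1) fun v l => (hF v l).trans <| by
      gcongr
      exact (neg_le_abs _).trans ((abs_mul_proportions_update_sub_le u σ v k l).trans hu)
  rwa [mulVec_const glauber_mem_rowStochastic] at h

end ExponentialTilt

section Target

variable {s c p lam : ℝ}

lemma IsTarget.mul_self_sign (ht : IsTarget q β s c p lam) : s * s = 1 := by
  rcases ht.sign with rfl | rfl <;> norm_num

lemma IsTarget.abs_sign_mul (ht : IsTarget q β s c p lam) (x : ℝ) : |s * x| = |x| := by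
  rcases ht.sign with rfl | rfl <;> simp

lemma IsTarget.sign_mul_sub_le_one (ht : IsTarget q β s c p lam) {m : ℝ}
    (hm : m ∈ Set.Icc (0 : ℝ) 1) : s * (m - c) ≤ 1 := by
  have hc : 0 < c := lt_of_le_of_lt (by positivity) ht.one_div_lt
  rw [Set.mem_Icc] at hm
  refine (le_abs_self _).trans ?_
  rw [ht.abs_sign_mul, abs_le]
  constructor <;> linarith [ht.lt_one]

lemma IsTarget.mul_sq_le_sub_mul_drift (ht : IsTarget q β s c p lam) {m : ℝ}
    (hm : m ∈ Set.Icc (0 : ℝ) 1) (hmc : 0 ≤ s * (m - c)) :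
    lam * (s * (m - c)) * (s * (p - c) - s * (m - c)) ^ 2 ≤
      (s * (p - c) - s * (m - c)) * (s * drift q β m) := by
  have h := ht.drift_le m hm hmc
  have hs := ht.mul_self_sign
  calc lam * (s * (m - c)) * (s * (p - c) - s * (m - c)) ^ 2
      = lam * (s * (m - c)) * (p - m) ^ 2 := by
        linear_combination lam * (s * (m - c)) * (p - m) ^ 2 * hs
    _ ≤ drift q β m * (p - m) := h
    _ = _ := by linear_combination -drift q β m * (p - m) * hs

lemma IsTarget.le_sign_mul_drift_of_le_half (ht : IsTarget q β s c p lam) {m : ℝ}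
    (hm : m ∈ Set.Icc (0 : ℝ) 1) (hmc : 0 ≤ s * (m - c)) (hmp : s * (m - c) ≤ s * (p - c) / 2) :
    lam * (s * (p - c)) / 2 * (s * (m - c)) ≤ s * drift q β m := by
  have hL := ht.dist_pos
  have h := ht.mul_sq_le_sub_mul_drift hm hmc
  set x := s * (m - c)
  set L := s * (p - c)
  have hLx : 0 < L - x := by linarith
  have hdrift : lam * x * (L - x) ≤ s * drift q β m :=
    le_of_mul_le_mul_left (by linarith) hLx
  have := ht.lam_pos
  calc lam * L / 2 * x = lam * x * (L / 2) := by ring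
    _ ≤ lam * x * (L - x) := by gcongr; linarith
    _ ≤ s * drift q β m := hdrift

lemma glauber_mulVec_gaussian_barrier_le [NeZero n] [NeZero q] (ht : IsTarget q β s c p lam)
    {a ε : ℝ} (ha : 0 < a) (ha₁ : 2 * a ≤ 1) (haL : a ≤ lam * (s * (p - c)) / 8)
    (k : Fin q) (σ : Config n q)
    (hε : |n * meanInc n q β σ k - drift q β (proportions σ k)| ≤ ε)
    (hx : 0 ≤ s * (proportions σ k - c))
    (hεx : ε ≤ lam * (s * (p - c)) / 4 * (s * (proportions σ k - c))) :
    (glauber n q β *ᵥ fun τ => Real.exp (-(a * n * (s * (proportions τ k - c)) ^ 2))) σ ≤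
      Real.exp (-(a * n * (s * (proportions σ k - c)) ^ 2)) +
        Real.exp 1 * Real.exp (-(a * n * (s * (p - c)) ^ 2 / 4)) := by
  set m := proportions σ k
  set x := s * (m - c) with hx_def
  set L := s * (p - c)
  have hm : m ∈ Set.Icc (0 : ℝ) 1 := ⟨proportions_nonneg σ k, proportions_le_one σ k⟩
  have hu : |2 * a * x * s| ≤ 1 := by
    rw [mul_comm, ht.abs_sign_mul, abs_of_nonneg (by positivity)]
    exact mul_le_one₀ ha₁ hx (ht.sign_mul_sub_le_one hm)
  have htilt (v : Fin n) (l : Fin q) :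
      Real.exp (-(a * n * (s * (proportions (Function.update σ v l) k - c)) ^ 2)) ≤
        Real.exp (-(a * n * x ^ 2)) * Real.exp
          (-(2 * a * x * s * n * (proportions (Function.update σ v l) k - m))) := by
    rw [← Real.exp_add, Real.exp_le_exp]
    have : 0 ≤ a * n * (s * (proportions (Function.update σ v l) k - m)) ^ 2 := by positivity
    rw [hx_def]
    linarith
  rcases le_or_gt x (L / 2) with hxL | hxL
  · refine (glauber_mulVec_le_of_exp_tilt (Real.exp_pos _).le hu htilt ?_).trans
      (le_add_of_nonneg_right (by positivity))
    have hdrift := ht.le_sign_mul_drift_of_le_half hm hx hxL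
    have herr : |s * (n * meanInc n q β σ k - drift q β m)| ≤ ε := (ht.abs_sign_mul _).trans_le hε
    have hinc : 2 * a * x ≤ s * (n * meanInc n q β σ k) := by
      nlinarith [(abs_le.1 herr).1, mul_le_mul_of_nonneg_right haL hx]
    calc (2 * a * x * s) ^ 2 = 2 * a * x * (2 * a * x) := by
          linear_combination (2 * a * x) ^ 2 * ht.mul_self_sign
      _ ≤ 2 * a * x * (s * (n * meanInc n q β σ k)) := by gcongr
      _ = _ := by ring
  · refine (glauber_mulVec_le_mul_exp_one_of_exp_tilt (Real.exp_pos _).le hu htilt).trans ?_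
    rw [mul_comm]
    refine (mul_le_mul_of_nonneg_left (Real.exp_le_exp.2 (neg_le_neg ?_))
      (Real.exp_pos 1).le).trans (le_add_of_nonneg_left (Real.exp_pos _).le)
    calc a * n * L ^ 2 / 4 = a * n * (L / 2) ^ 2 := by ring
      _ ≤ a * n * x ^ 2 := by gcongr; linarith [ht.dist_pos]

end Target

lemma glauber_mulVec_exp_barrier_le [NeZero n] [NeZero q] {d r b ε : ℝ}
    (hd : ∀ m ∈ Set.Icc (0 : ℝ) (1 / q), d * (1 / q - m) ≤ drift q β m) (hd₀ : 0 ≤ d)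
    (hr : 0 ≤ r) (hb : 0 ≤ b) (hb₁ : b ≤ 1) (hbd : b ≤ d * r / 4) (k : Fin q) (σ : Config n q)
    (hε : |n * meanInc n q β σ k - drift q β (proportions σ k)| ≤ ε) (hεd : ε ≤ d * r / 4) :
    (glauber n q β *ᵥ fun τ => Real.exp (-(b * n * (proportions τ k - 1 / q + r)))) σ ≤
      Real.exp (-(b * n * (proportions σ k - 1 / q + r))) +
        Real.exp 1 * Real.exp (-(b * n * r / 2)) := by
  set m := proportions σ k
  have htilt (v : Fin n) (l : Fin q) :
      Real.exp (-(b * n * (proportions (Function.update σ v l) k - 1 / q + r))) ≤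
        Real.exp (-(b * n * (m - 1 / q + r))) *
          Real.exp (-(b * n * (proportions (Function.update σ v l) k - m))) := by
    rw [← Real.exp_add]
    exact (congrArg Real.exp (by ring)).le
  have hb' : |b| ≤ 1 := by rwa [abs_of_nonneg hb]
  rcases le_or_gt (m - 1 / q + r) (r / 2) with hz | hz
  · refine (glauber_mulVec_le_of_exp_tilt (Real.exp_pos _).le hb' htilt ?_).trans
      (le_add_of_nonneg_right (by positivity))
    have hdrift : d * r / 2 ≤ drift q β m :=
      le_trans (by nlinarith) (hd m ⟨proportions_nonneg σ k, by linarith⟩)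
    rw [sq]
    gcongr
    linarith [(abs_le.1 hε).1]
  · refine (glauber_mulVec_le_mul_exp_one_of_exp_tilt (Real.exp_pos _).le hb' htilt).trans ?_
    rw [mul_comm]
    refine (mul_le_mul_of_nonneg_left (Real.exp_le_exp.2 (neg_le_neg ?_))
      (Real.exp_pos 1).le).trans (le_add_of_nonneg_left (Real.exp_pos _).le)
    rw [mul_div_assoc]
    gcongr

section RatioContraction

lemma sq_ratio_sub_one_le {L x d N : ℝ} (hL : 0 ≤ L) (hx : 0 < x) (hNx : 1 / N ≤ x / 2)
    (hd : |d| ≤ 1 / N) :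
    (L / (x + d) - 1) ^ 2 ≤ (L / x - 1) ^ 2 + 4 * |L / x - 1| * L / (N ^ 2 * x ^ 3) +
      4 * L ^ 2 / (N ^ 2 * x ^ 4) + -(2 * (L / x - 1) * L / x ^ 2) * d := by
  have hxd : x / 2 ≤ x + d := by linarith [(abs_le.1 hd).1]
  have hxd₀ : 0 < x + d := by linarith
  have hd₂ : d ^ 2 ≤ (1 / N) ^ 2 := sq_le_sq' (abs_le.1 hd).1 (abs_le.1 hd).2
  have hinv : 1 / (x + d) ≤ 2 / x := by rw [div_le_div_iff₀ hxd₀ hx]; linarith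
  set u := L / x - 1 with hu
  have hexpand : (L / (x + d) - 1) ^ 2 = u ^ 2 + -(2 * u * L / x ^ 2) * d +
      2 * u * (L / x ^ 2 * d ^ 2 * (1 / (x + d))) + L ^ 2 / x ^ 2 * d ^ 2 * (1 / (x + d)) ^ 2 := by
    rw [hu]; field_simp; ring
  have hcubic : 2 * u * (L / x ^ 2 * d ^ 2 * (1 / (x + d))) ≤
      2 * |u| * (L / x ^ 2 * (1 / N) ^ 2 * (2 / x)) := by
    have := le_abs_self u
    gcongr
  have hquartic : L ^ 2 / x ^ 2 * d ^ 2 * (1 / (x + d)) ^ 2 ≤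
      L ^ 2 / x ^ 2 * (1 / N) ^ 2 * (2 / x) ^ 2 := by gcongr
  calc (L / (x + d) - 1) ^ 2 ≤ u ^ 2 + -(2 * u * L / x ^ 2) * d +
        2 * |u| * (L / x ^ 2 * (1 / N) ^ 2 * (2 / x)) +
        L ^ 2 / x ^ 2 * (1 / N) ^ 2 * (2 / x) ^ 2 := by rw [hexpand]; gcongr
    _ = _ := by ring

lemma ratio_error_le_of_le_half {L x N ε lam : ℝ} (hN : 0 < N) (hx : 0 < x) (hlam : 0 < lam)
    (hxL : x ≤ L / 2) (hNx : 1 / (N * x ^ 2) ≤ lam * L / 48) (hεx : ε ≤ lam * L / 12 * x) :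
    4 * |L / x - 1| * L / (N ^ 2 * x ^ 3) + 4 * L ^ 2 / (N ^ 2 * x ^ 4) +
      2 * |L / x - 1| * L / x ^ 2 * (ε / N) ≤ lam * L / N * (L / x - 1) ^ 2 := by
  have hu₁ : 1 ≤ L / x - 1 := by rw [le_sub_iff_add_le, le_div_iff₀ hx]; linarith
  have hL : 0 < L := by linarith
  have hLu : L ≤ 2 * (L / x - 1) * x := by field_simp; linarith
  set u := L / x - 1
  have hu₀ : 0 < u := by linarith
  rw [abs_of_pos hu₀]
  have hcubic : 4 * u * L / (N ^ 2 * x ^ 3) ≤ lam * L / (6 * N) * u ^ 2 := by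
    calc 4 * u * L / (N ^ 2 * x ^ 3) ≤ 4 * u * (2 * u * x) / (N ^ 2 * x ^ 3) := by gcongr
      _ = 8 * u ^ 2 / N * (1 / (N * x ^ 2)) := by field_simp; norm_num
      _ ≤ 8 * u ^ 2 / N * (lam * L / 48) := by gcongr
      _ = _ := by field_simp; norm_num
  have hquartic : 4 * L ^ 2 / (N ^ 2 * x ^ 4) ≤ lam * L / (3 * N) * u ^ 2 := by
    calc 4 * L ^ 2 / (N ^ 2 * x ^ 4) ≤ 4 * (2 * u * x) ^ 2 / (N ^ 2 * x ^ 4) := by gcongr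
      _ = 16 * u ^ 2 / N * (1 / (N * x ^ 2)) := by field_simp; norm_num
      _ ≤ 16 * u ^ 2 / N * (lam * L / 48) := by gcongr
      _ = _ := by field_simp; norm_num
  have hdrift : 2 * u * L / x ^ 2 * (ε / N) ≤ lam * L / (3 * N) * u ^ 2 := by
    calc 2 * u * L / x ^ 2 * (ε / N)
        ≤ 2 * u * L / x ^ 2 * (lam * L / 12 * x / N) := by gcongr
      _ ≤ 2 * u * (2 * u * x) / x ^ 2 * (lam * L / 12 * x / N) := by gcongr
      _ = _ := by field_simp; norm_num
  have hsum : lam * L / (6 * N) * u ^ 2 + lam * L / (3 * N) * u ^ 2 + lam * L / (3 * N) * u ^ 2 =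
      5 / 6 * (lam * L / N * u ^ 2) := by field_simp; norm_num
  linarith [show 0 ≤ lam * L / N * u ^ 2 by positivity]

lemma ratio_error_le_of_half_le {L x N ε : ℝ} (hL : 0 < L) (hN : 0 < N) (hε : 0 ≤ ε)
    (hxL : L / 2 ≤ x) :
    4 * |L / x - 1| * L / (N ^ 2 * x ^ 3) + 4 * L ^ 2 / (N ^ 2 * x ^ 4) +
      2 * |L / x - 1| * L / x ^ 2 * (ε / N) ≤ (8 * ε / L + 96 / (L ^ 2 * N)) / N := by
  have hx : 0 < x := by linarith
  have hu : |L / x - 1| ≤ 1 := by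
    rw [abs_le]
    constructor <;> linarith [div_pos hL hx, (div_le_iff₀ hx).2 (by linarith : L ≤ 2 * x)]
  have hxinv : 1 / x ≤ 2 / L := by rw [div_le_div_iff₀ hx hL]; linarith
  calc _ = 4 * |L / x - 1| * L / N ^ 2 * (1 / x) ^ 3 + 4 * L ^ 2 / N ^ 2 * (1 / x) ^ 4 +
        2 * |L / x - 1| * L * (1 / x) ^ 2 * (ε / N) := by ring
    _ ≤ 4 * 1 * L / N ^ 2 * (2 / L) ^ 3 + 4 * L ^ 2 / N ^ 2 * (2 / L) ^ 4 +
        2 * 1 * L * (2 / L) ^ 2 * (ε / N) := by gcongr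
    _ = _ := by field_simp; ring

lemma ratio_error_le {L x N ε lam γ : ℝ} (hL : 0 < L) (hN : 0 < N) (hx : 0 < x)
    (hlam : 0 < lam) (hγx : γ ^ 2 ≤ 4 * N * x ^ 2) (hγ : 192 / (lam * L) ≤ γ ^ 2) (hε : 0 ≤ ε)
    (hεx : ε ≤ lam * L / 12 * x) :
    4 * |L / x - 1| * L / (N ^ 2 * x ^ 3) + 4 * L ^ 2 / (N ^ 2 * x ^ 4) +
      2 * |L / x - 1| * L / x ^ 2 * (ε / N) ≤
        lam * L / N * (L / x - 1) ^ 2 + (8 * ε / L + 96 / (L ^ 2 * N)) / N := by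
  rcases le_total x (L / 2) with hxL | hxL
  · refine (ratio_error_le_of_le_half hN hx hlam hxL ?_ hεx).trans
      (le_add_of_nonneg_right (by positivity))
    rw [div_le_iff₀ (by positivity)] at hγ ⊢
    nlinarith [mul_pos hlam hL]
  · exact (ratio_error_le_of_half_le hL hN hε hxL).trans (le_add_of_nonneg_left (by positivity))

variable {s c p lam : ℝ}

lemma glauber_mulVec_sq_ratio_le_affine [NeZero n] [NeZero q] (ht : IsTarget q β s c p lam)
    (k : Fin q) (σ : Config n q) (hx : 0 < s * (proportions σ k - c))
    (hnx : 1 / (n : ℝ) ≤ s * (proportions σ k - c) / 2) :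
    (glauber n q β *ᵥ fun τ => (s * (p - c) / (s * (proportions τ k - c)) - 1) ^ 2) σ ≤
      (s * (p - c) / (s * (proportions σ k - c)) - 1) ^ 2 +
        4 * |s * (p - c) / (s * (proportions σ k - c)) - 1| * (s * (p - c)) /
          ((n : ℝ) ^ 2 * (s * (proportions σ k - c)) ^ 3) +
        4 * (s * (p - c)) ^ 2 / ((n : ℝ) ^ 2 * (s * (proportions σ k - c)) ^ 4) +
        -(2 * (s * (p - c) / (s * (proportions σ k - c)) - 1) * (s * (p - c)) /
          (s * (proportions σ k - c)) ^ 2) * s * meanInc n q β σ k := by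
  refine glauber_mulVec_le_of_update_le_affine_single fun v l => ?_
  have h := sq_ratio_sub_one_le (d := s * (proportions (Function.update σ v l) k - proportions σ k))
    ht.dist_pos.le hx hnx ((ht.abs_sign_mul _).trans_le (abs_proportions_update_sub_le σ v l k))
  rw [← mul_add, sub_add_sub_cancel'] at h
  linarith

lemma IsTarget.sq_ratio_drift_le (ht : IsTarget q β s c p lam) {m D ε : ℝ} {N : ℝ} (hN : 0 < N)
    (hm : m ∈ Set.Icc (0 : ℝ) 1) (hx : 0 < s * (m - c)) (hε : |N * D - drift q β m| ≤ ε) :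
    -(2 * (s * (p - c) / (s * (m - c)) - 1) * (s * (p - c)) / (s * (m - c)) ^ 2) * s * D ≤
      -(2 * lam * (s * (p - c)) / N) * (s * (p - c) / (s * (m - c)) - 1) ^ 2 +
        2 * |s * (p - c) / (s * (m - c)) - 1| * (s * (p - c)) / (s * (m - c)) ^ 2 * (ε / N) := by
  have hdrift := ht.mul_sq_le_sub_mul_drift hm hx.le
  have hL := ht.dist_pos
  have herr : |s * (N * D - drift q β m)| ≤ ε := (ht.abs_sign_mul _).trans_le hε
  set x := s * (m - c)
  set L := s * (p - c)
  have hLx : L - x = x * (L / x - 1) := by field_simp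
  set u := L / x - 1
  have hdrift' : lam * x ^ 2 * u ^ 2 ≤ u * (s * drift q β m) := by
    rw [hLx] at hdrift
    exact le_of_mul_le_mul_left (by linarith) hx
  have hinc : lam * x ^ 2 * u ^ 2 - |u| * ε ≤ u * (s * (N * D)) := by
    have : |u * (s * (N * D - drift q β m))| ≤ |u| * ε := by
      rw [abs_mul]; gcongr
    linarith [(abs_le.1 this).1]
  calc -(2 * u * L / x ^ 2) * s * D = -(2 * L / (x ^ 2 * N) * (u * (s * (N * D)))) := by
        field_simp
    _ ≤ -(2 * L / (x ^ 2 * N) * (lam * x ^ 2 * u ^ 2 - |u| * ε)) := by gcongr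
    _ = _ := by field_simp; ring

lemma glauber_mulVec_sq_ratio_le [NeZero n] [NeZero q] (ht : IsTarget q β s c p lam) {γ ε : ℝ}
    (hγ : 192 / (lam * (s * (p - c))) ≤ γ ^ 2) (k : Fin q) (σ : Config n q)
    (hε : |n * meanInc n q β σ k - drift q β (proportions σ k)| ≤ ε)
    (hx : 0 < s * (proportions σ k - c))
    (hnx : 1 / (n : ℝ) ≤ s * (proportions σ k - c) / 2)
    (hγx : γ ^ 2 ≤ 4 * n * (s * (proportions σ k - c)) ^ 2)
    (hεx : ε ≤ lam * (s * (p - c)) / 12 * (s * (proportions σ k - c))) :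
    (glauber n q β *ᵥ fun τ => (s * (p - c) / (s * (proportions τ k - c)) - 1) ^ 2) σ ≤
      (1 - lam * (s * (p - c)) / n) * (s * (p - c) / (s * (proportions σ k - c)) - 1) ^ 2 +
        (8 * ε / (s * (p - c)) + 96 / ((s * (p - c)) ^ 2 * n)) / n := by
  have hn : (0 : ℝ) < n := by exact_mod_cast Nat.pos_of_ne_zero (NeZero.ne n)
  have hstep := glauber_mulVec_sq_ratio_le_affine (β := β) ht k σ hx hnx
  have hdrift := ht.sq_ratio_drift_le hn ⟨proportions_nonneg σ k, proportions_le_one σ k⟩ hx hε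
  have herror := ratio_error_le ht.dist_pos hn hx ht.lam_pos hγx hγ ((abs_nonneg _).trans hε) hεx
  generalize s * (p - c) / (s * (proportions σ k - c)) - 1 = u at *
  have hring : (1 - lam * (s * (p - c)) / n) * u ^ 2 =
      u ^ 2 + -(2 * lam * (s * (p - c)) / n) * u ^ 2 + lam * (s * (p - c)) / n * u ^ 2 := by ring
  linarith

end RatioContraction

section TargetDistance

variable {s c p lam : ℝ}

/-- The squared distance of the proportions vector to `dominated k p`, measured by the `k`-th
proportion and the transverse coordinates; it is the Lyapunov function near the target. -/
def targetDist (k : Fin q) (p : ℝ) (σ : Config n q) : ℝ :=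
  (proportions σ k - p) ^ 2 + transverseSq k (proportions σ)

lemma targetDist_nonneg (k : Fin q) (p : ℝ) (σ : Config n q) : 0 ≤ targetDist k p σ :=
  add_nonneg (sq_nonneg _) (transverseSq_nonneg _ _)

lemma glauber_mulVec_sq_sub_le [NeZero n] [NeZero q] (p : ℝ) (k : Fin q) (σ : Config n q) :
    (glauber n q β *ᵥ fun τ => (proportions τ k - p) ^ 2) σ ≤
      (proportions σ k - p) ^ 2 + 1 / n ^ 2 + 2 * (proportions σ k - p) * meanInc n q β σ k := by
  refine glauber_mulVec_le_of_update_le_affine_single fun v l => ?_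
  have h := sq_le_sq' (abs_le.1 (abs_proportions_update_sub_le σ v l k)).1
    (abs_le.1 (abs_proportions_update_sub_le σ v l k)).2
  rw [_root_.one_div_pow] at h
  linarith

lemma IsTarget.sub_mul_drift_nonpos (ht : IsTarget q β s c p lam) {m : ℝ}
    (hm : m ∈ Set.Icc (0 : ℝ) 1) (hmp : |m - p| ≤ s * (p - c)) : (m - p) * drift q β m ≤ 0 := by
  have hmc : 0 ≤ s * (m - c) := by
    rw [← ht.abs_sign_mul] at hmp
    linarith [(abs_le.1 hmp).1]
  have h := ht.drift_le m hm hmc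
  have : 0 ≤ lam * (s * (m - c)) * (p - m) ^ 2 := by have := ht.lam_pos; positivity
  linarith

lemma glauber_mulVec_targetDist_le [NeZero n] [NeZero q] (hq : 1 < q) (hβ : 0 ≤ β)
    (ht : IsTarget q β s c p lam) {r r₀ : ℝ} (hr₀ : 0 ≤ r₀) (hrq : 2 * β * r < q) (hr₀r : r₀ ≤ r)
    (hr₀L : r₀ ≤ s * (p - c)) (hr₀₁ : r₀ ≤ 1)
    (hr₀C : (β ^ 2 + 2 * β) * Real.exp (2 * β) * r₀ ≤
      1 - β * Real.exp (β * r) / (q - 2 * β * r))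
    (k : Fin q) (σ : Config n q) (hσ : targetDist k p σ < r₀ ^ 2) :
    (glauber n q β *ᵥ targetDist k p) σ ≤ targetDist k p σ +
      (1 + 2 * ((β ^ 2 + 2 * β) * Real.exp (2 * β)) +
        (4 * q + 4 * q * β * Real.exp (2 * β))) / n ^ 2 := by
  have hT := transverseSq_nonneg k (proportions σ)
  have hsq := glauber_mulVec_sq_sub_le (β := β) p k σ
  have hmp : |proportions σ k - p| ≤ r₀ :=
    abs_le_of_sq_le_sq (by unfold targetDist at hσ; linarith) hr₀
  have htrans := glauber_mulVec_transverseSq_le hq hβ k σ (hr₀.trans hr₀r) hrq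
    (by linarith [(abs_le.1 hmp).1, ht.one_div_le])
    (by unfold targetDist at hσ; nlinarith [sq_nonneg (proportions σ k - p)])
  have hmean := abs_meanInc_sub_drift_le (n := n) hq hβ σ k
  have hdrift := ht.sub_mul_drift_nonpos ⟨proportions_nonneg σ k, proportions_le_one σ k⟩
    (hmp.trans hr₀L)
  have hsplit : (glauber n q β *ᵥ targetDist k p) σ =
      (glauber n q β *ᵥ fun τ => (proportions τ k - p) ^ 2) σ +
        (glauber n q β *ᵥ fun τ => transverseSq k (proportions τ)) σ :=
    congrFun (mulVec_add _ _ _) σ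
  set C := (β ^ 2 + 2 * β) * Real.exp (2 * β)
  set θ := β * Real.exp (β * r) / (q - 2 * β * r)
  set m := proportions σ k
  set T := transverseSq k (proportions σ)
  have : 0 ≤ C := by positivity
  have herr : (m - p) * (n * meanInc n q β σ k - drift q β m) ≤ r₀ * (C * (T + 1 / n)) := by
    refine (le_abs_self _).trans ?_
    rw [abs_mul]
    gcongr
  have hinc : 2 * (m - p) * meanInc n q β σ k ≤ 2 / n * ((1 - θ) * T + C / n) := by
    calc 2 * (m - p) * meanInc n q β σ k
        = 2 / n * ((m - p) * (n * meanInc n q β σ k)) := by field_simp [NeZero.ne (n : ℝ)]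
      _ ≤ 2 / n * (r₀ * (C * (T + 1 / n))) :=
          mul_le_mul_of_nonneg_left (by linarith) (by positivity)
      _ = 2 / n * (C * r₀ * T + r₀ * (C / n)) := by ring
      _ ≤ 2 / n * ((1 - θ) * T + 1 * (C / n)) := by gcongr
      _ = _ := by rw [one_mul]
  rw [hsplit]
  calc _ ≤ (m - p) ^ 2 + 1 / n ^ 2 + 2 / n * ((1 - θ) * T + C / n) +
        (T - 2 * (1 - θ) / n * T + (4 * q + 4 * q * β * Real.exp (2 * β)) / n ^ 2) := by linarith
    _ = _ := by unfold targetDist; ring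

end TargetDistance

end Barriers

section LocalCoupling

variable {n q : ℕ} {β s c p lam : ℝ}

/-! ### Coupling near the target -/

lemma exists_targetDist_supersolution (hq : 1 < q) (hβ : 0 ≤ β) (hβq : β < q)
    (ht : IsTarget q β s c p lam) :
    ∃ r₁ > 0, ∃ C > 0, ∀ r ∈ Set.Icc 0 r₁, ∀ (n : ℕ) [NeZero n] (k : Fin q) (σ : Config n q),
      targetDist k p σ < r ^ 2 →
        (glauber n q β *ᵥ targetDist k p) σ ≤ targetDist k p σ + C / n ^ 2 := by
  have : NeZero q := ⟨by lia⟩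
  obtain ⟨r₀, hr₀, hr₀q, hθ⟩ := exists_pos_contraction_radius hβ hβq
  have hgap : 0 < (1 - β * Real.exp (β * r₀) / (q - 2 * β * r₀)) /
      ((β ^ 2 + 2 * β) * Real.exp (2 * β) + 1) := div_pos (by linarith) (by positivity)
  refine ⟨_, lt_min (lt_min hr₀ ht.dist_pos) (lt_min one_pos hgap), _,
    (by positivity : 0 < 1 + 2 * ((β ^ 2 + 2 * β) * Real.exp (2 * β)) +
      (4 * q + 4 * q * β * Real.exp (2 * β))), fun r ⟨hr, hr₁⟩ n _ k σ hσ => ?_⟩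
  simp only [le_min_iff] at hr₁
  obtain ⟨⟨hr_r₀, hrL⟩, hr_one, hr_gap⟩ := hr₁
  refine glauber_mulVec_targetDist_le hq hβ ht hr hr₀q hr_r₀ hrL hr_one ?_ k σ hσ
  rw [le_div_iff₀ (by positivity)] at hr_gap
  linarith

lemma abs_proportions_sub_dominated_le (hq : 1 < q) {k : Fin q} {r : ℝ} (hr : 0 ≤ r)
    {σ : Config n q} (hσ : targetDist k p σ ≤ r ^ 2) (i : Fin q) :
    |proportions σ i - dominated k p i| ≤ 2 * r := by
  unfold targetDist at hσ
  have hnonneg := transverseSq_nonneg k (proportions σ)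
  have hsq := sq_nonneg (proportions σ k - p)
  have htrans := sq_transverse_le_transverseSq k (proportions σ) i
  have hk : |proportions σ k - p| ≤ r := abs_le_of_sq_le_sq (by linarith) hr
  have hi : |transverse k (proportions σ) i| ≤ r := abs_le_of_sq_le_sq (by linarith) hr
  have haxis := abs_dominated_sub_dominated_le hq k (proportions σ k) p i
  have htri := abs_sub_le (proportions σ i) (dominated k (proportions σ k) i) (dominated k p i)
  simp only [transverse, Pi.sub_apply] at hi
  linarith

lemma abs_othersProp_sub_dominated_lt (hq : 1 < q) {k : Fin q} {r ε : ℝ} (hr : 0 ≤ r)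
    (hrε : 2 * r + 1 / n < ε) {σ : Config n q} (hσ : targetDist k p σ ≤ r ^ 2) (v : Fin n)
    (i : Fin q) : |othersProp σ v i - dominated k p i| < ε := by
  have hothers : |othersProp σ v i - proportions σ i| ≤ 1 / n := by
    rw [othersProp_eq, sub_sub_cancel_left, abs_neg, abs_div, Nat.abs_cast]
    gcongr
    split_ifs <;> simp
  linarith [abs_proportions_sub_dominated_le hq hr hσ i,
    abs_sub_le (othersProp σ v i) (proportions σ i) (dominated k p i)]

lemma exists_resampleProb_contraction (hq : 1 < q) (hβ : 0 ≤ β) (ht : IsTarget q β s c p lam) :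
    ∃ κ ∈ Set.Ico (0 : ℝ) 1, ∃ r₂ > 0, ∀ᶠ n : ℕ in atTop, ∀ r ∈ Set.Icc 0 r₂, ∀ (k : Fin q)
      (σ τ : Config n q), targetDist k p σ < r ^ 2 → targetDist k p τ < r ^ 2 → ∀ v,
        (∑ l, |resampleProb n q β σ v l - resampleProb n q β τ v l|) / 2 ≤
          κ * hammingDist σ τ / n := by
  obtain ⟨κ, hslope, hκ⟩ := exists_between ht.slope_lt
  have hp : 0 ≤ p := le_trans (by positivity) ht.one_div_le
  have hκ₀ : 0 ≤ κ := by
    have hp₁ : 0 ≤ 1 - p := by linarith [ht.le_one]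
    have hq₁ : (0 : ℝ) < q - 1 := sub_pos.2 (by exact_mod_cast hq)
    exact le_trans (by positivity) hslope.le
  obtain ⟨ε, hε, hcontr⟩ :=
    exists_softmax_contraction hq hβ ht.one_div_le ht.le_one ht.drift_eq_zero hslope
  refine ⟨κ, ⟨hκ₀, hκ⟩, ε / 4, by positivity, ?_⟩
  filter_upwards [(tendsto_const_div_atTop_nhds_zero_nat (1 : ℝ)).eventually
    (gt_mem_nhds (half_pos hε))] with n hn r ⟨hr, hrε⟩ k σ τ hσ hτ v
  have : NeZero n := ⟨v.pos.ne'⟩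
  have hrn : 2 * r + 1 / n < ε := by linarith
  simp only [resampleProb_eq_softmax]
  have hsoft := hcontr k (othersProp σ v) (othersProp τ v)
    (abs_othersProp_sub_dominated_lt hq hr hrn hσ.le v)
    (abs_othersProp_sub_dominated_lt hq hr hrn hτ.le v)
    ((sum_othersProp σ v).trans (sum_othersProp τ v).symm)
  calc _ ≤ κ * (2 * hammingDist σ τ / n) / 2 := by
        gcongr
        exact hsoft.trans (by gcongr; exact sum_abs_othersProp_sub_le σ τ v)
    _ = _ := by ring

lemma exists_local_coupling (hq : 1 < q) (hβ : 0 ≤ β) (hβq : β < q)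
    (ht : IsTarget q β s c p lam) :
    ∃ r > 0, ∃ κ ∈ Set.Ico (0 : ℝ) 1, ∃ C > 0, ∀ᶠ n : ℕ in atTop, ∀ k : Fin q,
      (∀ σ : Config n q, targetDist k p σ < r ^ 2 →
        (glauber n q β *ᵥ targetDist k p) σ ≤ targetDist k p σ + C / n ^ 2) ∧
      ∀ f : Config n q → ℝ, (∀ τ, f τ ∈ Set.Icc (0 : ℝ) 1) → ∀ t σ τ,
        (glauber n q β ^ t *ᵥ f) σ - (glauber n q β ^ t *ᵥ f) τ ≤ (1 - (1 - κ) / n) ^ t * n +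
          exitBound (targetDist k p) (r ^ 2) (C / n ^ 2) t σ +
          exitBound (targetDist k p) (r ^ 2) (C / n ^ 2) t τ := by
  have : NeZero q := ⟨by lia⟩
  obtain ⟨r₁, hr₁, C, hC, hdist⟩ := exists_targetDist_supersolution hq hβ hβq ht
  obtain ⟨κ, hκ, r₂, hr₂, hcontr⟩ := exists_resampleProb_contraction hq hβ ht
  have hr : 0 < min r₁ r₂ := lt_min hr₁ hr₂
  refine ⟨min r₁ r₂, hr, κ, hκ, C, hC, ?_⟩
  filter_upwards [hcontr, eventually_gt_atTop 0] with n hcontr hn k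
  have : NeZero n := ⟨hn.ne'⟩
  have hP : glauber n q β ∈ rowStochastic ℝ (Config n q) := glauber_mem_rowStochastic
  have hV := targetDist_nonneg (n := n) k p
  have hb : 0 ≤ C / (n : ℝ) ^ 2 := by positivity
  have hstep := hdist (min r₁ r₂) ⟨hr.le, min_le_left _ _⟩ n k
  refine ⟨hstep, fun f hf t σ τ => ?_⟩
  have hρ : 0 ≤ 1 - (1 - κ) / (n : ℝ) := by
    have hn₁ : (1 : ℝ) ≤ n := mod_cast hn
    rw [sub_nonneg, div_le_one (by positivity)]
    linarith [hκ.1]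
  have hcoupled := pow_mulVec_sub_le_of_coupling hP (U := {σ | targetDist k p σ < min r₁ r₂ ^ 2})
    (d := fun σ τ => (hammingDist σ τ : ℝ)) hρ (fun _ _ => Nat.cast_nonneg _)
    (fun σ τ hστ => by exact_mod_cast hammingDist_pos.2 hστ)
    (fun σ hσ τ hτ => exists_glauber_coupling
      (hcontr _ ⟨hr.le, min_le_right _ _⟩ k σ τ hσ hτ))
    (fun t ω => (exitBound_mem_Icc hV (by positivity) hb t ω).1)
    (fun t ω hω => (exitBound_eq_one (by positivity) hb (not_lt.1 hω)).ge)
    (mulVec_exitBound_le hP hV (by positivity) hb hstep) hf t σ τ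
  refine hcoupled.trans ?_
  gcongr
  simpa using hammingDist_le_card_fintype (x := σ) (y := τ)

end LocalCoupling

/-! ### Escape from the unstable point -/

/-- Upper bound for the error of `n * meanInc` as an approximation of `drift`, valid wherever the
transverse energy is at most `η`. -/
def driftError (n : ℕ) (β η : ℝ) : ℝ :=
  (β ^ 2 + 2 * β) * Real.exp (2 * β) * (η + 1 / n)

/-- Admissible constants for the escape argument towards a target at distance `L` from the unstable
point: the leading proportion is followed as long as it exceeds `1 / q - r`, and `a` and `b` are
the decay rates of the barriers at the unstable point and at `1 / q - r`. The constant `d` bounds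
the drift below `1 / q`. -/
structure IsEscapeRates (q : ℕ) (β L lam d r a b : ℝ) : Prop where
  r_pos : 0 < r
  two_mul_lt : 2 * β * r < q
  contraction : β * Real.exp (β * r) / (q - 2 * β * r) < 1
  d_pos : 0 < d
  le_drift : ∀ m ∈ Set.Icc (0 : ℝ) (1 / q), d * (1 / q - m) ≤ drift q β m
  a_pos : 0 < a
  two_mul_a_le : 2 * a ≤ 1
  a_le : a ≤ lam * L / 8
  b_pos : 0 < b
  b_le_one : b ≤ 1
  b_le : b ≤ d * r / 4

/-- The size `n` is large enough for the one-step estimates to hold as long as the leading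
proportion is at distance at least `γ / (2√n)` from the unstable point and the transverse energy is
at most `η`. -/
structure IsEscapeScale (n : ℕ) (β L lam d r γ η : ℝ) : Prop where
  γ_pos : 0 < γ
  le_sq_γ : 192 / (lam * L) ≤ γ ^ 2
  η_pos : 0 < η
  η_le : η ≤ r ^ 2
  driftError_le : driftError n β η ≤ lam * L / 12 * (γ / (2 * √(n : ℝ)))
  driftError_le_below : driftError n β η ≤ d * r / 4
  one_div_le : 1 / (n : ℝ) ≤ γ / (2 * √(n : ℝ)) / 2
  mul_le : lam * L ≤ n

/-- The configurations at which the one-step estimates of the escape argument apply. -/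
def escapeRegion (n : ℕ) {q : ℕ} (k : Fin q) (s c r γ η : ℝ) : Set (Config n q) :=
  {σ | γ / (2 * √(n : ℝ)) ≤ s * (proportions σ k - c) ∧ 1 / (q : ℝ) - r ≤ proportions σ k ∧
    transverseSq k (proportions σ) ≤ η}

/-- A function which is at least `1` outside the escape region and nearly superharmonic inside it:
one summand for each way of leaving the region. -/
def escapeBarrier {n q : ℕ} (k : Fin q) (s c r a b γ η : ℝ) (σ : Config n q) : ℝ :=
  Real.exp (a * γ ^ 2 / 4) *
      Real.exp (-(a * n * (max (s * (proportions σ k - c)) 0) ^ 2)) +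
    Real.exp (-(b * n * (proportions σ k - 1 / q + r))) +
    1 / η * transverseSq k (proportions σ)

/-- The increase per step of `escapeBarrier` inside the escape region. -/
def barrierError (n q : ℕ) (β L r a b γ η : ℝ) : ℝ :=
  Real.exp (a * γ ^ 2 / 4) * (Real.exp 1 * Real.exp (-(a * n * L ^ 2 / 4))) +
    Real.exp 1 * Real.exp (-(b * n * r / 2)) +
    1 / η * ((4 * q + 4 * q * β * Real.exp (2 * β)) / n ^ 2)

/-- The level to which the mean of `(L / x - 1) ^ 2` relaxes, where `x` is the distance of the
leading proportion from the unstable point. -/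
def ratioFloor (n : ℕ) (β L lam η : ℝ) : ℝ :=
  (8 * driftError n β η / L + 96 / (L ^ 2 * n)) / (lam * L)

section Escape

variable {n q : ℕ} {β s c p lam d r a b γ η : ℝ} {k : Fin q} {σ : Config n q}

lemma driftError_nonneg (hβ : 0 ≤ β) (hη : 0 ≤ η) : 0 ≤ driftError n β η := by
  unfold driftError
  positivity

lemma barrierError_nonneg (hβ : 0 ≤ β) (hη : 0 ≤ η) {L : ℝ} :
    0 ≤ barrierError n q β L r a b γ η := by
  unfold barrierError
  positivity

lemma ratioFloor_nonneg (hβ : 0 ≤ β) (hη : 0 ≤ η) {L : ℝ} (hL : 0 ≤ L) (hlam : 0 ≤ lam) :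
    0 ≤ ratioFloor n β L lam η := by
  have := driftError_nonneg (n := n) hβ hη
  unfold ratioFloor
  positivity

lemma escapeBarrier_nonneg (hη : 0 ≤ η) : 0 ≤ escapeBarrier k s c r a b γ η σ := by
  have := transverseSq_nonneg k (proportions σ)
  unfold escapeBarrier
  positivity

lemma one_le_escapeBarrier_of_notMem [NeZero n] (ha : 0 ≤ a) (hb : 0 ≤ b) (hγ : 0 ≤ γ)
    (hη : 0 < η) (hσ : σ ∉ escapeRegion n k s c r γ η) :
    1 ≤ escapeBarrier k s c r a b γ η σ := by
  have hn : (n : ℝ) ≠ 0 := NeZero.ne _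
  have htrans := transverseSq_nonneg k (proportions σ)
  have hgauss : 0 ≤ Real.exp (a * γ ^ 2 / 4) *
      Real.exp (-(a * n * (max (s * (proportions σ k - c)) 0) ^ 2)) := by positivity
  have hexp : 0 ≤ Real.exp (-(b * n * (proportions σ k - 1 / q + r))) := by positivity
  have hT : 0 ≤ 1 / η * transverseSq k (proportions σ) := by positivity
  unfold escapeBarrier
  by_cases h₁ : γ / (2 * √n) ≤ s * (proportions σ k - c)
  · by_cases h₂ : 1 / (q : ℝ) - r ≤ proportions σ k
    · have h₃ : η < transverseSq k (proportions σ) := lt_of_not_ge fun h => hσ ⟨h₁, h₂, h⟩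
      have : 1 ≤ 1 / η * transverseSq k (proportions σ) := by
        rw [one_div_mul_eq_div, one_le_div hη]
        exact h₃.le
      linarith
    · have : 1 ≤ Real.exp (-(b * n * (proportions σ k - 1 / q + r))) :=
        Real.one_le_exp (neg_nonneg.2 (mul_nonpos_of_nonneg_of_nonpos (by positivity)
          (by linarith)))
      linarith
  · have hmax : max (s * (proportions σ k - c)) 0 ≤ γ / (2 * √n) :=
      max_le (not_le.1 h₁).le (by positivity)
    have hsq : a * n * (max (s * (proportions σ k - c)) 0) ^ 2 ≤ a * γ ^ 2 / 4 :=
      calc _ ≤ a * n * (γ / (2 * √n)) ^ 2 := by gcongr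
        _ = a * γ ^ 2 / 4 := by
          rw [div_pow, mul_pow, Real.sq_sqrt n.cast_nonneg]
          field_simp
          norm_num
    have : 1 ≤ Real.exp (a * γ ^ 2 / 4) *
        Real.exp (-(a * n * (max (s * (proportions σ k - c)) 0) ^ 2)) := by
      rw [← Real.exp_add]
      exact Real.one_le_exp (by linarith)
    linarith

lemma abs_meanInc_sub_drift_le_driftError [NeZero n] [NeZero q] (hq : 1 < q) (hβ : 0 ≤ β)
    (hσ : σ ∈ escapeRegion n k s c r γ η) :
    |n * meanInc n q β σ k - drift q β (proportions σ k)| ≤ driftError n β η := by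
  refine (abs_meanInc_sub_drift_le hq hβ σ k).trans ?_
  unfold driftError
  gcongr
  exact hσ.2.2

lemma pos_of_mem_escapeRegion [NeZero n] (hγ : 0 < γ) (hσ : σ ∈ escapeRegion n k s c r γ η) :
    0 < s * (proportions σ k - c) := by
  have : (0 : ℝ) < n := Nat.cast_pos.2 (NeZero.pos n)
  exact lt_of_lt_of_le (by positivity) hσ.1

lemma glauber_mulVec_max_gaussian_barrier_le [NeZero n] [NeZero q] (hq : 1 < q) (hβ : 0 ≤ β)
    (ht : IsTarget q β s c p lam) (hrates : IsEscapeRates q β (s * (p - c)) lam d r a b)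
    (hscale : IsEscapeScale n β (s * (p - c)) lam d r γ η)
    (hσ : σ ∈ escapeRegion n k s c r γ η) :
    (glauber n q β *ᵥ fun τ =>
        Real.exp (-(a * n * (max (s * (proportions τ k - c)) 0) ^ 2))) σ ≤
      Real.exp (-(a * n * (max (s * (proportions σ k - c)) 0) ^ 2)) +
        Real.exp 1 * Real.exp (-(a * n * (s * (p - c)) ^ 2 / 4)) := by
  have hx := pos_of_mem_escapeRegion hscale.γ_pos hσ
  have hlamL : 0 < lam * (s * (p - c)) := mul_pos ht.lam_pos ht.dist_pos
  have hnx : 1 / (n : ℝ) ≤ s * (proportions σ k - c) :=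
    hscale.one_div_le.trans (by linarith [hσ.1])
  have hεx : driftError n β η ≤ lam * (s * (p - c)) / 4 * (s * (proportions σ k - c)) := by
    have := hscale.driftError_le.trans (mul_le_mul_of_nonneg_left hσ.1 (by positivity))
    linarith [mul_pos hlamL hx]
  have hmax (v : Fin n) (l : Fin q) :
      max (s * (proportions (Function.update σ v l) k - c)) 0 =
        s * (proportions (Function.update σ v l) k - c) := by
    have hstep : |s * (proportions (Function.update σ v l) k - proportions σ k)| ≤ 1 / n := by
      rw [ht.abs_sign_mul]
      exact abs_proportions_update_sub_le σ v l k
    refine max_eq_left ?_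
    linarith [neg_le_of_abs_le hstep]
  rw [max_eq_left hx.le]
  refine le_trans (glauber_mulVec_le_of_update_le fun v l => ?_)
    (glauber_mulVec_gaussian_barrier_le ht hrates.a_pos hrates.two_mul_a_le hrates.a_le k σ
      (abs_meanInc_sub_drift_le_driftError hq hβ hσ) hx.le hεx)
  rw [hmax]

lemma glauber_mulVec_escapeBarrier_le [NeZero n] [NeZero q] (hq : 1 < q) (hβ : 0 ≤ β)
    (ht : IsTarget q β s c p lam) (hrates : IsEscapeRates q β (s * (p - c)) lam d r a b)
    (hscale : IsEscapeScale n β (s * (p - c)) lam d r γ η)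
    (hσ : σ ∈ escapeRegion n k s c r γ η) :
    (glauber n q β *ᵥ escapeBarrier k s c r a b γ η) σ ≤
      escapeBarrier k s c r a b γ η σ + barrierError n q β (s * (p - c)) r a b γ η := by
  have hη := hscale.η_pos
  have hgauss := glauber_mulVec_max_gaussian_barrier_le hq hβ ht hrates hscale hσ
  have hexp := glauber_mulVec_exp_barrier_le hrates.le_drift hrates.d_pos.le hrates.r_pos.le
    hrates.b_pos.le hrates.b_le_one hrates.b_le k σ
    (abs_meanInc_sub_drift_le_driftError hq hβ hσ) hscale.driftError_le_below
  have htrans : (glauber n q β *ᵥ fun τ => transverseSq k (proportions τ)) σ ≤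
      transverseSq k (proportions σ) + (4 * q + 4 * q * β * Real.exp (2 * β)) / n ^ 2 := by
    refine (glauber_mulVec_transverseSq_le hq hβ k σ hrates.r_pos.le hrates.two_mul_lt hσ.2.1
      (hσ.2.2.trans hscale.η_le)).trans (add_le_add_left (sub_le_self _ ?_) _)
    have hgap := sub_pos.2 hrates.contraction
    have hnonneg := transverseSq_nonneg k (proportions σ)
    positivity
  have hsplit : escapeBarrier k s c r a b γ η = Real.exp (a * γ ^ 2 / 4) • (fun τ : Config n q =>
        Real.exp (-(a * n * (max (s * (proportions τ k - c)) 0) ^ 2))) +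
      (fun τ => Real.exp (-(b * n * (proportions τ k - 1 / q + r)))) +
      (1 / η) • fun τ => transverseSq k (proportions τ) := rfl
  rw [hsplit, mulVec_add, mulVec_add, mulVec_smul, mulVec_smul]
  simp only [Pi.add_apply, Pi.smul_apply, smul_eq_mul]
  have hgauss' := mul_le_mul_of_nonneg_left hgauss (Real.exp_nonneg (a * γ ^ 2 / 4))
  have htrans' := mul_le_mul_of_nonneg_left htrans (one_div_pos.2 hη).le
  unfold barrierError
  linarith

lemma glauber_mulVec_sq_ratio_le_ratioFloor [NeZero n] [NeZero q] (hq : 1 < q) (hβ : 0 ≤ β)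
    (ht : IsTarget q β s c p lam) (hscale : IsEscapeScale n β (s * (p - c)) lam d r γ η)
    (hσ : σ ∈ escapeRegion n k s c r γ η) :
    (glauber n q β *ᵥ fun τ => (s * (p - c) / (s * (proportions τ k - c)) - 1) ^ 2) σ ≤
      (1 - lam * (s * (p - c)) / n) * (s * (p - c) / (s * (proportions σ k - c)) - 1) ^ 2 +
        (1 - (1 - lam * (s * (p - c)) / n)) * ratioFloor n β (s * (p - c)) lam η := by
  have hn : (0 : ℝ) < n := Nat.cast_pos.2 (NeZero.pos n)
  have hγ := hscale.γ_pos
  have hL := ht.dist_pos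
  have hlam := ht.lam_pos
  have hγx : γ ^ 2 ≤ 4 * n * (s * (proportions σ k - c)) ^ 2 :=
    calc γ ^ 2 = 4 * n * (γ / (2 * √n)) ^ 2 := by
          rw [div_pow, mul_pow, Real.sq_sqrt hn.le]
          field_simp
          norm_num
      _ ≤ 4 * n * (s * (proportions σ k - c)) ^ 2 := by
          gcongr
          exact hσ.1
  refine (glauber_mulVec_sq_ratio_le ht hscale.le_sq_γ k σ
    (abs_meanInc_sub_drift_le_driftError hq hβ hσ) (pos_of_mem_escapeRegion hγ hσ)
    (hscale.one_div_le.trans (by linarith [hσ.1])) hγx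
    (hscale.driftError_le.trans (mul_le_mul_of_nonneg_left hσ.1 (by positivity)))).trans_eq ?_
  rw [sub_sub_cancel, ratioFloor]
  generalize s * (p - c) = L at *
  field_simp

lemma targetDist_le_sq_ratio_add [NeZero n] (ht : IsTarget q β s c p lam)
    (hx : 0 < s * (proportions σ k - c)) (hη : transverseSq k (proportions σ) ≤ η) :
    targetDist k p σ ≤ (s * (p - c) / (s * (proportions σ k - c)) - 1) ^ 2 + η := by
  refine add_le_add ?_ hη
  set x := s * (proportions σ k - c) with hx_def
  have hx₁ : x ≤ 1 := ht.sign_mul_sub_le_one ⟨proportions_nonneg σ k, proportions_le_one σ k⟩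
  have hscaled : x * (s * (p - c) / x - 1) = s * (p - proportions σ k) := by
    rw [mul_sub, mul_div_cancel₀ _ hx.ne', hx_def]
    ring
  calc (proportions σ k - p) ^ 2 = x ^ 2 * (s * (p - c) / x - 1) ^ 2 := by
        rw [← mul_pow, hscaled]
        linear_combination -(p - proportions σ k) ^ 2 * ht.mul_self_sign
    _ ≤ (s * (p - c) / x - 1) ^ 2 :=
        mul_le_of_le_one_left (sq_nonneg _) (pow_le_one₀ hx.le hx₁)

lemma glauber_pow_mulVec_le_of_le_targetDist [NeZero n] [NeZero q] (hq : 1 < q) (hβ : 0 ≤ β)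
    (ht : IsTarget q β s c p lam) (hrates : IsEscapeRates q β (s * (p - c)) lam d r a b)
    (hscale : IsEscapeScale n β (s * (p - c)) lam d r γ η) {g : Config n q → ℝ} {ρ B : ℝ}
    (hρ : 0 < ρ) (hB : 0 ≤ B) (hg : ∀ τ, g τ ∈ Set.Icc (0 : ℝ) 1)
    (hg_le : ∀ τ, g τ ≤ (targetDist k p τ + B) / ρ) (t : ℕ) (σ : Config n q) :
    (glauber n q β ^ t *ᵥ g) σ ≤ escapeBarrier k s c r a b γ η σ +
      t * barrierError n q β (s * (p - c)) r a b γ η +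
      1 / ρ * ((1 - lam * (s * (p - c)) / n) ^ t *
        (s * (p - c) / (s * (proportions σ k - c)) - 1) ^ 2 +
        ratioFloor n β (s * (p - c)) lam η) + (η + B) / ρ := by
  have hn : (0 : ℝ) < n := Nat.cast_pos.2 (NeZero.pos n)
  have hη := hscale.η_pos
  have hlamL : 0 < lam * (s * (p - c)) := mul_pos ht.lam_pos ht.dist_pos
  refine pow_mulVec_le_of_lyapunov glauber_mem_rowStochastic
    (R := escapeRegion n k s c r γ η) (Φ := escapeBarrier k s c r a b γ η) hg
    (barrierError_nonneg hβ hη.le) ?_ ?_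
    (ratioFloor_nonneg hβ hη.le ht.dist_pos.le ht.lam_pos.le) (by positivity) (by positivity)
    (fun _ => escapeBarrier_nonneg hη.le) (fun _ => sq_nonneg _)
    (fun _ => one_le_escapeBarrier_of_notMem hrates.a_pos.le hrates.b_pos.le hscale.γ_pos.le hη)
    (fun _ => glauber_mulVec_escapeBarrier_le hq hβ ht hrates hscale)
    (fun _ => glauber_mulVec_sq_ratio_le_ratioFloor hq hβ ht hscale) (fun τ hτ => ?_) t σ
  · rw [sub_nonneg, div_le_one hn]
    exact hscale.mul_le
  · exact sub_le_self _ (by positivity)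
  · have hdist := targetDist_le_sq_ratio_add ht (pos_of_mem_escapeRegion hscale.γ_pos hτ) hτ.2.2
    calc g τ ≤ (targetDist k p τ + B) / ρ := hg_le τ
      _ ≤ ((s * (p - c) / (s * (proportions τ k - c)) - 1) ^ 2 + η + B) / ρ := by gcongr
      _ = _ := by ring

end Escape

/-! ### Asymptotics in the number of vertices -/

/-- The number of steps, of order `n log n`, given to each of the two stages of the dynamics:
escaping from the unstable point, and coupling near the target. -/
def burnIn (A : ℝ) (n : ℕ) : ℕ := ⌈A * (n * Real.log n)⌉₊

section Asymptotics

lemma tendsto_log_pow_div_sqrt (j : ℕ) :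
    Tendsto (fun n : ℕ => Real.log n ^ j / √(n : ℝ)) atTop (𝓝 0) := by
  have h := ((Real.tendsto_pow_log_div_mul_add_atTop 1 0 j one_ne_zero).comp
    (Real.tendsto_sqrt_atTop.comp tendsto_natCast_atTop_atTop)).const_mul (2 ^ j : ℝ)
  rw [mul_zero] at h
  refine h.congr fun n => ?_
  simp only [Function.comp_apply, Real.log_sqrt (Nat.cast_nonneg n)]
  rw [one_mul, add_zero, div_pow]
  field_simp

lemma tendsto_one_div_sqrt : Tendsto (fun n : ℕ => 1 / √(n : ℝ)) atTop (𝓝 0) := by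
  simpa only [pow_zero] using tendsto_log_pow_div_sqrt 0

lemma tendsto_sq_mul_exp_neg {x : ℝ} (hx : 0 < x) :
    Tendsto (fun n : ℕ => (n : ℝ) ^ 2 * Real.exp (-(x * n))) atTop (𝓝 0) := by
  have h := (tendsto_rpow_mul_exp_neg_mul_atTop_nhds_zero 2 x hx).comp
    tendsto_natCast_atTop_atTop
  refine h.congr fun n => ?_
  simp only [Function.comp_apply, Real.rpow_two, neg_mul]

lemma eventually_one_le_log : ∀ᶠ n : ℕ in atTop, 1 ≤ Real.log n :=
  (Real.tendsto_log_atTop.comp tendsto_natCast_atTop_atTop).eventually_ge_atTop 1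

variable {A : ℝ}

lemma eventually_burnIn_le (hA : 0 ≤ A) :
    ∀ᶠ n : ℕ in atTop, (burnIn A n : ℝ) ≤ (A + 1) * (n * Real.log n) := by
  filter_upwards [eventually_one_le_log, eventually_ge_atTop 1] with n hlog hn
  have hn : (1 : ℝ) ≤ n := Nat.one_le_cast.2 hn
  have hone : 1 ≤ n * Real.log n := one_le_mul_of_one_le_of_one_le hn hlog
  have hceil := Nat.ceil_lt_add_one (mul_nonneg hA (zero_le_one.trans hone))
  unfold burnIn
  linarith

lemma tendsto_burnIn_div_sq_mul_sqrt (hA : 0 ≤ A) :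
    Tendsto (fun n : ℕ => (burnIn A n : ℝ) / n ^ 2 * √(n : ℝ)) atTop (𝓝 0) := by
  have hlim := (tendsto_log_pow_div_sqrt 1).const_mul (A + 1)
  rw [mul_zero] at hlim
  refine squeeze_zero' (.of_forall fun n => by positivity) ?_ hlim
  filter_upwards [eventually_burnIn_le hA, eventually_gt_atTop 0] with n hT hn
  have hn : (0 : ℝ) < n := Nat.cast_pos.2 hn
  calc (burnIn A n : ℝ) / n ^ 2 * √(n : ℝ)
      ≤ (A + 1) * (n * Real.log n) / n ^ 2 * √(n : ℝ) := by gcongr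
    _ = (A + 1) * (Real.log n ^ 1 / √(n : ℝ)) := by
      rw [pow_one]
      field_simp
      rw [Real.sq_sqrt hn.le, mul_comm]

lemma tendsto_burnIn_div_sq (hA : 0 ≤ A) :
    Tendsto (fun n : ℕ => (burnIn A n : ℝ) / n ^ 2) atTop (𝓝 0) := by
  have h := (tendsto_burnIn_div_sq_mul_sqrt hA).mul tendsto_one_div_sqrt
  rw [mul_zero] at h
  refine h.congr' ?_
  filter_upwards [eventually_gt_atTop 0] with n hn
  have : (0 : ℝ) < n := Nat.cast_pos.2 hn
  field_simp

lemma tendsto_burnIn_mul_exp_neg (hA : 0 ≤ A) {x : ℝ} (hx : 0 < x) :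
    Tendsto (fun n : ℕ => (burnIn A n : ℝ) * Real.exp (-(x * n))) atTop (𝓝 0) := by
  have h := (tendsto_burnIn_div_sq hA).mul (tendsto_sq_mul_exp_neg hx)
  rw [mul_zero] at h
  refine h.congr' ?_
  filter_upwards [eventually_gt_atTop 0] with n hn
  have : (0 : ℝ) < n := Nat.cast_pos.2 hn
  field_simp

lemma one_sub_div_pow_burnIn_le {n : ℕ} (hn : 0 < n) {y : ℝ} (hy : 0 ≤ y) (hyn : y ≤ n)
    (hyA : 2 ≤ y * A) : (1 - y / n) ^ burnIn A n ≤ 1 / n ^ 2 := by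
  have hn' : (0 : ℝ) < n := Nat.cast_pos.2 hn
  have hexponent : 2 * Real.log n ≤ burnIn A n * (y / n) :=
    calc 2 * Real.log n ≤ y * A * Real.log n :=
          mul_le_mul_of_nonneg_right hyA (Real.log_natCast_nonneg n)
      _ = A * (n * Real.log n) * (y / n) := by field_simp
      _ ≤ burnIn A n * (y / n) := by
          gcongr
          exact Nat.le_ceil _
  calc (1 - y / n) ^ burnIn A n ≤ Real.exp (-(y / n)) ^ burnIn A n :=
        pow_le_pow_left₀ (sub_nonneg.2 ((div_le_one hn').2 hyn)) (Real.one_sub_le_exp_neg _) _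
    _ = Real.exp (-(burnIn A n * (y / n))) := by rw [← Real.exp_nat_mul, mul_neg]
    _ ≤ Real.exp (-(2 * Real.log n)) := Real.exp_le_exp.2 (neg_le_neg hexponent)
    _ = 1 / n ^ 2 := by
        rw [Real.exp_neg, ← Nat.cast_two, Real.exp_nat_mul, Real.exp_log hn', one_div]

lemma one_sub_div_pow_burnIn_mul_le {n : ℕ} (hn : 0 < n) {y : ℝ} (hy : 0 ≤ y) (hyn : y ≤ n)
    (hyA : 2 ≤ y * A) : (1 - y / n) ^ burnIn A n * n ≤ 1 / n := by
  have hn' : (0 : ℝ) < n := Nat.cast_pos.2 hn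
  calc (1 - y / n) ^ burnIn A n * n ≤ 1 / (n : ℝ) ^ 2 * n :=
        mul_le_mul_of_nonneg_right (one_sub_div_pow_burnIn_le hn hy hyn hyA) hn'.le
    _ = 1 / n := by field_simp

variable {q : ℕ} {β L lam d r a b γ θ : ℝ}

lemma driftError_div_sqrt (n : ℕ) :
    driftError n β (θ / √(n : ℝ)) =
      (β ^ 2 + 2 * β) * Real.exp (2 * β) * (θ + 1 / √(n : ℝ)) * (1 / √(n : ℝ)) := by
  have hn : 1 / (n : ℝ) = 1 / √(n : ℝ) * (1 / √(n : ℝ)) := by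
    rw [one_div_mul_one_div, Real.mul_self_sqrt (Nat.cast_nonneg n)]
  rw [driftError, hn]
  ring

lemma tendsto_driftError : Tendsto (fun n : ℕ => driftError n β (θ / √(n : ℝ))) atTop (𝓝 0) := by
  simp only [driftError_div_sqrt]
  simpa only [mul_zero, add_zero] using
    ((tendsto_one_div_sqrt.const_add θ).const_mul _).mul tendsto_one_div_sqrt

lemma tendsto_ratioFloor :
    Tendsto (fun n : ℕ => ratioFloor n β L lam (θ / √(n : ℝ))) atTop (𝓝 0) := by
  have h := (((tendsto_driftError (β := β) (θ := θ)).const_mul 8).div_const L).add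
    ((tendsto_one_div_atTop_nhds_zero_nat (𝕜 := ℝ)).const_mul (96 / L ^ 2))
  simp only [mul_zero, zero_div, add_zero] at h
  have h := h.div_const (lam * L)
  rw [zero_div] at h
  refine h.congr fun n => ?_
  rw [ratioFloor, div_mul_div_comm, mul_one]

lemma tendsto_burnIn_mul_barrierError (hA : 0 ≤ A) (hL : L ≠ 0) (ha : 0 < a) (hb : 0 < b)
    (hr : 0 < r) : Tendsto (fun n : ℕ => (burnIn A n : ℝ) *
      barrierError n q β L r a b γ (θ / √(n : ℝ))) atTop (𝓝 0) := by
  have hgauss := (tendsto_burnIn_mul_exp_neg hA (by positivity : 0 < a * L ^ 2 / 4)).const_mul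
    (Real.exp (a * γ ^ 2 / 4) * Real.exp 1)
  have hexp := (tendsto_burnIn_mul_exp_neg hA (by positivity : 0 < b * r / 2)).const_mul
    (Real.exp 1)
  have htrans := (tendsto_burnIn_div_sq_mul_sqrt hA).const_mul
    ((4 * q + 4 * q * β * Real.exp (2 * β)) / θ)
  have h := (hgauss.add hexp).add htrans
  simp only [mul_zero, add_zero] at h
  refine h.congr fun n => ?_
  rw [barrierError, one_div_div]
  ring_nf

lemma exists_eventually_isEscapeScale (hlamL : 0 < lam * L) (hr : 0 < r)
    (hd : 0 < d) (hγ : 0 < γ) (hγ_sq : 192 / (lam * L) ≤ γ ^ 2) :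
    ∃ θ > 0, ∀ᶠ n : ℕ in atTop, IsEscapeScale n β L lam d r γ (θ / √(n : ℝ)) := by
  obtain ⟨θ, hθ, hθ_lt⟩ := exists_pos_mul_lt (by positivity : 0 < lam * L / 24 * γ)
    ((β ^ 2 + 2 * β) * Real.exp (2 * β))
  have hslope : Tendsto (fun n : ℕ => (β ^ 2 + 2 * β) * Real.exp (2 * β) * (θ + 1 / √(n : ℝ)))
      atTop (𝓝 ((β ^ 2 + 2 * β) * Real.exp (2 * β) * θ)) := by
    simpa only [add_zero] using (tendsto_one_div_sqrt.const_add θ).const_mul _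
  have hη : Tendsto (fun n : ℕ => θ / √(n : ℝ)) atTop (𝓝 0) := by
    simpa only [mul_one_div, mul_zero] using tendsto_one_div_sqrt.const_mul θ
  refine ⟨θ, hθ, ?_⟩
  filter_upwards [hslope.eventually_le_const hθ_lt, hη.eventually_le_const (pow_pos hr 2),
    tendsto_driftError.eventually_le_const (by positivity : 0 < d * r / 4),
    tendsto_one_div_sqrt.eventually_le_const (by positivity : 0 < γ / 4),
    eventually_ge_atTop ⌈lam * L⌉₊, eventually_gt_atTop 0] with n hslope hη hbelow hsmall hn hpos
  have hpos : (0 : ℝ) < n := Nat.cast_pos.2 hpos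
  refine ⟨hγ, hγ_sq, by positivity, hη, ?_, hbelow, ?_, Nat.ceil_le.1 hn⟩
  · rw [driftError_div_sqrt]
    refine (mul_le_mul_of_nonneg_right hslope (by positivity)).trans_eq ?_
    ring
  · calc 1 / (n : ℝ) = 1 / √(n : ℝ) * (1 / √(n : ℝ)) := by
          rw [one_div_mul_one_div, Real.mul_self_sqrt hpos.le]
      _ ≤ γ / 4 * (1 / √(n : ℝ)) := mul_le_mul_of_nonneg_right hsmall (by positivity)
      _ = γ / (2 * √(n : ℝ)) / 2 := by ring

end Asymptotics

/-! ### Mixing -/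

/-- Starting configurations from which the escape argument applies: all proportions other than the
`k`-th are almost equal, and the `k`-th one is at distance at least `γ / √n` from `c`, on the side
given by the sign `s`. -/
def escapeStart (n : ℕ) {q : ℕ} (k : Fin q) (s c K γ : ℝ) : Set (Config n q) :=
  {σ | l1Dist (proportions σ) (dominated k (proportions σ k)) ≤ K * (Real.log n / √(n : ℝ)) ∧
    1 / (q : ℝ) ≤ proportions σ k ∧ γ / √(n : ℝ) ≤ s * (proportions σ k - c)}

/-- The vanishing part of the bound on the probability that the dynamics started in `escapeStart`
fails to reach the target in time `burnIn A n` and to stay close to it for as long. -/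
def escapeRemainder (q : ℕ) (β L lam r a b γ A K θ ρ C : ℝ) (n : ℕ) : ℝ :=
  Real.exp (-(b * r * n)) + K ^ 2 / θ * (Real.log n ^ 2 / √(n : ℝ)) +
    burnIn A n * barrierError n q β L r a b γ (θ / √(n : ℝ)) +
    1 / ρ * (1 / n ^ 2 * (2 * (L ^ 2 / γ ^ 2 * n + 1)) + ratioFloor n β L lam (θ / √(n : ℝ))) +
    (θ / √(n : ℝ) + burnIn A n / n ^ 2 * C) / ρ

section Mixing

variable {n q : ℕ} {β s c p lam d r a b γ A K θ ρ C δ : ℝ} {k : Fin q} {σ : Config n q}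

lemma transverseSq_le_sq_l1Dist (k : Fin q) (x : Fin q → ℝ) :
    transverseSq k x ≤ l1Dist x (dominated k (x k)) ^ 2 := by
  calc transverseSq k x = ∑ i, |x i - dominated k (x k) i| ^ 2 := by
        simp only [transverseSq, transverse, sq_abs, Pi.sub_apply]
    _ ≤ l1Dist x (dominated k (x k)) ^ 2 :=
        Finset.sum_sq_le_sq_sum_of_nonneg fun _ _ => abs_nonneg _

lemma escapeBarrier_le_of_mem_escapeStart [NeZero n] (ha : 0 ≤ a) (hb : 0 ≤ b) (hγ : 0 ≤ γ)
    (hθ : 0 < θ) (hσ : σ ∈ escapeStart n k s c K γ) :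
    escapeBarrier k s c r a b γ (θ / √(n : ℝ)) σ ≤ Real.exp (-(3 / 4 * (a * γ ^ 2))) +
      Real.exp (-(b * r * n)) + K ^ 2 / θ * (Real.log n ^ 2 / √(n : ℝ)) := by
  obtain ⟨hdist, hlead, hγσ⟩ := hσ
  have hn : (0 : ℝ) < n := Nat.cast_pos.2 (NeZero.pos n)
  refine add_le_add_three ?_ ?_ ?_
  · have hsq : a * γ ^ 2 ≤ a * n * (max (s * (proportions σ k - c)) 0) ^ 2 :=
      calc a * γ ^ 2 = a * n * (γ / √(n : ℝ)) ^ 2 := by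
            rw [div_pow, Real.sq_sqrt hn.le]
            field_simp
        _ ≤ _ := by
            gcongr
            exact hγσ.trans (le_max_left _ _)
    rw [← Real.exp_add, Real.exp_le_exp]
    linarith
  · have hbn : 0 ≤ b * n * (proportions σ k - 1 / q) :=
      mul_nonneg (by positivity) (sub_nonneg.2 hlead)
    rw [Real.exp_le_exp]
    linarith
  · have hsq : transverseSq k (proportions σ) ≤ (K * (Real.log n / √(n : ℝ))) ^ 2 :=
      (transverseSq_le_sq_l1Dist _ _).trans
        (pow_le_pow_left₀ (Finset.sum_nonneg fun _ _ => abs_nonneg _) hdist 2)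
    calc 1 / (θ / √(n : ℝ)) * transverseSq k (proportions σ)
        ≤ 1 / (θ / √(n : ℝ)) * (K * (Real.log n / √(n : ℝ))) ^ 2 := by gcongr
      _ = K ^ 2 / θ * (Real.log n ^ 2 / √(n : ℝ)) := by field_simp

lemma sq_ratio_le_of_mem_escapeStart [NeZero n] {L : ℝ} (hL : 0 ≤ L) (hγ : 0 < γ)
    (hσ : σ ∈ escapeStart n k s c K γ) :
    (L / (s * (proportions σ k - c)) - 1) ^ 2 ≤ 2 * (L ^ 2 / γ ^ 2 * n + 1) := by
  have hn : (0 : ℝ) < n := Nat.cast_pos.2 (NeZero.pos n)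
  have hpos : 0 < γ / √(n : ℝ) := by positivity
  have hsq : (L / (s * (proportions σ k - c))) ^ 2 ≤ L ^ 2 / γ ^ 2 * n :=
    calc (L / (s * (proportions σ k - c))) ^ 2 ≤ (L / (γ / √(n : ℝ))) ^ 2 := by
          have hx := hpos.trans_le hσ.2.2
          gcongr
          exact hσ.2.2
      _ = L ^ 2 / γ ^ 2 * n := by
          rw [div_div_eq_mul_div, div_pow, mul_pow, Real.sq_sqrt hn.le]
          ring
  linarith [sq_nonneg (L / (s * (proportions σ k - c)) + 1)]

lemma tendsto_escapeRemainder {L : ℝ} (hA : 0 ≤ A) (hL : L ≠ 0) (ha : 0 < a) (hb : 0 < b)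
    (hr : 0 < r) : Tendsto (escapeRemainder q β L lam r a b γ A K θ ρ C) atTop (𝓝 0) := by
  have hexp : Tendsto (fun n : ℕ => Real.exp (-(b * r * n))) atTop (𝓝 0) :=
    Real.tendsto_exp_neg_atTop_nhds_zero.comp
      (tendsto_natCast_atTop_atTop.const_mul_atTop (mul_pos hb hr))
  have hone : Tendsto (fun n : ℕ => 1 / (n : ℝ)) atTop (𝓝 0) := tendsto_one_div_atTop_nhds_zero_nat
  have hratio : Tendsto (fun n : ℕ => 1 / (n : ℝ) ^ 2 * (2 * (L ^ 2 / γ ^ 2 * n + 1)))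
      atTop (𝓝 0) := by
    have h := (hone.const_mul (2 * (L ^ 2 / γ ^ 2))).add ((hone.pow 2).const_mul 2)
    norm_num only [mul_zero, add_zero] at h
    refine h.congr' ?_
    filter_upwards [eventually_gt_atTop 0] with n hn
    have : (0 : ℝ) < n := Nat.cast_pos.2 hn
    field_simp
  have hη : Tendsto (fun n : ℕ => θ / √(n : ℝ)) atTop (𝓝 0) := by
    simpa only [mul_one_div, mul_zero] using tendsto_one_div_sqrt.const_mul θ
  have h := (((hexp.add ((tendsto_log_pow_div_sqrt 2).const_mul (K ^ 2 / θ))).add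
    (tendsto_burnIn_mul_barrierError (q := q) (β := β) (γ := γ) (θ := θ) hA hL ha hb hr)).add
    ((hratio.add (tendsto_ratioFloor (β := β) (L := L) (lam := lam)
      (θ := θ))).const_mul (1 / ρ))).add
    ((hη.add ((tendsto_burnIn_div_sq hA).mul_const C)).div_const ρ)
  simp only [mul_zero, zero_mul, add_zero, zero_div] at h
  exact h

lemma pow_burnIn_mulVec_exitBound_le_of_mem_escapeStart [NeZero n] [NeZero q] (hq : 1 < q)
    (hβ : 0 ≤ β) (ht : IsTarget q β s c p lam)
    (hrates : IsEscapeRates q β (s * (p - c)) lam d r a b)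
    (hscale : IsEscapeScale n β (s * (p - c)) lam d r γ (θ / √(n : ℝ))) (hθ : 0 < θ)
    (hA : 2 ≤ lam * (s * (p - c)) * A) (hρ : 0 < ρ) (hC : 0 ≤ C)
    (hσ : σ ∈ escapeStart n k s c K γ) :
    (glauber n q β ^ burnIn A n *ᵥ
        exitBound (targetDist k p) ρ (C / n ^ 2) (burnIn A n)) σ ≤
      Real.exp (-(3 / 4 * (a * γ ^ 2))) +
        escapeRemainder q β (s * (p - c)) lam r a b γ A K θ ρ C n := by
  have hlamL : 0 < lam * (s * (p - c)) := mul_pos ht.lam_pos ht.dist_pos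
  have hbound := glauber_pow_mulVec_le_of_le_targetDist hq hβ ht hrates hscale hρ
    (by positivity : 0 ≤ C / n ^ 2 * burnIn A n)
    (exitBound_mem_Icc (targetDist_nonneg k p) hρ.le (by positivity) (burnIn A n))
    (exitBound_le (targetDist k p) ρ (C / n ^ 2) (burnIn A n)) (burnIn A n) σ
  have hbarrier := escapeBarrier_le_of_mem_escapeStart (r := r) hrates.a_pos.le hrates.b_pos.le
    hscale.γ_pos.le hθ hσ
  have hratio := mul_le_mul
    (one_sub_div_pow_burnIn_le (NeZero.pos n) hlamL.le hscale.mul_le hA)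
    (sq_ratio_le_of_mem_escapeStart ht.dist_pos.le hscale.γ_pos hσ) (sq_nonneg _) (by positivity)
  have hratio' := mul_le_mul_of_nonneg_left hratio (one_div_pos.2 hρ).le
  rw [div_mul_comm C] at hbound
  unfold escapeRemainder
  linarith

lemma eventually_pow_burnIn_mulVec_exitBound_le (hq : 1 < q) (hβ : 0 ≤ β)
    (ht : IsTarget q β s c p lam) (hrates : IsEscapeRates q β (s * (p - c)) lam d r a b)
    (hγ : 0 < γ) (hγ_sq : 192 / (lam * (s * (p - c))) ≤ γ ^ 2)
    (hA : 2 ≤ lam * (s * (p - c)) * A) (hρ : 0 < ρ) (hC : 0 ≤ C) (K : ℝ) {ε : ℝ} (hε : 0 < ε) :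
    ∀ᶠ n : ℕ in atTop, ∀ k : Fin q, ∀ σ ∈ escapeStart n k s c K γ,
      (glauber n q β ^ burnIn A n *ᵥ
        exitBound (targetDist k p) ρ (C / n ^ 2) (burnIn A n)) σ ≤
      Real.exp (-(3 / 4 * (a * γ ^ 2))) + ε := by
  have : NeZero q := ⟨by lia⟩
  have hlamL : 0 < lam * (s * (p - c)) := mul_pos ht.lam_pos ht.dist_pos
  have hA₀ : 0 ≤ A := nonneg_of_mul_nonneg_right (zero_le_two.trans hA) hlamL
  obtain ⟨θ, hθ, hscale⟩ :=
    exists_eventually_isEscapeScale (β := β) hlamL hrates.r_pos hrates.d_pos hγ hγ_sq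
  filter_upwards [hscale, eventually_gt_atTop 0,
    (tendsto_escapeRemainder (q := q) (β := β) (lam := lam) (γ := γ) (K := K) (θ := θ) (ρ := ρ)
      (C := C) hA₀ ht.dist_pos.ne' hrates.a_pos hrates.b_pos hrates.r_pos).eventually_le_const hε]
    with n hscale hn hrem k σ hσ
  have : NeZero n := ⟨hn.ne'⟩
  exact (pow_burnIn_mulVec_exitBound_le_of_mem_escapeStart hq hβ ht hrates hscale hθ hA hρ hC
    hσ).trans (add_le_add_right hrem _)

lemma targetDist_le_of_l1Dist_le (hq : 1 < q)
    (hσ : l1Dist (proportions σ) (dominated k p) ≤ δ) :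
    targetDist k p σ ≤ (1 + 4 * q) * δ ^ 2 := by
  have hcoord (i : Fin q) : |proportions σ i - dominated k p i| ≤ δ :=
    (Finset.single_le_sum (fun j _ => abs_nonneg (proportions σ j - dominated k p j))
      (Finset.mem_univ i)).trans hσ
  have hlead : |proportions σ k - p| ≤ δ := by simpa only [dominated_self] using hcoord k
  have htrans (i : Fin q) : transverse k (proportions σ) i ^ 2 ≤ (2 * δ) ^ 2 := by
    have hdom := (abs_dominated_sub_dominated_le hq k (proportions σ k) p i).trans hlead
    rw [abs_sub_comm] at hdom
    have habs : |transverse k (proportions σ) i| ≤ 2 * δ :=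
      (abs_sub_le _ (dominated k p i) _).trans (by linarith [hcoord i])
    exact sq_le_sq' (abs_le.1 habs).1 (abs_le.1 habs).2
  calc targetDist k p σ ≤ δ ^ 2 + ∑ _i : Fin q, (2 * δ) ^ 2 :=
        add_le_add (sq_le_sq' (abs_le.1 hlead).1 (abs_le.1 hlead).2)
          (Finset.sum_le_sum fun i _ => htrans i)
    _ = (1 + 4 * q) * δ ^ 2 := by
        simp only [Finset.sum_const, Finset.card_univ, Fintype.card_fin, nsmul_eq_mul]
        ring

lemma pow_burnIn_mulVec_exitBound_le_of_l1Dist_le [NeZero n] [NeZero q] (hq : 1 < q) (hρ : 0 < ρ)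
    (hC : 0 ≤ C)
    (hstep : ∀ τ : Config n q, targetDist k p τ < ρ →
      (glauber n q β *ᵥ targetDist k p) τ ≤ targetDist k p τ + C / n ^ 2)
    (hσ : l1Dist (proportions σ) (dominated k p) ≤ δ) :
    (glauber n q β ^ burnIn A n *ᵥ
        exitBound (targetDist k p) ρ (C / n ^ 2) (burnIn A n)) σ ≤
      ((1 + 4 * q) * δ ^ 2 + 2 * (burnIn A n / n ^ 2 * C)) / ρ := by
  refine (pow_mulVec_exitBound_le glauber_mem_rowStochastic (targetDist_nonneg k p) hρ
    (by positivity) hstep (burnIn A n) (burnIn A n) σ).trans ?_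
  refine (exitBound_le _ _ _ _ _).trans (div_le_div_of_nonneg_right ?_ hρ.le)
  refine add_le_add (targetDist_le_of_l1Dist_le hq hσ) (le_of_eq ?_)
  push_cast
  ring

lemma proportionsTV_single_le [NeZero n] [NeZero q] {N E₁ E₂ : ℝ} {e ν : Config n q → ℝ} {T : ℕ}
    (hcoupling : ∀ f : Config n q → ℝ, (∀ τ, f τ ∈ Set.Icc (0 : ℝ) 1) → ∀ σ τ,
      (glauber n q β ^ T *ᵥ f) σ - (glauber n q β ^ T *ᵥ f) τ ≤ N + e σ + e τ)
    (hν : ∀ τ, 0 ≤ ν τ) (hν_sum : ∑ τ, ν τ = 1)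
    (hσ : (glauber n q β ^ T *ᵥ e) σ ≤ E₁)
    (hτ : ∀ τ, ν τ ≠ 0 → (glauber n q β ^ T *ᵥ e) τ ≤ E₂) :
    proportionsTV n q β (Pi.single σ 1) ν (T + T) ≤ N + E₁ + E₂ := by
  have hP : glauber n q β ^ T ∈ rowStochastic ℝ (Config n q) :=
    pow_mem glauber_mem_rowStochastic T
  refine tvOf_vecMul_single_le proportions hν hν_sum fun f hf τ hντ => ?_
  have hdiff := mulVec_sub_le_of_forall_sub_le hP (hcoupling f hf)
  rw [pow_add, ← mulVec_mulVec, abs_sub_le_iff]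
  constructor <;> linarith [hdiff σ τ, hdiff τ σ, hτ τ hντ]

lemma exists_isEscapeRates (hβ : 0 ≤ β) (hβq : β < q) (ht : IsTarget q β s c p lam)
    (hd : 0 < d) (hle_drift : ∀ m ∈ Set.Icc (0 : ℝ) (1 / q), d * (1 / q - m) ≤ drift q β m) :
    ∃ r a b, IsEscapeRates q β (s * (p - c)) lam d r a b := by
  obtain ⟨r, hr, htwo, hcontr⟩ := exists_pos_contraction_radius hβ hβq
  have hlamL : 0 < lam * (s * (p - c)) := mul_pos ht.lam_pos ht.dist_pos
  refine ⟨r, min (1 / 2) (lam * (s * (p - c)) / 8), min 1 (d * r / 4), hr, htwo, hcontr, hd,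
    hle_drift, by positivity, ?_, min_le_right _ _, by positivity, min_le_left _ _,
    min_le_right _ _⟩
  linarith [min_le_left (1 / 2) (lam * (s * (p - c)) / 8)]

lemma eventually_proportionsTV_le_of_mem_escapeStart (hq : 1 < q) (hβ : 0 ≤ β) (hβq : β < q)
    (ht : IsTarget q β s c p lam) (hrates : IsEscapeRates q β (s * (p - c)) lam d r a b) :
    ∃ A > 0, ∀ γ > 0, 192 / (lam * (s * (p - c))) ≤ γ ^ 2 → ∀ (K : ℝ) (δ : ℕ → ℝ),
      Tendsto δ atTop (𝓝 0) → ∀ ε > 0, ∀ᶠ n : ℕ in atTop, ∀ k : Fin q,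
        ∀ σ ∈ escapeStart n k s c K γ, ∀ ν : Config n q → ℝ, (∀ τ, 0 ≤ ν τ) → ∑ τ, ν τ = 1 →
          (∀ τ, ν τ ≠ 0 → l1Dist (proportions τ) (dominated k p) ≤ δ n) →
          proportionsTV n q β (Pi.single σ 1) ν (burnIn A n + burnIn A n) ≤
            Real.exp (-(3 / 4 * (a * γ ^ 2))) + ε := by
  have : NeZero q := ⟨by lia⟩
  have hlamL : 0 < lam * (s * (p - c)) := mul_pos ht.lam_pos ht.dist_pos
  obtain ⟨ρ, hρ, κ, hκ, C, hC, hlocal⟩ := exists_local_coupling hq hβ hβq ht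
  have hκ' : 0 < 1 - κ := sub_pos.2 hκ.2
  set A := 2 / (lam * (s * (p - c))) + 2 / (1 - κ) with hA_def
  have hA : 0 < A := by positivity
  have hA_escape : 2 ≤ lam * (s * (p - c)) * A := by
    rw [hA_def, mul_add, mul_div_cancel₀ _ hlamL.ne']
    exact le_add_of_nonneg_right (by positivity)
  have hA_couple : 2 ≤ (1 - κ) * A := by
    rw [hA_def, mul_add, mul_div_cancel₀ _ hκ'.ne']
    exact le_add_of_nonneg_left (by positivity)
  refine ⟨A, hA, fun γ hγ hγ_sq K δ hδ ε hε => ?_⟩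
  have hstay : Tendsto (fun n : ℕ => 1 / (n : ℝ) +
      ((1 + 4 * q) * δ n ^ 2 + 2 * (burnIn A n / n ^ 2 * C)) / ρ ^ 2) atTop (𝓝 0) := by
    simpa only [zero_pow two_ne_zero, mul_zero, zero_mul, add_zero, zero_div] using
      (tendsto_one_div_atTop_nhds_zero_nat (𝕜 := ℝ)).add
      ((((hδ.pow 2).const_mul _).add
        (((tendsto_burnIn_div_sq hA.le).mul_const C).const_mul 2)).div_const _)
  filter_upwards [hlocal, hstay.eventually_le_const (half_pos hε), eventually_gt_atTop 0,
    eventually_pow_burnIn_mulVec_exitBound_le hq hβ ht hrates hγ hγ_sq hA_escape (pow_pos hρ 2)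
      hC.le K (half_pos hε)] with n hlocal hstay hn hescape k σ hσ ν hν hν_sum hν_near
  have : NeZero n := ⟨hn.ne'⟩
  have hκn : 1 - κ ≤ n := by linarith [hκ.1, (Nat.one_le_cast (α := ℝ)).2 hn]
  have hcontract := one_sub_div_pow_burnIn_mul_le hn hκ'.le hκn hA_couple
  have hTV := proportionsTV_single_le (fun f hf => (hlocal k).2 f hf (burnIn A n)) hν hν_sum
    (hescape k σ hσ) fun τ hτ => pow_burnIn_mulVec_exitBound_le_of_l1Dist_le hq (pow_pos hρ 2)
      hC.le (hlocal k).1 (hν_near τ hτ)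
  linarith

lemma exists_mixing_time (hq : 1 < q) (hβ : 0 ≤ β) (hβq : β < q)
    (ht : IsTarget q β s c p lam) (hd : 0 < d)
    (hle_drift : ∀ m ∈ Set.Icc (0 : ℝ) (1 / q), d * (1 / q - m) ≤ drift q β m) :
    ∃ rate > 0, ∃ C > 0, ∃ γ₀ > 0, ∀ γ ≥ γ₀, ∀ (K : ℝ) (δ : ℕ → ℝ), Tendsto δ atTop (𝓝 0) →
      ∀ᶠ n : ℕ in atTop, ∃ T : ℕ, (T : ℝ) ≤ C * (n * Real.log n) ∧ ∀ k : Fin q,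
        ∀ σ ∈ escapeStart n k s c K γ, ∀ ν : Config n q → ℝ, (∀ τ, 0 ≤ ν τ) → ∑ τ, ν τ = 1 →
          (∀ τ, ν τ ≠ 0 → l1Dist (proportions τ) (dominated k p) ≤ δ n) →
          proportionsTV n q β (Pi.single σ 1) ν T ≤ Real.exp (-(rate * γ ^ 2)) := by
  obtain ⟨r, a, b, hrates⟩ := exists_isEscapeRates hβ hβq ht hd hle_drift
  obtain ⟨A, hA, hmix⟩ := eventually_proportionsTV_le_of_mem_escapeStart hq hβ hβq ht hrates
  have ha := hrates.a_pos
  have hγ₀ : 0 < 192 / (lam * (s * (p - c))) :=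
    div_pos (by norm_num) (mul_pos ht.lam_pos ht.dist_pos)
  refine ⟨a / 2, half_pos ha, 2 * (A + 1), by positivity, √(192 / (lam * (s * (p - c)))),
    Real.sqrt_pos.2 hγ₀, fun γ hγ K δ hδ => ?_⟩
  have hγ_pos : 0 < γ := (Real.sqrt_pos.2 hγ₀).trans_le hγ
  have hgap : Real.exp (-(3 / 4 * (a * γ ^ 2))) < Real.exp (-(a / 2 * γ ^ 2)) := by
    rw [Real.exp_lt_exp]
    linarith [mul_pos ha (pow_pos hγ_pos 2)]
  filter_upwards [hmix γ hγ_pos (Real.sqrt_le_iff.1 hγ).2 K δ hδ _ (sub_pos.2 hgap),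
    eventually_burnIn_le hA.le] with n hmix hT
  refine ⟨burnIn A n + burnIn A n, ?_, fun k σ hσ ν hν hν_sum hν_near => ?_⟩
  · push_cast
    linarith
  · exact (hmix k σ hσ ν hν hν_sum hν_near).trans_eq (add_sub_cancel _ _)

end Mixing

/-- The configurations whose proportions are within `ℓ¹` distance `δ` of `dominated k p`. Both
phases of the theorem are of this form, with `p = 1 / q` and `p = mR q β`. -/
def dominatedPhase (n : ℕ) {q : ℕ} (k : Fin q) (p δ : ℝ) : Set (Config n q) :=
  {σ | l1Dist (proportions σ) (dominated k p) ≤ δ}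

/-- The dynamics started in `escapeStart` with `γ ≥ γ₀` comes, within `C * n * log n` steps, to
total-variation distance at most `exp (-(rate * γ ^ 2))` from the dynamics started from the Potts
measure conditioned on `dominatedPhase`, provided that `n` is large. -/
def IsMixingRate (q : ℕ) (β s c p rate C γ₀ : ℝ) : Prop :=
  ∀ γ ≥ γ₀, ∀ (K : ℝ) (δ : ℕ → ℝ), Tendsto δ atTop (𝓝 0) → ∀ᶠ n : ℕ in atTop, ∀ k : Fin q,
    ∀ σ ∈ escapeStart n k s c K γ, (dominatedPhase n k p (δ n)).Nonempty →
      ∃ T : ℕ, (T : ℝ) ≤ C * (n * Real.log n) ∧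
        proportionsTV n q β (Pi.single σ 1)
          (condOn (pottsMeasure n q β) (dominatedPhase n k p (δ n))) T ≤
            Real.exp (-(rate * γ ^ 2))

section Phases

variable {n q : ℕ} {β s c p lam d rate rate' C C' γ₀ γ₀' : ℝ}

lemma IsMixingRate.mono (h : IsMixingRate q β s c p rate C γ₀) (hrate : rate' ≤ rate)
    (hC : C ≤ C') (hγ₀ : γ₀ ≤ γ₀') : IsMixingRate q β s c p rate' C' γ₀' := by
  intro γ hγ K δ hδ
  filter_upwards [h γ (hγ₀.trans hγ) K δ hδ] with n hn k σ hσ hne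
  obtain ⟨T, hT, hTV⟩ := hn k σ hσ hne
  have hlog : 0 ≤ n * Real.log n := mul_nonneg (Nat.cast_nonneg n) (Real.log_natCast_nonneg n)
  refine ⟨T, hT.trans (mul_le_mul_of_nonneg_right hC hlog), hTV.trans (Real.exp_le_exp.2 ?_)⟩
  exact neg_le_neg (mul_le_mul_of_nonneg_right hrate (sq_nonneg γ))

lemma pottsMeasure_pos [NeZero q] (σ : Config n q) : 0 < pottsMeasure n q β σ :=
  div_pos (Real.exp_pos _)
    (Finset.sum_pos (fun _ _ => Real.exp_pos _) Finset.univ_nonempty)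

lemma exists_isMixingRate (hq : 1 < q) (hβ : 0 ≤ β) (hβq : β < q)
    (ht : IsTarget q β s c p lam) (hd : 0 < d)
    (hle_drift : ∀ m ∈ Set.Icc (0 : ℝ) (1 / q), d * (1 / q - m) ≤ drift q β m) :
    ∃ rate > 0, ∃ C > 0, ∃ γ₀ > 0, IsMixingRate q β s c p rate C γ₀ := by
  have : NeZero q := ⟨by lia⟩
  obtain ⟨rate, hrate, C, hC, γ₀, hγ₀, hmix⟩ := exists_mixing_time hq hβ hβq ht hd hle_drift
  refine ⟨rate, hrate, C, hC, γ₀, hγ₀, fun γ hγ K δ hδ => ?_⟩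
  filter_upwards [hmix γ hγ K δ hδ] with n ⟨T, hT, hmix⟩ k σ hσ hne
  exact ⟨T, hT, hmix k σ hσ _ (condOn_nonneg (fun _ => (pottsMeasure_pos _).le) _)
    (sum_condOn (prob_pos pottsMeasure_pos hne).ne') fun _ => mem_of_condOn_ne_zero⟩

lemma IsTarget.mul_le_drift_of_le_one_div (hq : q ≠ 0) (ht : IsTarget q β (-1) c (1 / q) lam)
    {m : ℝ} (hm : m ∈ Set.Icc (0 : ℝ) (1 / q)) :
    lam * (c - 1 / q) * (1 / q - m) ≤ drift q β m := by
  have hc := ht.one_div_lt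
  rcases hm.2.eq_or_lt with rfl | hlt
  · rw [sub_self, mul_zero, drift_one_div hq]
  · have hdrift := ht.drift_le m ⟨hm.1, hm.2.trans ht.le_one⟩ (by linarith)
    rw [sq, ← mul_assoc] at hdrift
    refine le_trans ?_ (le_of_mul_le_mul_right hdrift (sub_pos.2 hlt))
    gcongr
    · exact ht.lam_pos.le
    · linarith

lemma disPhase_eq_dominatedPhase (hq : 1 < q) (k : Fin q) (δ : ℝ) :
    disPhase n q δ = dominatedPhase n k (1 / q) δ := by
  have hq' : (1 : ℝ) < q := Nat.one_lt_cast.2 hq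
  have hconst : dominated k (1 / (q : ℝ)) = fun _ => 1 / (q : ℝ) := by
    funext i
    rcases eq_or_ne i k with rfl | hi
    · exact dominated_self i _
    · have : (q : ℝ) - 1 ≠ 0 := (sub_pos.2 hq').ne'
      rw [dominated_of_ne hi]
      field_simp
  rw [disPhase, dominatedPhase, hconst]

lemma exists_isMixingRate_one_div_and_mR (hq : 1 < q) (hβ : β ∈ Set.Ioo (betaU q) (betaS q)) :
    ∃ rate > 0, ∃ C > 0, ∃ γ₀ > 0, IsMixingRate q β (-1) (mStar q β) (1 / q) rate C γ₀ ∧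
      IsMixingRate q β 1 (mStar q β) (mR q β) rate C γ₀ := by
  have hβ₀ : 0 ≤ β := (betaU_nonneg hq).trans hβ.1.le
  obtain ⟨lam, hdis⟩ := exists_isTarget_one_div hq hβ
  obtain ⟨_, hord⟩ := exists_isTarget_mR hq hβ
  have hd : 0 < lam * (mStar q β - 1 / q) := mul_pos hdis.lam_pos (sub_pos.2 hdis.one_div_lt)
  have hdrift := fun m => hdis.mul_le_drift_of_le_one_div (m := m) (by lia)
  obtain ⟨c₁, hc₁, C₁, hC₁, γ₁, hγ₁, hmix₁⟩ := exists_isMixingRate hq hβ₀ hβ.2 hdis hd hdrift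
  obtain ⟨c₂, hc₂, C₂, _, γ₂, _, hmix₂⟩ := exists_isMixingRate hq hβ₀ hβ.2 hord hd hdrift
  exact ⟨min c₁ c₂, lt_min hc₁ hc₂, max C₁ C₂, lt_max_of_lt_left hC₁, max γ₁ γ₂,
    lt_max_of_lt_left hγ₁,
    hmix₁.mono (min_le_left _ _) (le_max_left _ _) (le_max_left _ _),
    hmix₂.mono (min_le_right _ _) (le_max_right _ _) (le_max_right _ _)⟩

end Phases

end

end MeanFieldPotts

theorem mainTheorem6 (q : ℕ) (hq : 2 < q) (β : ℝ)
    (hβ : β ∈ Set.Ioo (MeanFieldPotts.betaU q) (MeanFieldPotts.betaS q)) :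
    ∃ c > (0 : ℝ), ∃ C > (0 : ℝ), ∃ γ₀ > (0 : ℝ),
      ∀ γ : ℝ, γ₀ ≤ γ → ∀ K : ℝ, ∀ δ : ℕ → ℝ, Filter.Tendsto δ Filter.atTop (nhds 0) →
      ∀ᶠ n : ℕ in Filter.atTop, ∀ (k : Fin q) (σ₀ : MeanFieldPotts.Config n q),
        MeanFieldPotts.l1Dist (MeanFieldPotts.proportions σ₀)
            (MeanFieldPotts.dominated k (MeanFieldPotts.proportions σ₀ k))
          ≤ K * (Real.log n / √(n : ℝ)) →
        (1 / (q : ℝ) < MeanFieldPotts.proportions σ₀ k →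
          MeanFieldPotts.proportions σ₀ k ≤ MeanFieldPotts.mStar q β - γ / √(n : ℝ) →
          (MeanFieldPotts.disPhase n q (δ n)).Nonempty →
          ∃ T : ℕ, (T : ℝ) ≤ C * (n * Real.log n) ∧
            MeanFieldPotts.proportionsTV n q β (Pi.single σ₀ 1)
              (MeanFieldPotts.piDis n q β (δ n)) T ≤ Real.exp (-(c * γ ^ 2))) ∧
        (MeanFieldPotts.mStar q β + γ / √(n : ℝ) ≤ MeanFieldPotts.proportions σ₀ k →
          (MeanFieldPotts.ordPhase n q β k (δ n)).Nonempty →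
          ∃ T : ℕ, (T : ℝ) ≤ C * (n * Real.log n) ∧
            MeanFieldPotts.proportionsTV n q β (Pi.single σ₀ 1)
              (MeanFieldPotts.piOrd n q β k (δ n)) T ≤ Real.exp (-(c * γ ^ 2))) := by
  have hq₁ : 1 < q := by lia
  obtain ⟨c, hc, C, hC, γ₀, hγ₀, hdis, hord⟩ :=
    MeanFieldPotts.exists_isMixingRate_one_div_and_mR hq₁ hβ
  refine ⟨c, hc, C, hC, γ₀, hγ₀, fun γ hγ K δ hδ => ?_⟩
  filter_upwards [hdis γ hγ K δ hδ, hord γ hγ K δ hδ] with n hdis hord k σ₀ hσ₀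
  refine ⟨fun hlo hhi => ?_, fun hlo => hord k σ₀ ⟨hσ₀, ?_, by linarith⟩⟩
  · rw [MeanFieldPotts.piDis, MeanFieldPotts.disPhase_eq_dominatedPhase hq₁ k]
    exact hdis k σ₀ ⟨hσ₀, hlo.le, by linarith⟩
  · have hγn : 0 ≤ γ / √(n : ℝ) := div_nonneg (hγ₀.le.trans hγ) (Real.sqrt_nonneg _)
    linarith [(MeanFieldPotts.mStar_mR_spec hq₁ hβ).1]
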